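/- **Theorem (Relative entropy bound for linear systems).** Let $m\in\mathbb N$, $T>0$, $\varepsilon>0$ and $\Omega=(0,1)$. Let $B\in\mathbb R^{m\times m}$ be diagonal and let $A\in\mathbb R^{m\times m}$ be symmetric positive definite with smallest eigenvalue $1$. Consider the system $$\partial_t u+B\,\partial_x u=\varepsilon A\,\partial_{xx}u \tag{1}$$ and the perturbed system $$\partial_t \hat u+B\,\partial_x \hat u=\varepsilon A\,\partial_{xx}\hat u+r_1+\varepsilon r_2, \tag{2}$$ where $r_1\in L^1(0,T;L^2(\Omega;\mathbb R^m))$ and $r_2\in L^2(0,T;H^{-1}(\Omega;\mathbb R^m))$. Here $H^{-1}(\Omega;\mathbb R^m)$ is the dual of $H^1_0(\Omega;\mathbb R^m)$, with the dual norm with respect to $\|\varphi\|_{H^1}=(\|\varphi\|_{L^2}^2+\|\partial_x\varphi\|_{L^2}^2)^{1/2}$. Let $\eta(u)=\tfrac12|u|^2$ and $q(u)=\tfrac12\,u\cdot Bu$. Let $u\in L^2(0,T;H^1(\Omega;\mathbb R^m))$ be an entropy solution of (1) for $(\eta,q)$ with initial data $u_0\in H^1(\Omega;\mathbb R^m)$.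 That is, $u\in L^\infty((0,T)\times\Omega;\mathbb R^m)$, $\varepsilon A\partial_xu\in L^1((0,T)\times\Omega;\mathbb R^m)$, $\varepsilon\,\partial_x u\cdot A\partial_x u\in W^{-1,1}((0,T)\times\Omega)$, $$\int_0^T\!\!\int_\Omega \partial_t\phi\cdot u+\partial_x\phi\cdot(Bu-\varepsilon A\partial_xu)\,dx\,dt+\int_\Omega u_0\cdot\phi(0,\cdot)\,dx=0$$ for all $\phi\in C_0^\infty([0,T)\times\Omega;\mathbb R^m)$, and $$\int_0^T\!\!\int_\Omega \partial_t\Phi\,\eta(u)+\partial_x\Phi\,(q(u)-\varepsilon\, u\cdot A\partial_xu)-\varepsilon\,\Phi\,\partial_xu\cdot A\partial_xu\,dx\,dt+\int_\Omega\Phi(0,\cdot)\,\eta(u_0)\,dx\ge0$$ for all $0\le\Phi\in C_0^\infty([0,T)\times\Omega)$. Assume also that for almost every $t\in(0,T)$ the trace of $u(t,\cdot)$ on $\partial\Omega$ is $g_D(t,\cdot)$, where $g_D\in W^{1,\infty}((0,T)\times\partial\Omega;\mathbb R^m)$. Let $\hat u\in W^{1,\infty}((0,T)\times\Omega;\mathbb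 R^m)$ (that is, Lipschitz continuous) be a solution of (2) with initial data $\hat u_0\in W^{1,\infty}(\Omega;\mathbb R^m)$ and the same boundary data $g_D$. That is, $\hat u(0,\cdot)=\hat u_0$, $\hat u=g_D$ on $(0,T)\times\partial\Omega$, and $$\int_0^T\!\!\int_\Omega \partial_t\phi\cdot \hat u+\partial_x\phi\cdot(B\hat u-\varepsilon A\partial_x\hat u)+r_1\cdot\phi\,dx\,dt+\varepsilon\int_0^T\langle r_2(t),\phi(t,\cdot)\rangle\,dt+\int_\Omega \hat u_0\cdot\phi(0,\cdot)\,dx=0$$ for all $\phi\in C_0^\infty([0,T)\times\Omega;\mathbb R^m)$. Then for almost all $t\in(0,T)$, $$\tfrac14\|u-\hat u\|^2_{L^\infty(0,t;L^2(\Omega))}+\tfrac{\varepsilon}{2}\|\partial_xu-\partial_x\hat u\|^2_{L^2((0,t)\times\Omega)}\le\|u_0-\hat u_0\|^2_{L^2(\Omega)}+4\|r_1\|^2_{L^1(0,t;L^2(\Omega))}+\varepsilon\|r_2\|^2_{L^2(0,t;H^{-1}(\Omega))}.$$ -/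

import Mathlib

open Set MeasureTheory
open scoped ENNReal ContDiff

namespace ConvDiff

/-- The state space `ℝᵐ` with its Euclidean norm. -/
abbrev Vec (m : ℕ) : Type := EuclideanSpace ℝ (Fin m)

/-- The spatial domain `Ω = (0,1)`. -/
def Om : Set ℝ := Ioo 0 1

/-- The space-time cylinder `(0,T) × Ω`. -/
def cyl (T : ℝ) : Set (ℝ × ℝ) := Ioo 0 T ×ˢ Om

/-- `φ ∈ C_c^∞(O; F)`: smooth, with compact support contained in `O`. -/
structure IsTest {X F : Type*} [NormedAddCommGroup X] [NormedSpace ℝ X]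
    [NormedAddCommGroup F] [NormedSpace ℝ F] (O : Set X) (φ : X → F) : Prop where
  smooth : ContDiff ℝ ∞ φ
  compact : HasCompactSupport φ
  supp : tsupport φ ⊆ O

/-- `φ ∈ C_0^∞([0,T) × Ω; F)`, written `φ t x`: the restriction to `t ≥ 0` of a smooth function on
`ℝ × ℝ` with compact support in `(-∞,T) × Ω`; so `φ` need not vanish at `t = 0`. -/
def IsSTTest {F : Type*} [NormedAddCommGroup F] [NormedSpace ℝ F] (T : ℝ) (φ : ℝ → ℝ → F) : Prop :=
  IsTest (Iio T ×ˢ Om) (Function.uncurry φ)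

section Slices

variable {F : Type*} [NormedAddCommGroup F] [NormedSpace ℝ F]

theorem IsTest.zero {O : Set ℝ} : IsTest O (0 : ℝ → F) :=
  ⟨contDiff_const, HasCompactSupport.zero, by simp [tsupport]⟩

theorem IsTest.add {O : Set ℝ} {φ ψ : ℝ → F} (h : IsTest O φ) (k : IsTest O ψ) :
    IsTest O (φ + ψ) :=
  ⟨h.smooth.add k.smooth, h.compact.add k.compact,
    (tsupport_add φ ψ).trans (union_subset h.supp k.supp)⟩

theorem IsTest.smul {O : Set ℝ} {φ : ℝ → F} (c : ℝ) (h : IsTest O φ) : IsTest O (c • φ) :=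
  ⟨contDiff_const.smul h.smooth, h.compact.smul_left (f := fun _ => c),
    (closure_mono (Function.support_const_smul_subset c φ)).trans h.supp⟩

theorem IsTest.memLp {O : Set ℝ} {φ : ℝ → F} (h : IsTest O φ) (p : ℝ≥0∞) :
    MemLp φ p (volume.restrict Om) :=
  (h.smooth.continuous.memLp_of_hasCompactSupport h.compact).restrict _

theorem IsTest.deriv_memLp {O : Set ℝ} {φ : ℝ → F} (h : IsTest O φ) (p : ℝ≥0∞) :
    MemLp (deriv φ) p (volume.restrict Om) :=
  ((h.smooth.continuous_deriv (by simp)).memLp_of_hasCompactSupport h.compact.deriv).restrict _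

/-- Time slices of space-time test functions are test functions on `Ω`. -/
theorem IsSTTest.slice {T : ℝ} {φ : ℝ → ℝ → F} (h : IsSTTest T φ) (t : ℝ) :
    IsTest Om (φ t) := by
  have hsub : tsupport (φ t) ⊆ (fun x : ℝ => (t, x)) ⁻¹' tsupport (Function.uncurry φ) := by
    refine closure_minimal (fun x hx => ?_) ((isClosed_tsupport _).preimage (by fun_prop))
    exact subset_tsupport _ (by simpa [Function.uncurry] using hx)
  refine ⟨?_, ?_, fun x hx => (h.supp (hsub hx)).2⟩
  · exact h.smooth.comp (contDiff_const.prodMk contDiff_id)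
  · refine (h.compact.isCompact.image continuous_snd).of_isClosed_subset (isClosed_tsupport _) ?_
    exact fun x hx => ⟨(t, x), hsub hx, rfl⟩

end Slices

/-! ### Sobolev spaces on `Ω` -/

/-- `dw` is the weak derivative of `w` on `Ω`. -/
def HasWeakDeriv {m : ℕ} (w dw : ℝ → Vec m) : Prop :=
  ∀ φ : ℝ → ℝ, IsTest Om φ → ∫ x in Om, deriv φ x • w x = - ∫ x in Om, φ x • dw x

/-- `w ∈ H¹(Ω; ℝᵐ)`. -/
def MemH1 {m : ℕ} (w : ℝ → Vec m) : Prop :=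
  MemLp w 2 (volume.restrict Om) ∧
    ∃ dw : ℝ → Vec m, MemLp dw 2 (volume.restrict Om) ∧ HasWeakDeriv w dw

/-- `u ∈ L²(0,T; H¹(Ω; ℝᵐ))`, with weak space derivative `du = ∂ₓu`. -/
structure MemL2H1 {m : ℕ} (T : ℝ) (u du : ℝ → ℝ → Vec m) : Prop where
  memLp : MemLp (Function.uncurry u) 2 (volume.restrict (cyl T))
  memLp_deriv : MemLp (Function.uncurry du) 2 (volume.restrict (cyl T))
  weakDeriv : ∀ᵐ t ∂(volume.restrict (Ioo 0 T)), HasWeakDeriv (u t) (du t)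

/-- The boundary trace of `w ∈ H¹(Ω; ℝᵐ)` is `g` (on `∂Ω = {0,1}`): the continuous representative
of `w` on `[0,1]` takes the values `g 0` and `g 1` at the end points. -/
def HasTrace {m : ℕ} (w g : ℝ → Vec m) : Prop :=
  ∃ W : ℝ → Vec m, ContinuousOn W (Icc 0 1) ∧ W =ᵐ[volume.restrict Om] w ∧
    ∀ x ∈ frontier Om, W x = g x

/-- The ambient Hilbert space `L²(Ω;ℝᵐ) × L²(Ω;ℝᵐ)` of pairs `(w, ∂ₓw)`, with norm
`(‖w‖² + ‖∂ₓw‖²)^{1/2}`. -/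
abbrev L2Pair (m : ℕ) : Type :=
  WithLp 2 (Lp (Vec m) 2 (volume.restrict Om) × Lp (Vec m) 2 (volume.restrict Om))

/-- The pair `(φ, φ')` of a test function `φ`. -/
noncomputable def testPair {m : ℕ} (φ : ℝ → Vec m) (h : IsTest Om φ) : L2Pair m :=
  WithLp.toLp 2 ((h.memLp 2).toLp φ, (h.deriv_memLp 2).toLp (deriv φ))

/-- The image of `C_c^∞(Ω; ℝᵐ)` under `φ ↦ (φ, φ')`. -/
noncomputable def testSubmodule (m : ℕ) : Submodule ℝ (L2Pair m) where
  carrier := {p | ∃ (φ : ℝ → Vec m) (h : IsTest Om φ), p = testPair φ h}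
  zero_mem' := by
    refine ⟨0, IsTest.zero, ?_⟩
    have h0 : deriv (0 : ℝ → Vec m) = 0 := by
      funext x
      simp [Pi.zero_def]
    simp only [testPair, h0]
    rfl
  add_mem' := by
    rintro _ _ ⟨φ, h, rfl⟩ ⟨ψ, k, rfl⟩
    refine ⟨φ + ψ, h.add k, ?_⟩
    have hd : deriv (φ + ψ) = deriv φ + deriv ψ := by
      funext x
      exact deriv_add (h.smooth.differentiable (by simp) x) (k.smooth.differentiable (by simp) x)
    simp only [testPair, hd]
    rfl
  smul_mem' := by
    rintro c _ ⟨φ, h, rfl⟩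
    refine ⟨c • φ, h.smul c, ?_⟩
    have hd : deriv (c • φ) = c • deriv φ := by
      funext x
      exact deriv_const_smul c (h.smooth.differentiable (by simp) x)
    simp only [testPair, hd]
    rfl

/-- `H¹₀(Ω; ℝᵐ)`: the closure of `C_c^∞(Ω; ℝᵐ)` in the `H¹` norm. -/
noncomputable abbrev H10 (m : ℕ) : Type := (testSubmodule m).topologicalClosure

/-- `H⁻¹(Ω; ℝᵐ)`: the dual of `H¹₀(Ω; ℝᵐ)`, with the dual norm. -/
noncomputable abbrev Hneg1 (m : ℕ) : Type := StrongDual ℝ (H10 m)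

/-- A test function on `Ω` as an element of `H¹₀(Ω; ℝᵐ)`. -/
noncomputable def toH10 {m : ℕ} (φ : ℝ → Vec m) (h : IsTest Om φ) : H10 m :=
  ⟨testPair φ h, Submodule.le_topologicalClosure _ ⟨φ, h, rfl⟩⟩

/-- The norm of `L^p(0,t; L²(Ω; ℝᵐ))`. -/
noncomputable def normLpL2 {m : ℕ} (p : ℝ≥0∞) (t : ℝ) (f : ℝ → ℝ → Vec m) : ℝ≥0∞ :=
  eLpNorm (fun s => eLpNorm (f s) 2 (volume.restrict Om)) p (volume.restrict (Ioo 0 t))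

/-- `f ∈ L^p(0,T; L²(Ω; ℝᵐ))`. -/
def MemLpL2 {m : ℕ} (p : ℝ≥0∞) (T : ℝ) (f : ℝ → ℝ → Vec m) : Prop :=
  AEStronglyMeasurable (Function.uncurry f) (volume.restrict (cyl T)) ∧ normLpL2 p T f < (∞ : ℝ≥0∞)

/-- The locally integrable function `g` belongs to `W^{-1,1}((0,T) × Ω)`: as a distribution,
`g = h₀ - ∂ₜ h₁ - ∂ₓ h₂` with integrable `h₀`, `h₁`, `h₂`. -/
def MemWneg11 (T : ℝ) (g : ℝ → ℝ → ℝ) : Prop :=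
  LocallyIntegrableOn (Function.uncurry g) (cyl T) ∧
  ∃ h₀ h₁ h₂ : ℝ → ℝ → ℝ,
    IntegrableOn (Function.uncurry h₀) (cyl T) ∧ IntegrableOn (Function.uncurry h₁) (cyl T) ∧
    IntegrableOn (Function.uncurry h₂) (cyl T) ∧
    ∀ φ : ℝ → ℝ → ℝ, IsTest (cyl T) (Function.uncurry φ) →
      ∫ t in Ioo 0 T, ∫ x in Om, g t x * φ t x =
        ∫ t in Ioo 0 T, ∫ x in Om,
          (h₀ t x * φ t x + h₁ t x * deriv (fun s => φ s x) t + h₂ t x * deriv (φ t) x)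

/-! ### Weak and entropy solutions of `∂ₜu + ∂ₓf(u) = ε ∂ₓ(A(u) ∂ₓu)`

`du` stands for the weak derivative `∂ₓu`. -/

/-- Weak solutions with initial value `u₀`. -/
structure IsWeakSolution {m : ℕ} (T ε : ℝ) (f : Vec m → Vec m) (A : Vec m → Vec m →L[ℝ] Vec m)
    (u du : ℝ → ℝ → Vec m) (u₀ : ℝ → Vec m) : Prop where
  bounded : MemLp (Function.uncurry u) (∞ : ℝ≥0∞) (volume.restrict (cyl T))
  integrable_diffusion :
    IntegrableOn (Function.uncurry fun t x => ε • A (u t x) (du t x)) (cyl T)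
  weak : ∀ φ : ℝ → ℝ → Vec m, IsSTTest T φ →
    (∫ t in Ioo 0 T, ∫ x in Om,
        (inner ℝ (deriv (fun s => φ s x) t) (u t x)
          + inner ℝ (deriv (φ t) x) (f (u t x) - ε • A (u t x) (du t x))))
      + ∫ x in Om, inner ℝ (u₀ x) (φ 0 x) = 0

/-- Entropy solutions with respect to an entropy/entropy-flux pair `(η, q)`. Here
`fderiv ℝ η u (A(u) ∂ₓu)` is `Dη(u) A(u) ∂ₓu`, and `fderiv ℝ (fderiv ℝ η) u ∂ₓu` is `∂ₓ(Dη(u))`. -/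
structure IsEntropySolution {m : ℕ} (T ε : ℝ) (f : Vec m → Vec m)
    (A : Vec m → Vec m →L[ℝ] Vec m) (η q : Vec m → ℝ)
    (u du : ℝ → ℝ → Vec m) (u₀ : ℝ → Vec m) : Prop
    extends IsWeakSolution T ε f A u du u₀ where
  dissipation_regular : MemWneg11 T fun t x =>
    ε * fderiv ℝ (fderiv ℝ η) (u t x) (du t x) (A (u t x) (du t x))
  entropy : ∀ Φ : ℝ → ℝ → ℝ, IsSTTest T Φ → (∀ t ∈ Ico 0 T, ∀ x ∈ Om, 0 ≤ Φ t x) →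
    0 ≤ (∫ t in Ioo 0 T, ∫ x in Om,
          (deriv (fun s => Φ s x) t * η (u t x)
            + deriv (Φ t) x * (q (u t x) - ε * fderiv ℝ η (u t x) (A (u t x) (du t x)))
            - ε * Φ t x * fderiv ℝ (fderiv ℝ η) (u t x) (du t x) (A (u t x) (du t x))))
        + ∫ x in Om, Φ 0 x * η (u₀ x)

/-- `v` is a Lipschitz continuous solution, with initial value `v₀`, of the perturbed system
`∂ₜv + ∂ₓf(v) = ε ∂ₓ(A(v) ∂ₓv) + r₁ + ε r₂`, in the weak sense. Membership of `v` in
`W^{1,∞}((0,T) × Ω; ℝᵐ)` is Lipschitz continuity (of the continuous representative, extended to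
the closure), and `deriv (v t) x` is `∂ₓv`, which exists almost everywhere. -/
structure IsPerturbedSolution {m : ℕ} (T ε : ℝ) (f : Vec m → Vec m)
    (A : Vec m → Vec m →L[ℝ] Vec m) (r₁ : ℝ → ℝ → Vec m) (r₂ : ℝ → Hneg1 m)
    (v : ℝ → ℝ → Vec m) (v₀ : ℝ → Vec m) : Prop where
  lipschitz : ∃ K, LipschitzOnWith K (Function.uncurry v) (Icc 0 T ×ˢ Icc 0 1)
  initial : ∀ x ∈ Icc (0 : ℝ) 1, v 0 x = v₀ x
  weak : ∀ (φ : ℝ → ℝ → Vec m) (hφ : IsSTTest T φ),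
    (∫ t in Ioo 0 T, ∫ x in Om,
        (inner ℝ (deriv (fun s => φ s x) t) (v t x)
          + inner ℝ (deriv (φ t) x) (f (v t x) - ε • A (v t x) (deriv (v t) x))
          + inner ℝ (r₁ t x) (φ t x)))
      + ε * (∫ t in Ioo 0 T, r₂ t (toH10 (φ t) (hφ.slice t)))
      + ∫ x in Om, inner ℝ (v₀ x) (φ 0 x) = 0

/-- A matrix as an operator on Euclidean space. -/
noncomputable def mulOp {m : ℕ} (M : Matrix (Fin m) (Fin m) ℝ) : Vec m →L[ℝ] Vec m :=
  Matrix.toEuclideanCLM (𝕜 := ℝ) M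

/-- The quadratic entropy `η(u) = ½ ‖u‖²`. -/
noncomputable def quadEntropy {m : ℕ} (u : Vec m) : ℝ := 1 / 2 * ‖u‖ ^ 2

/-- Its entropy flux `q(u) = ½ u · B u`. -/
noncomputable def quadFlux {m : ℕ} (B : Matrix (Fin m) (Fin m) ℝ) (u : Vec m) : ℝ :=
  1 / 2 * inner ℝ u (mulOp B u)

end ConvDiff

/-! Write `v` for the perturbed solution, `w = u - v`, and measure the distance by the relative
entropy `½‖w‖²`. Since the entropy is quadratic and `B` is symmetric, the entropy inequality for
`u`, minus the weak form for `u` tested with `v`, plus the energy identities of `v`, is an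
inequality for `½‖w‖²` (`relative_entropy_cutoff`). It is obtained with test functions `θ(t)χ(x)`;
`v` is only Lipschitz, so it is admitted as a factor of a test function by mollification
(`weak_lipschitz`).

The space cut-off `χ` must then tend to `1`, although `∂ₓχ` blows up near the boundary. Equal
boundary data make `w(t)` vanish there, so `‖w‖² ≤ 2x(1-x)‖∂ₓw‖²`. Hence `χ' w` stays bounded in
`L²` while its support shrinks to nothing, and the flux term disappears (`relative_entropy`).
Removing the time cut-off gives, for almost every `t`, `½‖w(t)‖² + ∫₀ᵗ h ≤ ½‖w(0)‖²`, where `h = ∫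
w·∂ₜv + ε ∂ₓw·A∂ₓu + w·B∂ₓv` (`ae_add_integral_le`).

The perturbed system holds in `H⁻¹` at almost every time (`perturbed_ae`), and `w(t)` lies in `H¹₀`
(`IsH10.exists_mem`). Testing with `w(t)` yields `h = ε∫ ∂ₓw·A∂ₓw + ∫ w·r₁ + ε⟨r₂,w⟩`. Here `A ≥ 1`
gives dissipation `εD` with `D = ‖∂ₓw‖²`, and the Poincaré inequality with constant `1/3` gives
`‖w‖²_{H¹} ≤ (4/3)D`. Young's inequality for the `r₂` term is used twice: once spending all of the
dissipation, at cost `(ε/3)‖r₂‖²`, and once keeping half of it, at cost `(2ε/3)‖r₂‖²`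
(`relative_entropy_rate_bounds`).

With `M` the `L^∞(0,t;L²)` norm of `w` and `R` the `L¹(0,t;L²)` norm of `r₁`, the first version
bounds `½M²` and the second bounds `(ε/2)∫D`. Their sum has `‖w(0)‖² + 2MR + ε‖r₂‖²` on the right,
and `2MR ≤ ¼M² + 4R²` produces exactly the stated constants (`gronwall_L1`). There is no exponential
factor, because no term quadratic in `w` remains on the right. -/

namespace ConvDiff

/-! ### Absolute continuity and integration by parts for vector-valued functions -/

section AbsolutelyContinuous

theorem absolutelyContinuousOnInterval_sum {ι : Type*} (s : Finset ι) {f : ι → ℝ → ℝ} {a b : ℝ}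
    (hf : ∀ i ∈ s, AbsolutelyContinuousOnInterval (f i) a b) :
    AbsolutelyContinuousOnInterval (fun x => ∑ i ∈ s, f i x) a b := by
  classical
  induction s using Finset.induction_on with
  | empty =>
    simpa using (LipschitzWith.const (0 : ℝ)).lipschitzOnWith.absolutelyContinuousOnInterval
  | insert i s hi ih =>
    have h := (hf i (Finset.mem_insert_self i s)).add
      (ih fun j hj => hf j (Finset.mem_insert_of_mem hj))
    have he : (fun x => ∑ j ∈ insert i s, f j x) = f i + fun x => ∑ j ∈ s, f j x := by
      funext x
      simp [Finset.sum_insert hi]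
    rw [he]
    exact h

variable {m : ℕ}

/-- Absolute continuity of vector functions is recorded coordinate by coordinate, so that the
product rule and the fundamental theorem of calculus are needed for real functions only. -/
theorem absolutelyContinuousOnInterval_inner {W V : ℝ → Vec m} {a b : ℝ}
    (hW : ∀ i, AbsolutelyContinuousOnInterval (fun x => W x i) a b)
    (hV : ∀ i, AbsolutelyContinuousOnInterval (fun x => V x i) a b) :
    AbsolutelyContinuousOnInterval (fun x => (inner ℝ (W x) (V x) : ℝ)) a b := by
  have h := absolutelyContinuousOnInterval_sum Finset.univ (fun i _ => (hV i).mul (hW i))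
  have he : (fun x => (inner ℝ (W x) (V x) : ℝ))
      = fun x => ∑ i, ((fun x => V x i) * fun x => W x i) x := by
    funext x
    simp [PiLp.inner_apply]
  rw [he]
  exact h

theorem integral_eq_sub_of_absolutelyContinuous {f f' : ℝ → ℝ} {a b : ℝ} (hab : a ≤ b)
    (hf : AbsolutelyContinuousOnInterval f a b)
    (hd : ∀ᵐ x, x ∈ Ioo a b → HasDerivAt f (f' x) x) :
    ∫ x in Ioo a b, f' x = f b - f a := by
  rw [← hf.integral_deriv_eq_sub, intervalIntegral.integral_of_le hab,
    integral_Ioc_eq_integral_Ioo]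
  refine setIntegral_congr_ae measurableSet_Ioo ?_
  filter_upwards [hd] with x hx hxm
  exact (hx hxm).deriv.symm

/-- Integration by parts for absolutely continuous vector valued functions. -/
theorem integral_inner_add_inner {W V w v : ℝ → Vec m} {a b : ℝ} (hab : a ≤ b)
    (hW : ∀ i, AbsolutelyContinuousOnInterval (fun x => W x i) a b)
    (hV : ∀ i, AbsolutelyContinuousOnInterval (fun x => V x i) a b)
    (hWd : ∀ᵐ x, x ∈ Ioo a b → HasDerivAt W (w x) x)
    (hVd : ∀ᵐ x, x ∈ Ioo a b → HasDerivAt V (v x) x) :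
    ∫ x in Ioo a b, (inner ℝ (W x) (v x) + inner ℝ (w x) (V x) : ℝ)
      = inner ℝ (W b) (V b) - inner ℝ (W a) (V a) := by
  refine integral_eq_sub_of_absolutelyContinuous hab
    (absolutelyContinuousOnInterval_inner hW hV) ?_
  filter_upwards [hWd, hVd] with x h1 h2 hx
  exact (h1 hx).inner ℝ (h2 hx)

theorem ac_coord_of_lipschitz {V : ℝ → Vec m} {K : NNReal} (hV : LipschitzWith K V) (a b : ℝ)
    (i : Fin m) : AbsolutelyContinuousOnInterval (fun x => V x i) a b := by
  have h : LipschitzWith (1 * K) (fun x => V x i) := by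
    refine LipschitzWith.comp (f := fun y : Vec m => y i) ?_ hV
    refine LipschitzWith.of_dist_le_mul fun x y => ?_
    rw [dist_eq_norm, dist_eq_norm]
    simpa using PiLp.norm_apply_le (x - y) i
  exact h.lipschitzOnWith.absolutelyContinuousOnInterval

theorem ac_coord_of_contDiff {V : ℝ → Vec m} (hV : ContDiff ℝ 1 V) (a b : ℝ)
    (i : Fin m) : AbsolutelyContinuousOnInterval (fun x => V x i) a b := by
  refine ContDiffOn.absolutelyContinuousOnInterval (ContDiff.contDiffOn ?_)
  exact (EuclideanSpace.proj (𝕜 := ℝ) i).contDiff.comp hV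

theorem ac_coord_primitive {w : ℝ → Vec m} (hw : Integrable w) (a b : ℝ) (i : Fin m) :
    AbsolutelyContinuousOnInterval (fun x => (∫ y in a..x, w y) i) a b := by
  have h : (fun x => (∫ y in a..x, w y) i) = fun x => ∫ y in a..x, w y i := by
    funext x
    exact ((EuclideanSpace.proj (𝕜 := ℝ) i).intervalIntegral_comp_comm
      (hw.intervalIntegrable)).symm
  rw [h]
  refine IntervalIntegrable.absolutelyContinuousOnInterval_intervalIntegral ?_ (by simp)
  exact ((EuclideanSpace.proj (𝕜 := ℝ) i).integrable_comp hw).intervalIntegrable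

theorem ac_coord_add_const {V : ℝ → Vec m} {a b : ℝ} (c : Vec m)
    (hV : ∀ i, AbsolutelyContinuousOnInterval (fun x => V x i) a b) (i : Fin m) :
    AbsolutelyContinuousOnInterval (fun x => (c + V x) i) a b := by
  have h := ((LipschitzWith.const (c i)).lipschitzOnWith
    (s := uIcc a b)).absolutelyContinuousOnInterval.add (hV i)
  exact h

theorem ac_coord_clm {V : ℝ → Vec m} {a b : ℝ} (L : Vec m →L[ℝ] Vec m)
    (hV : ∀ i, AbsolutelyContinuousOnInterval (fun x => V x i) a b) (i : Fin m) :
    AbsolutelyContinuousOnInterval (fun x => (L (V x)) i) a b := by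
  have h : (fun x => (L (V x)) i) = fun x => ∑ j, (L (EuclideanSpace.single j 1)) i * V x j := by
    funext x
    conv_lhs => rw [← (EuclideanSpace.basisFun (Fin m) ℝ).sum_repr (V x)]
    simp [map_sum, mul_comm]
  rw [h]
  exact absolutelyContinuousOnInterval_sum _ fun j _ => (hV j).const_mul _

theorem ac_coord_smul {V : ℝ → Vec m} {f : ℝ → ℝ} {a b : ℝ}
    (hf : AbsolutelyContinuousOnInterval f a b)
    (hV : ∀ i, AbsolutelyContinuousOnInterval (fun x => V x i) a b) (i : Fin m) :
    AbsolutelyContinuousOnInterval (fun x => (f x • V x) i) a b :=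
  hf.mul (hV i)

end AbsolutelyContinuous

/-! ### Test functions on an interval and the du Bois-Reymond lemma -/

section TestFunctions

theorem exists_Icc_of_isCompact_subset_Ioo {a b : ℝ} (hab : a < b) {K : Set ℝ} (hK : IsCompact K)
    (h : K ⊆ Ioo a b) : ∃ c d, a < c ∧ c ≤ d ∧ d < b ∧ K ⊆ Icc c d := by
  rcases K.eq_empty_or_nonempty with rfl | hne
  · exact ⟨(a + b) / 2, (a + b) / 2, by linarith, le_rfl, by linarith, by simp⟩
  · have h1 := h (hK.sInf_mem hne)
    have h2 := h (hK.sSup_mem hne)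
    exact ⟨sInf K, sSup K, h1.1, csInf_le_csSup hne hK.bddBelow hK.bddAbove, h2.2, fun x hx =>
      ⟨csInf_le hK.bddBelow hx, le_csSup hK.bddAbove hx⟩⟩

/-- The primitive started to the left of the support vanishes on the left by construction and on the
right because the total integral is zero. -/
theorem IsTest.exists_primitive {a b : ℝ} (hab : a < b) {g : ℝ → ℝ} (hg : IsTest (Ioo a b) g)
    (h0 : ∫ x, g x = 0) : ∃ φ : ℝ → ℝ, IsTest (Ioo a b) φ ∧ deriv φ = g := by
  obtain ⟨c, d, hac, hcd, hdb, hK⟩ :=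
    exists_Icc_of_isCompact_subset_Ioo hab hg.compact.isCompact hg.supp
  have hcont : Continuous g := hg.smooth.continuous
  have hint : Integrable g := hcont.integrable_of_hasCompactSupport hg.compact
  have hz : ∀ x, x ∉ Icc c d → g x = 0 := fun x hx => image_eq_zero_of_notMem_tsupport
    fun h => hx (hK h)
  have hder : ∀ x, HasDerivAt (fun x => ∫ y in c..x, g y) (g x) x := fun x =>
    intervalIntegral.integral_hasDerivAt_right hint.intervalIntegrable
      (hcont.stronglyMeasurableAtFilter _ _) hcont.continuousAt
  have hderiv : deriv (fun x => ∫ y in c..x, g y) = g := funext fun x => (hder x).deriv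
  have hsupp : tsupport (fun x => ∫ y in c..x, g y) ⊆ Icc c d := by
    refine closure_minimal (fun x hx => ?_) isClosed_Icc
    by_contra hxn
    apply hx
    rcases lt_or_ge x c with hxc | hxc
    · refine intervalIntegral.integral_zero_ae (ae_of_all _ fun y hy => ?_)
      rw [uIoc_of_ge hxc.le] at hy
      rcases hy.2.lt_or_eq with h | h
      · exact hz y fun h' => absurd h'.1 (not_le.2 h)
      -- Only `y = c` is left. If `g c ≠ 0`, continuity makes `g` nonzero slightly to the left of
      -- `c`, outside its support.
      · by_contra hne
        have hopen : IsOpen (Function.support g) := hcont.isOpen_support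
        obtain ⟨ε, hε, hball⟩ := Metric.isOpen_iff.1 hopen y hne
        have : y - ε / 2 ∈ Function.support g := hball (by simp [abs_of_pos hε]; linarith)
        exact this (hz _ fun h' => by linarith [h'.1])
    · have hxd : d < x := by
        by_contra h
        exact hxn ⟨hxc, not_lt.1 h⟩
      show ∫ y in c..x, g y = 0
      rw [intervalIntegral.integral_of_le hxc, ← h0]
      refine setIntegral_eq_integral_of_ae_compl_eq_zero ?_
      have hne : ∀ᵐ y : ℝ, y ≠ c := by simp [ae_iff, measure_singleton]
      filter_upwards [hne] with y hyc hy
      refine hz y fun h' => hy ⟨lt_of_le_of_ne h'.1 hyc.symm, h'.2.trans hxd.le⟩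
  refine ⟨fun x => ∫ y in c..x, g y, ⟨?_, ?_, ?_⟩, hderiv⟩
  · refine contDiff_infty_iff_deriv.2 ⟨fun x => (hder x).differentiableAt, ?_⟩
    rw [hderiv]
    exact hg.smooth
  · exact isCompact_Icc.of_isClosed_subset (isClosed_tsupport _) hsupp
  · exact hsupp.trans fun x hx => ⟨hac.trans_le hx.1, hx.2.trans_lt hdb⟩

theorem exists_isTest_integral_eq_one : ∃ ρ : ℝ → ℝ, IsTest Om ρ ∧ ∫ x, ρ x = 1 := by
  let f : ContDiffBump (1 / 2 : ℝ) := ⟨1 / 8, 1 / 4, by norm_num, by norm_num⟩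
  refine ⟨f.normed volume, ⟨f.contDiff_normed, f.hasCompactSupport_normed, ?_⟩, f.integral_normed⟩
  rw [f.tsupport_normed_eq]
  intro x hx
  rw [Metric.mem_closedBall, Real.dist_eq, abs_le] at hx
  have : f.rOut = 1 / 4 := rfl
  rw [this] at hx
  exact ⟨by linarith [hx.1], by linarith [hx.2]⟩

theorem IsTest.integral_restrict {O : Set ℝ} {F : Type*} [NormedAddCommGroup F] [NormedSpace ℝ F]
    {φ : ℝ → F} (h : IsTest O φ) : ∫ x in O, φ x = ∫ x, φ x :=
  setIntegral_eq_integral_of_forall_compl_eq_zero fun _ hx =>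
    image_eq_zero_of_notMem_tsupport fun h' => hx (h.supp h')

/-- Du Bois-Reymond's lemma. -/
theorem ae_eq_const_of_integral_deriv_smul_eq_zero {m : ℕ} {z : ℝ → Vec m}
    (hz : IntegrableOn z Om)
    (h : ∀ φ : ℝ → ℝ, IsTest Om φ → ∫ x in Om, deriv φ x • z x = 0) :
    ∃ c : Vec m, z =ᵐ[volume.restrict Om] fun _ => c := by
  obtain ⟨ρ, hρ, hρ1⟩ := exists_isTest_integral_eq_one
  have hsm : ∀ {g : ℝ → ℝ}, IsTest Om g → IntegrableOn (fun x => g x • z x) Om := fun {g} hg => by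
    obtain ⟨C, hC⟩ := hg.compact.exists_bound_of_continuous hg.smooth.continuous
    exact hz.bdd_smul C hg.smooth.continuous.aestronglyMeasurable (ae_of_all _ hC)
  refine ⟨∫ x in Om, ρ x • z x, ?_⟩
  set c := ∫ x in Om, ρ x • z x with hc
  have hOm : IsOpen Om := isOpen_Ioo
  have key : ∀ᵐ x, x ∈ Om → z x - c = 0 := by
    refine hOm.ae_eq_zero_of_integral_contDiff_smul_eq_zero ?_ ?_
    · exact (hz.sub (integrableOn_const (by simp [Om]))).locallyIntegrableOn
    · intro g h1 h2 h3
      have hg : IsTest Om g := ⟨h1, h2, h3⟩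
      have hgi : Integrable g := h1.continuous.integrable_of_hasCompactSupport h2
      have hρi : Integrable ρ := hρ.smooth.continuous.integrable_of_hasCompactSupport hρ.compact
      -- Subtracting `(∫ g)ρ` makes the mean zero, so the result is the derivative of a test
      -- function and the hypothesis applies to it.
      have hG : IsTest Om (g + (-(∫ x, g x)) • ρ) := hg.add (hρ.smul _)
      obtain ⟨φ, hφ, hφd⟩ := hG.exists_primitive zero_lt_one (by
        simp only [Pi.add_apply, Pi.smul_apply, smul_eq_mul]
        rw [integral_add hgi (hρi.const_mul _), integral_const_mul, hρ1]
        ring)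
      have h4 := h φ hφ
      rw [hφd] at h4
      simp only [Pi.add_apply, Pi.smul_apply, add_smul, smul_assoc] at h4
      have hI : IntegrableOn (fun x => (-∫ x, g x) • ρ x • z x) Om := by
        have := Integrable.smul (-∫ x, g x) (hsm hρ)
        exact this
      rw [integral_add (hsm hg) hI, integral_smul, ← hc] at h4
      have h5 : ∫ x, g x • (z x - c) = ∫ x in Om, g x • (z x - c) :=
        (setIntegral_eq_integral_of_forall_compl_eq_zero fun x hx => by
          rw [image_eq_zero_of_notMem_tsupport fun h' => hx (h3 h'), zero_smul]).symm
      rw [h5]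
      simp only [smul_sub]
      rw [integral_sub (hsm hg) (hgi.integrableOn.smul_const c), integral_smul_const,
        hg.integral_restrict, ← h4]
      simp [sub_eq_add_neg]
  rw [Filter.EventuallyEq, ae_restrict_iff' hOm.measurableSet]
  filter_upwards [key] with x hx hxm
  exact sub_eq_zero.1 (hx hxm)

end TestFunctions


/-! ### One-dimensional Sobolev functions, traces, and `H¹₀` -/

section Sobolev

variable {m : ℕ}

theorem measurableSet_Om : MeasurableSet Om := measurableSet_Ioo

instance : IsFiniteMeasure (volume.restrict Om) := ⟨by simp [Om]⟩

theorem frontier_Om : frontier Om = {0, 1} := by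
  rw [Om, frontier_Ioo zero_lt_one]

theorem IsTest.apply_zero {F : Type*} [NormedAddCommGroup F] [NormedSpace ℝ F] {φ : ℝ → F}
    (h : IsTest Om φ) : φ 0 = 0 :=
  image_eq_zero_of_notMem_tsupport fun h' => lt_irrefl _ (h.supp h').1

theorem IsTest.apply_one {F : Type*} [NormedAddCommGroup F] [NormedSpace ℝ F] {φ : ℝ → F}
    (h : IsTest Om φ) : φ 1 = 0 :=
  image_eq_zero_of_notMem_tsupport fun h' => lt_irrefl _ (h.supp h').2

theorem IsTest.hasDerivAt {F : Type*} [NormedAddCommGroup F] [NormedSpace ℝ F] {φ : ℝ → F}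
    {O : Set ℝ} (h : IsTest O φ) (x : ℝ) : HasDerivAt φ (deriv φ x) x :=
  (h.smooth.differentiable (by simp) x).hasDerivAt

theorem IsTest.smul_const {F : Type*} [NormedAddCommGroup F] [NormedSpace ℝ F] {φ : ℝ → ℝ}
    {O : Set ℝ} (h : IsTest O φ) (e : F) : IsTest O (fun x => φ x • e) :=
  ⟨h.smooth.smul contDiff_const, h.compact.smul_right,
    (closure_mono (Function.support_smul_subset_left φ fun _ => e)).trans h.supp⟩

theorem IsTest.deriv_smul_const {F : Type*} [NormedAddCommGroup F] [NormedSpace ℝ F] {φ : ℝ → ℝ}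
    {O : Set ℝ} (h : IsTest O φ) (e : F) :
    deriv (fun x => φ x • e) = fun x => deriv φ x • e :=
  funext fun x => ((h.hasDerivAt x).smul_const e).deriv

theorem IsTest.exists_bound {F : Type*} [NormedAddCommGroup F] [NormedSpace ℝ F] {φ : ℝ → F}
    {O : Set ℝ} (h : IsTest O φ) : ∃ C, ∀ x, ‖φ x‖ ≤ C :=
  h.compact.exists_bound_of_continuous h.smooth.continuous

theorem IsTest.continuous_deriv {F : Type*} [NormedAddCommGroup F] [NormedSpace ℝ F] {φ : ℝ → F}
    {O : Set ℝ} (h : IsTest O φ) : Continuous (deriv φ) := h.smooth.continuous_deriv (by simp)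

theorem IsTest.exists_bound_deriv {F : Type*} [NormedAddCommGroup F] [NormedSpace ℝ F] {φ : ℝ → F}
    {O : Set ℝ} (h : IsTest O φ) : ∃ C, ∀ x, ‖deriv φ x‖ ≤ C :=
  h.compact.deriv.exists_bound_of_continuous h.continuous_deriv

/-- Reduces to the scalar case by taking the inner product with an arbitrary constant vector. -/
theorem integral_eq_sub_of_ac_coord {W w : ℝ → Vec m} {a b : ℝ} (hab : a ≤ b)
    (hW : ∀ i, AbsolutelyContinuousOnInterval (fun x => W x i) a b)
    (hWd : ∀ᵐ x, x ∈ Ioo a b → HasDerivAt W (w x) x) (hw : IntegrableOn w (Ioo a b)) :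
    ∫ x in Ioo a b, w x = W b - W a := by
  refine ext_inner_left ℝ fun e => ?_
  have h := integral_inner_add_inner (W := fun _ => e) (w := 0) hab
    (ac_coord_of_contDiff contDiff_const a b) hW
    (ae_of_all _ fun x _ => hasDerivAt_const x e) hWd
  simp only [Pi.zero_apply, inner_zero_left, add_zero] at h
  rw [integral_inner hw e] at h
  rw [h, inner_sub_right]

/-- The primitive of `w` on `Ω` vanishing at `0`. -/
noncomputable def prim (w : ℝ → Vec m) (x : ℝ) : Vec m := ∫ y in (0 : ℝ)..x, Om.indicator w y

theorem prim_ac {w : ℝ → Vec m} (hw : IntegrableOn w Om) (i : Fin m) :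
    AbsolutelyContinuousOnInterval (fun x => prim w x i) 0 1 :=
  ac_coord_primitive (hw.integrable_indicator measurableSet_Om) 0 1 i

theorem prim_hasDerivAt {w : ℝ → Vec m} (hw : IntegrableOn w Om) :
    ∀ᵐ x, x ∈ Ioo (0 : ℝ) 1 → HasDerivAt (prim w) (w x) x := by
  filter_upwards [_root_.LocallyIntegrable.ae_hasDerivAt_integral
    (hw.integrable_indicator measurableSet_Om).locallyIntegrable] with x hx hxm
  have := hx 0
  rwa [indicator_of_mem (show x ∈ Om from hxm)] at this

theorem continuous_prim {w : ℝ → Vec m} (hw : IntegrableOn w Om) : Continuous (prim w) :=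
  intervalIntegral.continuous_primitive
    (fun _ _ => (hw.integrable_indicator measurableSet_Om).intervalIntegrable) 0

@[simp] theorem prim_zero (w : ℝ → Vec m) : prim w 0 = 0 := by simp [prim]

theorem prim_eq {w : ℝ → Vec m} {x : ℝ} (hx : x ∈ Icc (0 : ℝ) 1) :
    prim w x = ∫ y in Ioo 0 x, w y := by
  rw [prim, intervalIntegral.integral_of_le hx.1, integral_Ioc_eq_integral_Ioo]
  refine setIntegral_congr_fun measurableSet_Ioo fun y hy => ?_
  exact indicator_of_mem (show y ∈ Om from ⟨hy.1, hy.2.trans_le hx.2⟩) w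

theorem IntegrableOn.test_smul {w : ℝ → Vec m} {f : ℝ → ℝ} (hw : IntegrableOn w Om)
    (hf : Continuous f) (hb : ∃ C, ∀ x, ‖f x‖ ≤ C) : IntegrableOn (fun x => f x • w x) Om := by
  obtain ⟨C, hC⟩ := hb
  exact hw.bdd_smul C hf.aestronglyMeasurable (ae_of_all _ hC)

theorem hasWeakDeriv_prim {w : ℝ → Vec m} (hw : IntegrableOn w Om) :
    HasWeakDeriv (prim w) w := by
  intro φ hφ
  rw [eq_neg_iff_add_eq_zero]
  have i1 : IntegrableOn (fun x => deriv φ x • prim w x) Om :=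
    IntegrableOn.test_smul (((continuous_prim hw).integrableOn_Icc (a := 0) (b := 1)).mono_set
      Ioo_subset_Icc_self) hφ.continuous_deriv hφ.exists_bound_deriv
  have i2 : IntegrableOn (fun x => φ x • w x) Om :=
    IntegrableOn.test_smul hw hφ.smooth.continuous hφ.exists_bound
  rw [← integral_add i1 i2]
  refine (integral_eq_sub_of_ac_coord (W := fun x => φ x • prim w x) zero_le_one
    (ac_coord_smul ?_ (prim_ac hw)) ?_ (i1.add i2)).trans ?_
  · exact (hφ.smooth.of_le (by simp)).contDiffOn.absolutelyContinuousOnInterval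
  · filter_upwards [prim_hasDerivAt hw] with x hx hxm
    rw [add_comm]
    exact (hφ.hasDerivAt x).smul (hx hxm)
  · simp [hφ.apply_zero, hφ.apply_one]

/-- The difference of `w` and the primitive of `dw` has weak derivative zero, hence is constant by
du Bois-Reymond. -/
theorem exists_eq_const_add_prim {w dw : ℝ → Vec m} (hw : IntegrableOn w Om)
    (hdw : IntegrableOn dw Om) (h : HasWeakDeriv w dw) :
    ∃ c : Vec m, w =ᵐ[volume.restrict Om] fun x => c + prim dw x := by
  have hp : IntegrableOn (prim dw) Om :=
    ((continuous_prim hdw).integrableOn_Icc (a := 0) (b := 1)).mono_set Ioo_subset_Icc_self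
  obtain ⟨c, hc⟩ := ae_eq_const_of_integral_deriv_smul_eq_zero (z := fun x => w x - prim dw x)
    (hw.sub hp) fun φ hφ => by
      simp only [smul_sub]
      rw [integral_sub (IntegrableOn.test_smul hw hφ.continuous_deriv hφ.exists_bound_deriv)
        (IntegrableOn.test_smul hp hφ.continuous_deriv hφ.exists_bound_deriv), h φ hφ,
        hasWeakDeriv_prim hdw φ hφ, sub_self]
  refine ⟨c, ?_⟩
  filter_upwards [hc] with x hx
  rw [← hx, sub_add_cancel]

/-- The representative in the definition of the trace and `c + prim dw` are continuous on `[0,1]`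
and agree almost everywhere, hence everywhere, including the end points. The second conclusion
compares their values at `1`. -/
theorem eq_of_hasTrace {w dw g : ℝ → Vec m} (hw : IntegrableOn w Om)
    (hdw : IntegrableOn dw Om) (h : HasWeakDeriv w dw) (hg : HasTrace w g) :
    (w =ᵐ[volume.restrict Om] fun x => g 0 + prim dw x) ∧ g 1 = g 0 + prim dw 1 := by
  obtain ⟨c, hc⟩ := exists_eq_const_add_prim hw hdw h
  obtain ⟨W, hWc, hW, hWg⟩ := hg
  have hcont : ContinuousOn (fun x => c + prim dw x) (Icc 0 1) :=
    (continuous_const.add (continuous_prim hdw)).continuousOn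
  have heq : EqOn W (fun x => c + prim dw x) (Icc 0 1) := by
    refine Measure.eqOn_Icc_of_ae_eq volume zero_ne_one ?_ hWc hcont
    rw [← restrict_Ioo_eq_restrict_Icc]
    exact hW.trans hc
  have h0 : g 0 = c := by
    rw [← hWg 0 (by simp [frontier_Om]), heq (by simp)]
    simp
  refine ⟨by rwa [h0], ?_⟩
  rw [← hWg 1 (by simp [frontier_Om]), heq (by simp), h0]

/-- `w` has weak derivative `dw ∈ L²` and vanishes on `∂Ω`. -/
structure IsH10 (w dw : ℝ → Vec m) : Prop where
  memLp : MemLp dw 2 (volume.restrict Om)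
  ae_eq : w =ᵐ[volume.restrict Om] prim dw
  prim_one : prim dw 1 = 0

theorem IsH10.integrableOn {w dw : ℝ → Vec m} (h : IsH10 w dw) : IntegrableOn dw Om :=
  h.memLp.integrable one_le_two

/-- This is where equality of the boundary data enters: the value at `0` cancels in the
representation of `w - v` as a primitive, and the value at `1` shows that this primitive vanishes
there. -/
theorem isH10_sub_of_lipschitz {w dw g v : ℝ → Vec m} {K : NNReal} (hw : IntegrableOn w Om)
    (hdw : MemLp dw 2 (volume.restrict Om)) (h : HasWeakDeriv w dw) (hg : HasTrace w g)
    (hv : LipschitzWith K v) (hvg : ∀ x ∈ frontier Om, v x = g x) :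
    IsH10 (fun x => w x - v x) (fun x => dw x - deriv v x) := by
  have hdw' : IntegrableOn dw Om := hdw.integrable one_le_two
  obtain ⟨h1, h2⟩ := eq_of_hasTrace hw hdw' h hg
  have hdv : MemLp (deriv v) ∞ (volume.restrict Om) := by
    refine memLp_top_of_bound (aestronglyMeasurable_deriv v _) K (ae_of_all _ fun x => ?_)
    exact norm_deriv_le_of_lipschitz hv
  have hdv2 : MemLp (deriv v) 2 (volume.restrict Om) := hdv.mono_exponent le_top
  have hdv' : IntegrableOn (deriv v) Om := hdv2.integrable one_le_two
  have hvp : ∀ x ∈ Icc (0 : ℝ) 1, prim (deriv v) x = v x - v 0 := fun x hx => by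
    rw [prim_eq hx]
    refine integral_eq_sub_of_ac_coord hx.1 (ac_coord_of_lipschitz hv 0 x) ?_ ?_
    · filter_upwards [hv.ae_differentiableAt_real] with y hy _ using hy.hasDerivAt
    · exact hdv'.mono_set (Ioo_subset_Ioo_right hx.2)
  have hsub : ∀ x ∈ Icc (0 : ℝ) 1,
      prim (fun x => dw x - deriv v x) x = prim dw x - prim (deriv v) x := fun x hx => by
    rw [prim_eq hx, prim_eq hx, prim_eq hx]
    exact integral_sub (hdw'.mono_set (Ioo_subset_Ioo_right hx.2))
      (hdv'.mono_set (Ioo_subset_Ioo_right hx.2))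
  have hv0 := hvg 0 (by simp [frontier_Om])
  have hv1 := hvg 1 (by simp [frontier_Om])
  refine ⟨hdw.sub hdv2, ?_, ?_⟩
  · filter_upwards [h1, ae_restrict_mem measurableSet_Om] with x hx hxm
    have hxm' : x ∈ Icc (0 : ℝ) 1 := Ioo_subset_Icc_self hxm
    rw [hsub x hxm', hvp x hxm', hx, hv0]
    abel
  · rw [hsub 1 (by simp), hvp 1 (by simp), hv0, hv1, h2]
    abel

/-- Cauchy-Schwarz against the constant `1`, read off from the discriminant of the nonnegative
quadratic `c ↦ ∫ (f - c)²`. -/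
theorem sq_integral_le {μ : Measure ℝ} [IsFiniteMeasure μ] {f : ℝ → ℝ} (hf : MemLp f 2 μ) :
    (∫ x, f x ∂μ) ^ 2 ≤ μ.real univ * ∫ x, f x ^ 2 ∂μ := by
  have h1 : Integrable f μ := hf.integrable one_le_two
  have h2 : Integrable (fun x => f x ^ 2) μ := hf.integrable_sq
  have key : ∀ c : ℝ, 0 ≤ μ.real univ * (c * c) + (-2 * ∫ x, f x ∂μ) * c + ∫ x, f x ^ 2 ∂μ := by
    intro c
    have h3 : 0 ≤ ∫ x, (f x - c) ^ 2 ∂μ := integral_nonneg fun x => sq_nonneg _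
    have h4 : ∀ x, (f x - c) ^ 2 = (f x ^ 2 - 2 * c * f x) + c ^ 2 := fun x => by ring
    simp only [h4] at h3
    have h5 : Integrable (fun x => f x ^ 2 - 2 * c * f x) μ := h2.sub (h1.const_mul _)
    rw [integral_add h5 (integrable_const _), integral_sub h2 (h1.const_mul _), integral_const_mul, integral_const, smul_eq_mul] at h3
    linarith
  have := discrim_le_zero key
  rw [discrim] at this
  linarith

theorem norm_sq_setIntegral_le {w : ℝ → Vec m} {s : Set ℝ} (hs : s ⊆ Om)
    (hw : MemLp w 2 (volume.restrict Om)) {l : ℝ} (hl : volume.real s ≤ l) :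
    ‖∫ x in s, w x‖ ^ 2 ≤ l * ∫ x in Om, ‖w x‖ ^ 2 := by
  have hw' : MemLp w 2 (volume.restrict s) := hw.mono_measure (Measure.restrict_mono hs le_rfl)
  have : IsFiniteMeasure (volume.restrict s) := ⟨by
    simpa using (measure_mono hs).trans_lt (by simp [Om])⟩
  calc ‖∫ x in s, w x‖ ^ 2 ≤ (∫ x in s, ‖w x‖) ^ 2 := by
        gcongr
        exact norm_integral_le_integral_norm _
    _ ≤ volume.real s * ∫ x in s, ‖w x‖ ^ 2 := by
        simpa using sq_integral_le hw'.norm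
    _ ≤ l * ∫ x in Om, ‖w x‖ ^ 2 := by
        refine mul_le_mul hl ?_ (integral_nonneg fun x => sq_nonneg _)
          (measureReal_nonneg.trans hl)
        exact setIntegral_mono_set hw.norm.integrable_sq (ae_of_all _ fun x => sq_nonneg _)
          hs.eventuallyLE

/-- Integrating `dw` from the nearer end point and applying Cauchy-Schwarz gives the factor `min x
(1-x)`, which is at most `2x(1-x)`. This weight serves twice: its integral is the Poincaré constant,
and its decay at the boundary controls the boundary layer of the cut-off. -/
theorem IsH10.prim_sq_le {w dw : ℝ → Vec m} (h : IsH10 w dw) {x : ℝ} (hx : x ∈ Om) :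
    ‖prim dw x‖ ^ 2 ≤ 2 * x * (1 - x) * ∫ y in Om, ‖dw y‖ ^ 2 := by
  have hx' : x ∈ Icc (0 : ℝ) 1 := Ioo_subset_Icc_self hx
  have h1 : prim dw x = ∫ y in Ioo 0 x, dw y := prim_eq hx'
  -- Since the primitive vanishes at `1`, it can also be computed from the right end point.
  have h2 : prim dw x = - ∫ y in Ioo x 1, dw y := by
    have h3 := h.prim_one
    have hi : ∀ a b, IntervalIntegrable (Om.indicator dw) volume a b := fun a b =>
      (h.integrableOn.integrable_indicator measurableSet_Om).intervalIntegrable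
    rw [prim, ← intervalIntegral.integral_add_adjacent_intervals (hi 0 x) (hi x 1)] at h3
    rw [eq_neg_iff_add_eq_zero, ← h3, prim, intervalIntegral.integral_of_le hx'.2,
      integral_Ioc_eq_integral_Ioo]
    congr 1
    refine setIntegral_congr_fun measurableSet_Ioo fun y hy => ?_
    exact (indicator_of_mem (show y ∈ Om from ⟨hx.1.trans hy.1, hy.2⟩) dw).symm
  have hD : 0 ≤ ∫ y in Om, ‖dw y‖ ^ 2 := integral_nonneg fun y => sq_nonneg _
  rcases le_total x (1 / 2) with hm | hm
  · rw [h1]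
    refine (norm_sq_setIntegral_le (Ioo_subset_Ioo_right hx'.2) h.memLp (l := x)
      (by simp [hx'.1])).trans (mul_le_mul_of_nonneg_right ?_ hD)
    nlinarith [hx'.1]
  · rw [h2, norm_neg]
    refine (norm_sq_setIntegral_le (Ioo_subset_Ioo_left hx'.1) h.memLp (l := 1 - x)
      (by simp [hx'.2])).trans (mul_le_mul_of_nonneg_right ?_ hD)
    nlinarith [hx'.2]

theorem IsH10.norm_sq_le {w dw : ℝ → Vec m} (h : IsH10 w dw) :
    ∀ᵐ x ∂(volume.restrict Om), ‖w x‖ ^ 2 ≤ 2 * x * (1 - x) * ∫ y in Om, ‖dw y‖ ^ 2 := by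
  filter_upwards [h.ae_eq, ae_restrict_mem measurableSet_Om] with x hx hxm
  rw [hx]
  exact h.prim_sq_le hxm

/-- A Poincaré inequality on `Ω`. -/
theorem IsH10.integral_sq_le {w dw : ℝ → Vec m} (h : IsH10 w dw) :
    ∫ x in Om, ‖w x‖ ^ 2 ≤ 1 / 3 * ∫ x in Om, ‖dw x‖ ^ 2 := by
  have hpoly : ∫ x in Om, 2 * x * (1 - x) = 1 / 3 := by
    rw [Om, ← integral_Ioc_eq_integral_Ioo, ← intervalIntegral.integral_of_le zero_le_one]
    have h1 : (fun x : ℝ => 2 * x * (1 - x)) = fun x => 2 * x - 2 * x ^ 2 := by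
      funext x
      ring
    rw [h1, intervalIntegral.integral_sub (Continuous.intervalIntegrable (by fun_prop) _ _)
      (Continuous.intervalIntegrable (by fun_prop) _ _)]
    rw [intervalIntegral.integral_const_mul, intervalIntegral.integral_const_mul, integral_id,
      integral_pow]
    norm_num
  have hpi : IntegrableOn (fun x : ℝ => 2 * x * (1 - x)) Om :=
    (Continuous.integrableOn_Icc (a := 0) (b := 1) (by fun_prop)).mono_set Ioo_subset_Icc_self
  rw [← hpoly, ← integral_mul_const]
  exact integral_mono_of_nonneg (ae_of_all _ fun x => sq_nonneg _) (hpi.mul_const _) h.norm_sq_le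

theorem norm_sq_L2Pair (p : L2Pair m) :
    ‖p‖ ^ 2 = (∫ x in Om, ‖p.fst x‖ ^ 2) + ∫ x in Om, ‖p.snd x‖ ^ 2 := by
  rw [WithLp.prod_norm_sq_eq_of_L2]
  have h : ∀ f : Lp (Vec m) 2 (volume.restrict Om), ‖f‖ ^ 2 = ∫ x in Om, ‖f x‖ ^ 2 := fun f => by
    rw [← real_inner_self_eq_norm_sq, L2.inner_def]
    simp only [real_inner_self_eq_norm_sq]
  rw [h, h]

theorem inner_L2Pair (p q : L2Pair m) :
    inner ℝ p q = (∫ x in Om, inner ℝ (p.fst x) (q.fst x))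
      + ∫ x in Om, (inner ℝ (p.snd x) (q.snd x) : ℝ) := by
  rw [WithLp.prod_inner_apply]
  rfl

theorem testPair_fst {φ : ℝ → Vec m} (h : IsTest Om φ) :
    (testPair φ h).fst =ᵐ[volume.restrict Om] φ := (h.memLp 2).coeFn_toLp

theorem testPair_snd {φ : ℝ → Vec m} (h : IsTest Om φ) :
    (testPair φ h).snd =ᵐ[volume.restrict Om] deriv φ := (h.deriv_memLp 2).coeFn_toLp

/-- `H¹₀` is a closure of test functions, whereas `IsH10` describes primitives vanishing at both
ends; this lemma passes from the latter to the former. Instead of approximating, it shows that the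
pair is orthogonal to everything orthogonal to the test pairs. -/
theorem IsH10.exists_mem {w dw : ℝ → Vec m} (h : IsH10 w dw) :
    ∃ p : H10 m, (p : L2Pair m).fst =ᵐ[volume.restrict Om] w ∧
      (p : L2Pair m).snd =ᵐ[volume.restrict Om] dw := by
  have hw : MemLp w 2 (volume.restrict Om) := by
    refine MemLp.ae_eq h.ae_eq.symm ?_
    obtain ⟨C, hC⟩ := (isCompact_Icc (a := (0 : ℝ)) (b := 1)).exists_bound_of_continuousOn
      (continuous_prim h.integrableOn).continuousOn
    refine (memLp_top_of_bound (continuous_prim h.integrableOn).aestronglyMeasurable C ?_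
      ).mono_exponent le_top
    filter_upwards [ae_restrict_mem measurableSet_Om] with x hx
    exact hC x (Ioo_subset_Icc_self hx)
  set p : L2Pair m := WithLp.toLp 2 (hw.toLp w, h.memLp.toLp dw) with hp
  have hp1 : p.fst =ᵐ[volume.restrict Om] w := hw.coeFn_toLp
  have hp2 : p.snd =ᵐ[volume.restrict Om] dw := h.memLp.coeFn_toLp
  refine ⟨⟨p, ?_⟩, hp1, hp2⟩
  rw [← Submodule.orthogonal_orthogonal_eq_closure, Submodule.mem_orthogonal]
  intro q hq
  rw [Submodule.mem_orthogonal] at hq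
  have ha : IntegrableOn q.fst Om := (Lp.memLp q.fst).integrable one_le_two
  have hb : IntegrableOn q.snd Om := (Lp.memLp q.snd).integrable one_le_two
  -- Orthogonality of `q` to all `(φ, φ')` says precisely that `q.fst` is the weak derivative of
  -- `q.snd`.
  have hweak : HasWeakDeriv q.snd q.fst := by
    intro φ hφ
    rw [eq_neg_iff_add_eq_zero]
    refine ext_inner_left ℝ fun e => ?_
    have i1 := IntegrableOn.test_smul hb hφ.continuous_deriv hφ.exists_bound_deriv
    have i2 := IntegrableOn.test_smul ha hφ.smooth.continuous hφ.exists_bound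
    have h1 := hq _ ⟨_, hφ.smul_const e, rfl⟩
    rw [inner_L2Pair] at h1
    rw [inner_add_right, ← integral_inner i1, ← integral_inner i2, inner_zero_right, ← h1, add_comm]
    congr 1
    · refine integral_congr_ae ?_
      filter_upwards [testPair_fst (hφ.smul_const e)] with x hx
      rw [hx, real_inner_smul_left, real_inner_smul_right]
    · refine integral_congr_ae ?_
      filter_upwards [testPair_snd (hφ.smul_const e)] with x hx
      rw [hx, hφ.deriv_smul_const, real_inner_smul_left, real_inner_smul_right]
  obtain ⟨c, hc⟩ := exists_eq_const_add_prim hb ha hweak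
  -- Integration by parts of `prim dw` against `c + prim q.fst`: the boundary terms vanish because
  -- `prim dw` is zero at both ends, so the inner product with `q` is zero.
  have key := integral_inner_add_inner zero_le_one (prim_ac h.integrableOn)
    (ac_coord_add_const c (prim_ac ha)) (prim_hasDerivAt h.integrableOn)
    (by filter_upwards [prim_hasDerivAt ha] with x hx hxm using (hx hxm).const_add c)
  rw [h.prim_one, prim_zero, inner_zero_left, inner_zero_left, sub_zero] at key
  rw [real_inner_comm, inner_L2Pair, ← key, ← integral_add (L2.integrable_inner _ _) (L2.integrable_inner _ _)]
  refine integral_congr_ae ?_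
  filter_upwards [hp1, hp2, hc, h.ae_eq] with x h1 h2 h3 h4
  rw [h1, h2, h3, h4]

end Sobolev


/-! ### Lipschitz functions of `(t,x)`, mollification, and Lipschitz test functions -/

section Lipschitz

open Filter Topology

variable {m : ℕ} {F : Type*} [NormedAddCommGroup F] [NormedSpace ℝ F]

/-- The time derivative. -/
noncomputable def tderiv (v : ℝ → ℝ → F) (z : ℝ × ℝ) : F := deriv (fun s => v s z.2) z.1

/-- The space derivative. -/
noncomputable def xderiv (v : ℝ → ℝ → F) (z : ℝ × ℝ) : F := deriv (v z.1) z.2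

variable {v : ℝ → ℝ → Vec m} {K : NNReal}

theorem lipschitz_fst (hv : LipschitzWith K (Function.uncurry v)) (x : ℝ) :
    LipschitzWith K (fun s => v s x) := by
  have h := hv.comp (LipschitzWith.prodMk_right (α := ℝ) x)
  rwa [mul_one] at h

theorem lipschitz_snd (hv : LipschitzWith K (Function.uncurry v)) (t : ℝ) :
    LipschitzWith K (v t) := by
  have h := hv.comp (LipschitzWith.prodMk_left (β := ℝ) t)
  rwa [mul_one] at h

theorem norm_tderiv_le (hv : LipschitzWith K (Function.uncurry v)) (z : ℝ × ℝ) :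
    ‖tderiv v z‖ ≤ K := norm_deriv_le_of_lipschitz (lipschitz_fst hv z.2)

theorem norm_xderiv_le (hv : LipschitzWith K (Function.uncurry v)) (z : ℝ × ℝ) :
    ‖xderiv v z‖ ≤ K := norm_deriv_le_of_lipschitz (lipschitz_snd hv z.1)

theorem stronglyMeasurable_xderiv (hv : LipschitzWith K (Function.uncurry v)) :
    StronglyMeasurable (xderiv v) :=
  stronglyMeasurable_deriv_with_param hv.continuous

theorem stronglyMeasurable_tderiv (hv : LipschitzWith K (Function.uncurry v)) :
    StronglyMeasurable (tderiv v) := by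
  have h : Continuous (Function.uncurry fun x s => v s x) := hv.continuous.comp continuous_swap
  exact (stronglyMeasurable_deriv_with_param h).comp_measurable measurable_swap

theorem ae_hasDerivAt_tderiv (hv : LipschitzWith K (Function.uncurry v)) :
    ∀ᵐ z : ℝ × ℝ, HasDerivAt (fun s => v s z.2) (tderiv v z) z.1 := by
  filter_upwards [hv.ae_differentiableAt (μ := volume)] with z hz
  have h : DifferentiableAt ℝ (fun s => Function.uncurry v (s, z.2)) z.1 :=
    DifferentiableAt.comp (g := Function.uncurry v) z.1 hz (by fun_prop)
  exact h.hasDerivAt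

theorem ae_hasDerivAt_xderiv (hv : LipschitzWith K (Function.uncurry v)) :
    ∀ᵐ z : ℝ × ℝ, HasDerivAt (v z.1) (xderiv v z) z.2 := by
  filter_upwards [hv.ae_differentiableAt (μ := volume)] with z hz
  have h : DifferentiableAt ℝ (fun y => Function.uncurry v (z.1, y)) z.2 :=
    DifferentiableAt.comp (g := Function.uncurry v) z.2 hz (by fun_prop)
  exact h.hasDerivAt

/-- A sequence of bump functions in the plane shrinking to the origin. -/
noncomputable def bump (n : ℕ) : ContDiffBump (0 : ℝ × ℝ) :=
  ⟨1 / (n + 1), 2 / (n + 1), by positivity, by gcongr; norm_num⟩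

/-- Mollification in the plane. -/
noncomputable def moll (n : ℕ) (g : ℝ × ℝ → Vec m) : ℝ × ℝ → Vec m :=
  convolution ((bump n).normed volume) g (ContinuousLinearMap.lsmul ℝ ℝ) volume

theorem tendsto_bump_rOut : Tendsto (fun n => (bump n).rOut) atTop (𝓝 0) := by
  have h := tendsto_one_div_add_atTop_nhds_zero_nat (𝕜 := ℝ) |>.const_mul 2
  simpa [bump, div_eq_mul_inv] using h

theorem moll_tendsto_ae {g : ℝ × ℝ → Vec m} (hg : LocallyIntegrable g) :
    ∀ᵐ z, Tendsto (fun n => moll n g z) atTop (𝓝 (g z)) := by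
  refine ContDiffBump.ae_convolution_tendsto_right_of_locallyIntegrable (K := 2)
    tendsto_bump_rOut (Eventually.of_forall fun n => le_of_eq ?_) hg
  simp [bump, div_eq_mul_inv]

theorem moll_tendsto {g : ℝ × ℝ → Vec m} (hg : Continuous g) (z : ℝ × ℝ) :
    Tendsto (fun n => moll n g z) atTop (𝓝 (g z)) :=
  ContDiffBump.convolution_tendsto_right_of_continuous tendsto_bump_rOut hg z

theorem contDiff_moll {g : ℝ × ℝ → Vec m} (hg : LocallyIntegrable g) (n : ℕ) :
    ContDiff ℝ ∞ (moll n g) :=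
  (bump n).hasCompactSupport_normed.contDiff_convolution_left _ (bump n).contDiff_normed hg

theorem dist_moll_le {g : ℝ × ℝ → Vec m} (hg : AEStronglyMeasurable g) {C : ℝ} (z : ℝ × ℝ)
    (n : ℕ) (h : ∀ y ∈ Metric.ball z (bump n).rOut, dist (g y) (g z) ≤ C) :
    dist (moll n g z) (g z) ≤ C :=
  ContDiffBump.dist_normed_convolution_le hg h

/-- The factor `3` is crude (distance at most `2C` to a value of norm at most `C`), but any bound
uniform in `n` suffices for dominated convergence. -/
theorem norm_moll_le {g : ℝ × ℝ → Vec m} (hg : AEStronglyMeasurable g) {C : ℝ}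
    (h : ∀ y, ‖g y‖ ≤ C) (n : ℕ) (z : ℝ × ℝ) : ‖moll n g z‖ ≤ 3 * C := by
  have h1 := dist_moll_le (C := 2 * C) hg z n fun y _ => by
    rw [dist_eq_norm]
    linarith [norm_sub_le (g y) (g z), h y, h z]
  rw [dist_eq_norm] at h1
  linarith [norm_sub_norm_le (moll n g z) (g z), h z]

theorem locallyIntegrable_of_bound {g : ℝ × ℝ → Vec m} (hg : AEStronglyMeasurable g) {C : ℝ}
    (h : ∀ y, ‖g y‖ ≤ C) : LocallyIntegrable g :=
  (locallyIntegrable_const C).mono hg (ae_of_all _ fun y => (h y).trans (le_abs_self C))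

/-- Mollification commutes with directional derivatives of Lipschitz functions. -/
theorem hasDerivAt_moll (hv : LipschitzWith K (Function.uncurry v)) (n : ℕ) {e z : ℝ × ℝ}
    {g : ℝ × ℝ → Vec m} (hg : StronglyMeasurable g)
    (hd : ∀ᵐ y : ℝ × ℝ, HasDerivAt (fun r : ℝ => Function.uncurry v (y + r • e)) (g y) 0) :
    HasDerivAt (fun r : ℝ => moll n (Function.uncurry v) (z + r • e)) (moll n g z) 0 := by
  set ρ := (bump n).normed (volume : Measure (ℝ × ℝ)) with hρ
  have hρc : Continuous ρ := (bump n).continuous_normed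
  have hρi : Integrable ρ := hρc.integrable_of_hasCompactSupport (bump n).hasCompactSupport_normed
  have hvc : Continuous (Function.uncurry v) := hv.continuous
  -- Differentiation under the integral with the derivative falling on `v`: difference quotients are
  -- dominated by the Lipschitz bound, so differentiability at almost every point is enough.
  have key := hasDerivAt_integral_of_dominated_loc_of_lip (μ := (volume : Measure (ℝ × ℝ)))
    (F := fun (r : ℝ) (y : ℝ × ℝ) => ρ y • Function.uncurry v (z + r • e - y))
    (F' := fun y => ρ y • g (z - y)) (x₀ := (0 : ℝ)) (s := univ)
    (bound := fun y => ‖ρ y‖ * (K * ‖e‖)) univ_mem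
    (Eventually.of_forall fun r => Continuous.aestronglyMeasurable (by fun_prop)) ?_ ?_ ?_ ?_ ?_
  · have h := key.2
    exact h
  · refine Continuous.integrable_of_hasCompactSupport (by fun_prop) ?_
    exact (bump n).hasCompactSupport_normed.smul_right
  · exact hρc.aestronglyMeasurable.smul
      (hg.comp_measurable (measurable_const.sub measurable_id)).aestronglyMeasurable
  · refine ae_of_all _ fun y => LipschitzOnWith.of_dist_le_mul fun r _ s _ => ?_
    rw [dist_smul₀]
    have h1 := hv.dist_le_mul (z + r • e - y) (z + s • e - y)
    have h2 : dist (z + r • e - y) (z + s • e - y) = dist r s * ‖e‖ := by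
      rw [dist_eq_norm, dist_eq_norm, ← norm_smul, sub_smul]
      congr 1
      abel
    rw [h2] at h1
    have h3 : (0 : ℝ) ≤ ‖ρ y‖ * (K * ‖e‖) := by positivity
    rw [Real.coe_nnabs, abs_of_nonneg h3]
    calc _ ≤ ‖ρ y‖ * (K * (dist r s * ‖e‖)) := by gcongr
      _ = _ := by ring
  · exact hρi.norm.mul_const _
  · have hqmp : Measure.QuasiMeasurePreserving (fun y : ℝ × ℝ => z - y) volume volume :=
      quasiMeasurePreserving_sub_left volume z
    filter_upwards [hqmp.ae hd] with y hy
    have h := hy.const_smul (ρ y)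
    refine h.congr_of_eventuallyEq (Eventually.of_forall fun r => ?_)
    show ρ y • Function.uncurry v (z + r • e - y) = ρ y • Function.uncurry v (z - y + r • e)
    congr 2
    abel

theorem hasDerivAt_moll_fst (hv : LipschitzWith K (Function.uncurry v)) (n : ℕ) (t x : ℝ) :
    HasDerivAt (fun s => moll n (Function.uncurry v) (s, x)) (moll n (tderiv v) (t, x)) t := by
  have h := hasDerivAt_moll hv n (e := (1, 0)) (z := (t, x)) (stronglyMeasurable_tderiv hv) (by
    filter_upwards [ae_hasDerivAt_tderiv hv] with y hy
    have h1 : HasDerivAt (fun r : ℝ => y.1 + r) 1 0 := (hasDerivAt_id 0).const_add y.1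
    have h2 := HasDerivAt.scomp_of_eq (0 : ℝ) hy h1 (by simp)
    simpa [Function.comp_def, Function.uncurry] using h2)
  have h1 : HasDerivAt (fun s : ℝ => s - t) 1 t := (hasDerivAt_id t).sub_const t
  have h2 := HasDerivAt.scomp_of_eq t h h1 (by simp)
  simpa [Function.comp_def] using h2

theorem hasDerivAt_moll_snd (hv : LipschitzWith K (Function.uncurry v)) (n : ℕ) (t x : ℝ) :
    HasDerivAt (fun y => moll n (Function.uncurry v) (t, y)) (moll n (xderiv v) (t, x)) x := by
  have h := hasDerivAt_moll hv n (e := (0, 1)) (z := (t, x)) (stronglyMeasurable_xderiv hv) (by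
    filter_upwards [ae_hasDerivAt_xderiv hv] with y hy
    have h1 : HasDerivAt (fun r : ℝ => y.2 + r) 1 0 := (hasDerivAt_id 0).const_add y.2
    have h2 := HasDerivAt.scomp_of_eq (0 : ℝ) hy h1 (by simp)
    simpa [Function.comp_def, Function.uncurry] using h2)
  have h1 : HasDerivAt (fun s : ℝ => s - x) 1 x := (hasDerivAt_id x).sub_const x
  have h2 := HasDerivAt.scomp_of_eq x h h1 (by simp)
  simpa [Function.comp_def] using h2

theorem isSTTest_smul {T : ℝ} {θ χ : ℝ → ℝ} (hθ : IsTest (Iio T) θ) (hχ : IsTest Om χ)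
    {g : ℝ → ℝ → F} (hg : ContDiff ℝ ∞ (Function.uncurry g)) :
    IsSTTest T (fun t x => (θ t * χ x) • g t x) := by
  have hsub : tsupport (Function.uncurry fun t x => (θ t * χ x) • g t x)
      ⊆ tsupport θ ×ˢ tsupport χ := by
    refine closure_minimal (fun z hz => ?_) ((isClosed_tsupport _).prod (isClosed_tsupport _))
    have hz' : (θ z.1 * χ z.2) • g z.1 z.2 ≠ 0 := hz
    refine ⟨subset_tsupport _ fun h => hz' ?_, subset_tsupport _ fun h => hz' ?_⟩ <;> simp [h]
  refine ⟨?_, ?_, hsub.trans (prod_mono hθ.supp hχ.supp)⟩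
  · exact ((hθ.smooth.comp contDiff_fst).mul (hχ.smooth.comp contDiff_snd)).smul hg
  · exact (hθ.compact.isCompact.prod hχ.compact.isCompact).of_isClosed_subset
      (isClosed_tsupport _) hsub

theorem integral_cyl {T : ℝ} {f : ℝ × ℝ → F} (hf : IntegrableOn f (cyl T)) :
    ∫ t in Ioo 0 T, ∫ x in Om, f (t, x) = ∫ z in cyl T, f z :=
  (setIntegral_prod (μ := volume) (ν := volume) f hf).symm

theorem measurableSet_cyl (T : ℝ) : MeasurableSet (cyl T) := measurableSet_Ioo.prod measurableSet_Om

instance (T : ℝ) : IsFiniteMeasure (volume.restrict (cyl T)) := ⟨by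
  rw [Measure.restrict_apply_univ, cyl, Measure.volume_eq_prod, Measure.prod_prod]
  simp [Om]⟩

theorem integrable_inner_of_bound {α : Type*} [MeasurableSpace α] {μ : Measure α} {a u : α → Vec m}
    (hu : Integrable u μ) (ha : AEStronglyMeasurable a μ) {C : ℝ} (hb : ∀ᵐ z ∂μ, ‖a z‖ ≤ C) :
    Integrable (fun z => (inner ℝ (a z) (u z) : ℝ)) μ := by
  refine (hu.norm.const_mul C).mono' (ha.inner hu.1) ?_
  filter_upwards [hb] with z hz
  exact (norm_inner_le_norm _ _).trans (by gcongr)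

theorem tendsto_integral_inner {α : Type*} [MeasurableSpace α] {μ : Measure α} {a : ℕ → α → Vec m}
    {b u : α → Vec m} (hu : Integrable u μ) (ha : ∀ n, AEStronglyMeasurable (a n) μ) {C : ℝ}
    (hb : ∀ n, ∀ᵐ z ∂μ, ‖a n z‖ ≤ C) (hl : ∀ᵐ z ∂μ, Tendsto (fun n => a n z) atTop (𝓝 (b z))) :
    Tendsto (fun n => ∫ z, (inner ℝ (a n z) (u z) : ℝ) ∂μ) atTop
      (𝓝 (∫ z, inner ℝ (b z) (u z) ∂μ)) := by
  refine tendsto_integral_of_dominated_convergence (fun z => C * ‖u z‖)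
    (fun n => (ha n).inner hu.1) (hu.norm.const_mul C) (fun n => ?_) ?_
  · filter_upwards [hb n] with z hz
    exact (norm_inner_le_norm _ _).trans (by gcongr)
  · filter_upwards [hl] with z hz using hz.inner tendsto_const_nhds

theorem norm_smul_add_smul_le {a b A B C D : ℝ} {x y : F} (ha : ‖a‖ ≤ A) (hb : ‖b‖ ≤ B)
    (hx : ‖x‖ ≤ C) (hy : ‖y‖ ≤ D) : ‖a • x + b • y‖ ≤ A * C + B * D := by
  refine (norm_add_le _ _).trans ?_
  rw [norm_smul, norm_smul]
  have hA := (norm_nonneg _).trans ha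
  have hB := (norm_nonneg _).trans hb
  gcongr

theorem norm_mul_le_of_le' {a b A B : ℝ} (ha : ‖a‖ ≤ A) (hb : ‖b‖ ≤ B) : ‖a * b‖ ≤ A * B := by
  rw [norm_mul]
  have hA := (norm_nonneg _).trans ha
  gcongr

/-- Weak formulations extend to products of cut-off functions and Lipschitz functions. -/
theorem weak_lipschitz {T : ℝ} {u G : ℝ × ℝ → Vec m} {u₀ : ℝ → Vec m}
    (hu : IntegrableOn u (cyl T)) (hG : IntegrableOn G (cyl T)) (hu₀ : IntegrableOn u₀ Om)
    (hw : ∀ φ : ℝ → ℝ → Vec m, IsSTTest T φ →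
      (∫ t in Ioo 0 T, ∫ x in Om, (inner ℝ (deriv (fun s => φ s x) t) (u (t, x))
        + inner ℝ (deriv (φ t) x) (G (t, x)) : ℝ)) + ∫ x in Om, inner ℝ (u₀ x) (φ 0 x) = 0)
    (hv : LipschitzWith K (Function.uncurry v)) {θ χ : ℝ → ℝ} (hθ : IsTest (Iio T) θ)
    (hχ : IsTest Om χ) :
    (∫ z in cyl T, (inner ℝ ((deriv θ z.1 * χ z.2) • v z.1 z.2 + (θ z.1 * χ z.2) • tderiv v z) (u z)
      + inner ℝ ((θ z.1 * deriv χ z.2) • v z.1 z.2 + (θ z.1 * χ z.2) • xderiv v z) (G z) : ℝ))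
      + ∫ x in Om, inner ℝ (u₀ x) ((θ 0 * χ x) • v 0 x) = 0 := by
  have hvc : Continuous (Function.uncurry v) := hv.continuous
  have hvl := hvc.locallyIntegrable (μ := volume)
  have htm := (stronglyMeasurable_tderiv hv).aestronglyMeasurable (μ := volume)
  have hxm := (stronglyMeasurable_xderiv hv).aestronglyMeasurable (μ := volume)
  have htl := locallyIntegrable_of_bound htm (norm_tderiv_le hv)
  have hxl := locallyIntegrable_of_bound hxm (norm_xderiv_le hv)
  obtain ⟨Cθ, hCθ⟩ := hθ.exists_bound
  obtain ⟨Cθ', hCθ'⟩ := hθ.exists_bound_deriv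
  obtain ⟨Cχ, hCχ⟩ := hχ.exists_bound
  obtain ⟨Cχ', hCχ'⟩ := hχ.exists_bound_deriv
  obtain ⟨Cv, hCv⟩ := (isCompact_Icc (a := (0 : ℝ)) (b := T)).prod
    (isCompact_Icc (a := (0 : ℝ)) (b := 1)) |>.exists_bound_of_continuousOn hvc.continuousOn
  -- All mollification radii are at most `2`, so a mollified value differs from `v` by at most `2K`,
  -- uniformly in `n`.
  have hg0 : ∀ n t x, t ∈ Icc 0 T → x ∈ Icc (0 : ℝ) 1 → ‖moll n (Function.uncurry v) (t, x)‖ ≤ Cv + 2 * K := by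
    intro n t x ht hx
    have h1 := dist_moll_le (C := 2 * K) hvc.aestronglyMeasurable (t, x) n fun y hy => by
      refine (hv.dist_le_mul _ _).trans ?_
      have h2 : (bump n).rOut ≤ 2 := by
        show 2 / ((n : ℝ) + 1) ≤ 2
        rw [div_le_iff₀ (by positivity)]
        nlinarith [n.cast_nonneg (α := ℝ)]
      nlinarith [K.2, Metric.mem_ball.1 hy, K.coe_nonneg]
    rw [dist_eq_norm] at h1
    linarith [norm_sub_norm_le (moll n (Function.uncurry v) (t, x)) (Function.uncurry v (t, x)), hCv (t, x) ⟨ht, hx⟩]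
  have hcθ := hθ.smooth.continuous
  have hcχ := hχ.smooth.continuous
  have hcθ' := hθ.continuous_deriv
  have hcχ' := hχ.continuous_deriv
  have hmv : ∀ n, Continuous (moll n (Function.uncurry v)) := fun n => (contDiff_moll hvl n).continuous
  have hmt : ∀ n, Continuous (moll n (tderiv v)) := fun n => (contDiff_moll htl n).continuous
  have hmx : ∀ n, Continuous (moll n (xderiv v)) := fun n => (contDiff_moll hxl n).continuous
  set a : ℕ → ℝ × ℝ → Vec m := fun n z => (deriv θ z.1 * χ z.2) • moll n (Function.uncurry v) z
    + (θ z.1 * χ z.2) • moll n (tderiv v) z with ha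
  set b : ℕ → ℝ × ℝ → Vec m := fun n z => (θ z.1 * deriv χ z.2) • moll n (Function.uncurry v) z
    + (θ z.1 * χ z.2) • moll n (xderiv v) z with hb
  have ham : ∀ n, AEStronglyMeasurable (a n) (volume.restrict (cyl T)) := fun n =>
    Continuous.aestronglyMeasurable (by
      have := hmv n
      have := hmt n
      fun_prop)
  have hbm : ∀ n, AEStronglyMeasurable (b n) (volume.restrict (cyl T)) := fun n =>
    Continuous.aestronglyMeasurable (by
      have := hmv n
      have := hmx n
      fun_prop)
  have hab : ∀ n, ∀ᵐ z ∂(volume.restrict (cyl T)),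
      ‖a n z‖ ≤ Cθ' * Cχ * (Cv + 2 * K) + Cθ * Cχ * (3 * K) := fun n => by
    filter_upwards [ae_restrict_mem (measurableSet_cyl T)] with z hz
    exact norm_smul_add_smul_le (norm_mul_le_of_le' (hCθ' _) (hCχ _))
      (norm_mul_le_of_le' (hCθ _) (hCχ _))
      (hg0 n _ _ (Ioo_subset_Icc_self hz.1) (Ioo_subset_Icc_self hz.2))
      (norm_moll_le htm (norm_tderiv_le hv) n z)
  have hbb : ∀ n, ∀ᵐ z ∂(volume.restrict (cyl T)),
      ‖b n z‖ ≤ Cθ * Cχ' * (Cv + 2 * K) + Cθ * Cχ * (3 * K) := fun n => by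
    filter_upwards [ae_restrict_mem (measurableSet_cyl T)] with z hz
    exact norm_smul_add_smul_le (norm_mul_le_of_le' (hCθ _) (hCχ' _))
      (norm_mul_le_of_le' (hCθ _) (hCχ _))
      (hg0 n _ _ (Ioo_subset_Icc_self hz.1) (Ioo_subset_Icc_self hz.2))
      (norm_moll_le hxm (norm_xderiv_le hv) n z)
  -- The mollified derivatives converge only almost everywhere, at Lebesgue points, while `v` itself
  -- converges everywhere.
  have hla : ∀ᵐ z ∂(volume.restrict (cyl T)), Tendsto (fun n => a n z) atTop
      (𝓝 ((deriv θ z.1 * χ z.2) • v z.1 z.2 + (θ z.1 * χ z.2) • tderiv v z)) := by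
    filter_upwards [ae_restrict_of_ae (moll_tendsto_ae htl)] with z hz
    exact ((moll_tendsto hvc z).const_smul _).add (hz.const_smul _)
  have hlb : ∀ᵐ z ∂(volume.restrict (cyl T)), Tendsto (fun n => b n z) atTop
      (𝓝 ((θ z.1 * deriv χ z.2) • v z.1 z.2 + (θ z.1 * χ z.2) • xderiv v z)) := by
    filter_upwards [ae_restrict_of_ae (moll_tendsto_ae hxl)] with z hz
    exact ((moll_tendsto hvc z).const_smul _).add (hz.const_smul _)
  have hia : ∀ n, IntegrableOn (fun z => (inner ℝ (a n z) (u z) : ℝ)) (cyl T) := fun n =>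
    integrable_inner_of_bound hu (ham n) (hab n)
  have hib : ∀ n, IntegrableOn (fun z => (inner ℝ (b n z) (G z) : ℝ)) (cyl T) := fun n =>
    integrable_inner_of_bound hG (hbm n) (hbb n)
  have hlim1 := tendsto_integral_inner hu ham hab hla
  have hlim2 := tendsto_integral_inner hG hbm hbb hlb
  have hlim3 : Tendsto (fun n => ∫ x in Om, (inner ℝ
      ((θ 0 * χ x) • moll n (Function.uncurry v) (0, x)) (u₀ x) : ℝ)) atTop
      (𝓝 (∫ x in Om, inner ℝ ((θ 0 * χ x) • v 0 x) (u₀ x))) := by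
    rcases lt_or_ge 0 T with hT | hT
    · refine tendsto_integral_inner (C := Cθ * Cχ * (Cv + 2 * K)) hu₀ (fun n =>
        Continuous.aestronglyMeasurable (by
          have := hmv n
          fun_prop)) (fun n => ?_) (ae_of_all _ fun x => ((moll_tendsto hvc (0, x)).const_smul _))
      filter_upwards [ae_restrict_mem measurableSet_Om] with x hx
      rw [norm_smul]
      exact mul_le_mul (norm_mul_le_of_le' (hCθ _) (hCχ _))
        (hg0 n _ _ ⟨le_rfl, hT.le⟩ (Ioo_subset_Icc_self hx)) (norm_nonneg _)
        (mul_nonneg ((norm_nonneg _).trans (hCθ 0)) ((norm_nonneg _).trans (hCχ 0)))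
    -- If `T ≤ 0`, time `0` lies outside the support of `θ` and the initial term is zero.
    · have h0 : θ 0 = 0 := image_eq_zero_of_notMem_tsupport fun h =>
        absurd (hθ.supp h) (not_lt.2 hT)
      simp [h0]
  have heq : ∀ n, (∫ z in cyl T, (inner ℝ (a n z) (u z) : ℝ))
      + (∫ z in cyl T, (inner ℝ (b n z) (G z) : ℝ)) + (∫ x in Om, (inner ℝ
      ((θ 0 * χ x) • moll n (Function.uncurry v) (0, x)) (u₀ x) : ℝ)) = 0 := by
    intro n
    -- The cut-offs make the smooth mollification of `v` an admissible test function, with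
    -- derivatives `a n` and `b n`.
    have h := hw _ (isSTTest_smul hθ hχ (g := fun t x => moll n (Function.uncurry v) (t, x))
      (contDiff_moll hvl n))
    have ht : ∀ t x, deriv (fun s => (θ s * χ x) • moll n (Function.uncurry v) (s, x)) t
        = a n (t, x) := fun t x => by
      have h1 := ((hθ.hasDerivAt t).mul_const (χ x)).smul (hasDerivAt_moll_fst hv n t x)
      exact h1.deriv.trans (add_comm _ _)
    have hx : ∀ t x, deriv (fun y => (θ t * χ y) • moll n (Function.uncurry v) (t, y)) x
        = b n (t, x) := fun t x => by
      have h1 := ((hχ.hasDerivAt x).const_mul (θ t)).smul (hasDerivAt_moll_snd hv n t x)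
      exact h1.deriv.trans (add_comm _ _)
    simp only [ht, hx] at h
    rw [integral_cyl (f := fun z => (inner ℝ (a n z) (u z) + inner ℝ (b n z) (G z) : ℝ))
      ((hia n).add (hib n)), integral_add (hia n) (hib n)] at h
    refine Eq.trans ?_ h
    simp only [real_inner_comm]
  have hlim := ((hlim1.add hlim2).add hlim3).congr heq
  rw [integral_add]
  · refine Eq.trans ?_ (tendsto_nhds_unique hlim tendsto_const_nhds)
    simp only [real_inner_comm]
  · exact integrable_inner_of_bound hu (aestronglyMeasurable_of_tendsto_ae atTop ham hla)
      (by
        filter_upwards [ae_all_iff.2 hab, hla] with z hz hz'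
        exact le_of_tendsto' hz'.norm hz)
  · exact integrable_inner_of_bound hG (aestronglyMeasurable_of_tendsto_ae atTop hbm hlb)
      (by
        filter_upwards [ae_all_iff.2 hbb, hlb] with z hz hz'
        exact le_of_tendsto' hz'.norm hz)

end Lipschitz


/-! ### The relative entropy inequality with cut-offs in time and space -/

section RelativeEntropy

open Filter Topology

variable {m : ℕ}

theorem fderiv_quadEntropy : fderiv ℝ (quadEntropy (m := m)) = fun u => innerSL ℝ u := by
  funext u
  have h := ((hasStrictFDerivAt_norm_sq u).hasFDerivAt).const_mul (1 / 2 : ℝ)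
  have h2 : HasFDerivAt (quadEntropy (m := m)) _ u := h
  rw [h2.fderiv]
  ext y
  simp

theorem fderiv_quadEntropy_apply (u y : Vec m) :
    fderiv ℝ quadEntropy u y = inner ℝ u y := by
  rw [fderiv_quadEntropy]
  rfl

theorem fderiv_fderiv_quadEntropy_apply (u x y : Vec m) :
    fderiv ℝ (fderiv ℝ quadEntropy) u x y = inner ℝ x y := by
  rw [fderiv_quadEntropy]
  have h : HasFDerivAt (fun u : Vec m => innerSL ℝ u) (innerSL ℝ) u := (innerSL ℝ).hasFDerivAt
  rw [h.fderiv]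
  rfl

theorem integrable_inner_of_memLp {α : Type*} [MeasurableSpace α] {μ : Measure α} {f g : α → Vec m}
    (hf : MemLp f 2 μ) (hg : MemLp g 2 μ) : Integrable (fun z => (inner ℝ (f z) (g z) : ℝ)) μ := by
  have h : Integrable (fun z => ‖f z‖ * ‖g z‖) μ := hf.norm.integrable_mul hg.norm
  exact h.mono' (hf.1.inner hg.1) (ae_of_all _ fun z => norm_inner_le_norm _ _)

theorem integrable_mul_cutoff {T : ℝ} {f : ℝ × ℝ → ℝ} (hf : IntegrableOn f (cyl T)) {a b : ℝ → ℝ}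
    (ha : Continuous a) (hb : Continuous b) (ha' : ∃ C, ∀ x, ‖a x‖ ≤ C) (hb' : ∃ C, ∀ x, ‖b x‖ ≤ C) :
    IntegrableOn (fun z => a z.1 * b z.2 * f z) (cyl T) := by
  obtain ⟨C, hC⟩ := ha'
  obtain ⟨D, hD⟩ := hb'
  exact hf.bdd_mul (c := C * D) (Continuous.aestronglyMeasurable (by fun_prop))
    (ae_of_all _ fun z => norm_mul_le_of_le' (hC _) (hD _))

variable {T ε : ℝ} {B A : Vec m →L[ℝ] Vec m} {v : ℝ → ℝ → Vec m} {K : NNReal}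

theorem memLp_lipschitz (hv : LipschitzWith K (Function.uncurry v)) (p : ℝ≥0∞) :
    MemLp (fun z : ℝ × ℝ => v z.1 z.2) p (volume.restrict (cyl T)) := by
  obtain ⟨C, hC⟩ := (isCompact_Icc (a := (0 : ℝ)) (b := T)).prod
    (isCompact_Icc (a := (0 : ℝ)) (b := 1)) |>.exists_bound_of_continuousOn
    hv.continuous.continuousOn
  refine (memLp_top_of_bound hv.continuous.aestronglyMeasurable C ?_).mono_exponent le_top
  filter_upwards [ae_restrict_mem (measurableSet_cyl T)] with z hz
  exact hC z ⟨Ioo_subset_Icc_self hz.1, Ioo_subset_Icc_self hz.2⟩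

theorem memLp_tderiv (hv : LipschitzWith K (Function.uncurry v)) (p : ℝ≥0∞) :
    MemLp (tderiv v) p (volume.restrict (cyl T)) :=
  (memLp_top_of_bound (stronglyMeasurable_tderiv hv).aestronglyMeasurable K
    (ae_of_all _ (norm_tderiv_le hv))).mono_exponent le_top

theorem memLp_xderiv (hv : LipschitzWith K (Function.uncurry v)) (p : ℝ≥0∞) :
    MemLp (xderiv v) p (volume.restrict (cyl T)) :=
  (memLp_top_of_bound (stronglyMeasurable_xderiv hv).aestronglyMeasurable K
    (ae_of_all _ (norm_xderiv_le hv))).mono_exponent le_top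

theorem memLp_slice (hv : LipschitzWith K (Function.uncurry v)) (t : ℝ) (p : ℝ≥0∞) :
    MemLp (v t) p (volume.restrict Om) := by
  have hc : Continuous (v t) := (lipschitz_snd hv t).continuous
  obtain ⟨C, hC⟩ := (isCompact_Icc (a := (0 : ℝ)) (b := 1)).exists_bound_of_continuousOn
    hc.continuousOn
  refine (memLp_top_of_bound hc.aestronglyMeasurable C ?_).mono_exponent le_top
  filter_upwards [ae_restrict_mem measurableSet_Om] with x hx
  exact hC x (Ioo_subset_Icc_self hx)

theorem IsTest.apply_right {F : Type*} [NormedAddCommGroup F] [NormedSpace ℝ F] {θ : ℝ → F}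
    (h : IsTest (Iio T) θ) : θ T = 0 :=
  image_eq_zero_of_notMem_tsupport fun h' => lt_irrefl T (h.supp h')

theorem IsTest.ac {O : Set ℝ} {θ : ℝ → ℝ} (h : IsTest O θ) (a b : ℝ) :
    AbsolutelyContinuousOnInterval θ a b :=
  (h.smooth.of_le (by simp)).contDiffOn.absolutelyContinuousOnInterval

/-- For each fixed `x`, the fundamental theorem of calculus for `½θ‖v‖²`. As `θ` vanishes at `T`,
only the initial value survives. -/
theorem time_identity (hT : 0 ≤ T) (hv : LipschitzWith K (Function.uncurry v)) {θ χ : ℝ → ℝ}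
    (hθ : IsTest (Iio T) θ) (hχ : IsTest Om χ) :
    (∫ z in cyl T, (deriv θ z.1 * χ z.2 * (1 / 2 * inner ℝ (v z.1 z.2) (v z.1 z.2))
      + θ z.1 * χ z.2 * inner ℝ (v z.1 z.2) (tderiv v z) : ℝ))
      + ∫ x in Om, θ 0 * χ x * (1 / 2 * inner ℝ (v 0 x) (v 0 x)) = 0 := by
  have i1 := integrable_mul_cutoff ((integrable_inner_of_memLp (memLp_lipschitz (T := T) hv 2)
    (memLp_lipschitz hv 2)).const_mul (1 / 2)) hθ.continuous_deriv hχ.smooth.continuous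
    hθ.exists_bound_deriv hχ.exists_bound
  have i2 := integrable_mul_cutoff (integrable_inner_of_memLp (memLp_lipschitz (T := T) hv 2)
    (memLp_tderiv hv 2)) hθ.smooth.continuous hχ.smooth.continuous
    hθ.exists_bound hχ.exists_bound
  have i3 := i1.add i2
  rw [IntegrableOn, cyl, Measure.volume_eq_prod, ← Measure.prod_restrict] at i3
  rw [cyl, Measure.volume_eq_prod, ← Measure.prod_restrict]
  refine (congrArg₂ (· + ·) (integral_prod_symm _ i3) rfl).trans ?_
  rw [← eq_neg_iff_add_eq_zero, ← integral_neg]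
  refine integral_congr_ae (ae_of_all _ fun x => ?_)
  have h := integral_inner_add_inner (W := fun t => θ t • v t x)
    (V := fun t => (1 / 2 : ℝ) • v t x) (v := fun t => (1 / 2 : ℝ) • tderiv v (t, x)) hT
    (ac_coord_smul (hθ.ac 0 T) (ac_coord_of_lipschitz (lipschitz_fst hv x) 0 T))
    (ac_coord_smul (f := fun _ => (1 / 2 : ℝ))
      (contDiff_const.contDiffOn.absolutelyContinuousOnInterval)
      (ac_coord_of_lipschitz (lipschitz_fst hv x) 0 T))
    (by
      filter_upwards [(lipschitz_fst hv x).ae_differentiableAt_real] with t ht _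
      exact (hθ.hasDerivAt t).smul ht.hasDerivAt)
    (by
      filter_upwards [(lipschitz_fst hv x).ae_differentiableAt_real] with t ht _
      exact ht.hasDerivAt.const_smul (1 / 2 : ℝ))
  rw [hθ.apply_right, zero_smul, inner_zero_left, zero_sub] at h
  simp only [real_inner_smul_left, real_inner_smul_right] at h
  have h2 := congrArg (χ x * ·) h
  simp only [← integral_const_mul] at h2
  refine Eq.trans (integral_congr_ae (ae_of_all _ fun t => ?_)) (h2.trans ?_)
  · show _ = χ x * _
    simp only [Pi.add_apply, inner_add_left, real_inner_smul_left, tderiv]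
    rw [real_inner_comm (v t x) (deriv (fun s => v s x) t)]
    ring
  · ring

/-- For each fixed `t`, the fundamental theorem of calculus for `½χ v·Bv`, which vanishes at both
ends. Symmetry of `B` merges the two terms in which `∂ₓ` falls on `v`. -/
theorem space_identity (hB : ∀ x y, (inner ℝ (B x) y : ℝ) = inner ℝ x (B y))
    (hv : LipschitzWith K (Function.uncurry v)) {θ χ : ℝ → ℝ}
    (hθ : IsTest (Iio T) θ) (hχ : IsTest Om χ) :
    ∫ z in cyl T, (θ z.1 * deriv χ z.2 * (1 / 2 * inner ℝ (v z.1 z.2) (B (v z.1 z.2)))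
      + θ z.1 * χ z.2 * inner ℝ (xderiv v z) (B (v z.1 z.2)) : ℝ) = 0 := by
  have hBv : MemLp (fun z : ℝ × ℝ => B (v z.1 z.2)) 2 (volume.restrict (cyl T)) :=
    B.comp_memLp' (memLp_lipschitz hv 2)
  have i1 := integrable_mul_cutoff ((integrable_inner_of_memLp (memLp_lipschitz (T := T) hv 2)
    hBv).const_mul (1 / 2)) hθ.smooth.continuous hχ.continuous_deriv
    hθ.exists_bound hχ.exists_bound_deriv
  have i2 := integrable_mul_cutoff (integrable_inner_of_memLp (memLp_xderiv (T := T) hv 2) hBv)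
    hθ.smooth.continuous hχ.smooth.continuous hθ.exists_bound hχ.exists_bound
  refine (integral_cyl (i1.add i2)).symm.trans ?_
  refine integral_eq_zero_of_ae (ae_of_all _ fun t => ?_)
  have h := integral_inner_add_inner (W := fun x => χ x • v t x)
    (V := fun x => (1 / 2 : ℝ) • B (v t x)) (v := fun x => (1 / 2 : ℝ) • B (xderiv v (t, x)))
    zero_le_one
    (ac_coord_smul (hχ.ac 0 1) (ac_coord_of_lipschitz (lipschitz_snd hv t) 0 1))
    (ac_coord_smul (f := fun _ => (1 / 2 : ℝ))
      (contDiff_const.contDiffOn.absolutelyContinuousOnInterval)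
      (ac_coord_clm B (ac_coord_of_lipschitz (lipschitz_snd hv t) 0 1)))
    (by
      filter_upwards [(lipschitz_snd hv t).ae_differentiableAt_real] with x hx _
      exact (hχ.hasDerivAt x).smul hx.hasDerivAt)
    (by
      filter_upwards [(lipschitz_snd hv t).ae_differentiableAt_real] with x hx _
      exact (B.hasFDerivAt.comp_hasDerivAt x hx.hasDerivAt).const_smul (1 / 2 : ℝ))
  rw [hχ.apply_one, hχ.apply_zero, zero_smul, zero_smul, inner_zero_left, inner_zero_left,
    sub_zero] at h
  have h2 := congrArg (θ t * ·) h
  simp only [← integral_const_mul, mul_zero] at h2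
  refine Eq.trans (integral_congr_ae (ae_of_all _ fun x => ?_)) h2
  simp only [Pi.add_apply, inner_add_left, real_inner_smul_left, real_inner_smul_right, xderiv]
  have a : (inner ℝ (v t x) (B (deriv (v t) x)) : ℝ) = inner ℝ (deriv (v t) x) (B (v t x)) := by
    rw [← hB, real_inner_comm]
  rw [a]
  ring

theorem entropy_cutoff {u du : ℝ → ℝ → Vec m} {u₀ : ℝ → Vec m}
    (hu : MemLp (Function.uncurry u) 2 (volume.restrict (cyl T)))
    (hdu : MemLp (Function.uncurry du) 2 (volume.restrict (cyl T)))
    (hsol : IsEntropySolution T ε B (fun _ => A) quadEntropy (fun u => 1 / 2 * inner ℝ u (B u))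
      u du u₀) {θ χ : ℝ → ℝ} (hθ : IsTest (Iio T) θ) (hχ : IsTest Om χ)
    (hθ0 : ∀ t ∈ Ico 0 T, 0 ≤ θ t) (hχ0 : ∀ x, 0 ≤ χ x) :
    IntegrableOn (fun z : ℝ × ℝ =>
      (deriv θ z.1 * χ z.2 * (1 / 2 * inner ℝ (u z.1 z.2) (u z.1 z.2))
        + θ z.1 * deriv χ z.2 * (1 / 2 * inner ℝ (u z.1 z.2) (B (u z.1 z.2))
          - ε * inner ℝ (u z.1 z.2) (A (du z.1 z.2)))
        - θ z.1 * χ z.2 * (ε * inner ℝ (du z.1 z.2) (A (du z.1 z.2))) : ℝ)) (cyl T) ∧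
    0 ≤ (∫ z in cyl T, (deriv θ z.1 * χ z.2 * (1 / 2 * inner ℝ (u z.1 z.2) (u z.1 z.2))
        + θ z.1 * deriv χ z.2 * (1 / 2 * inner ℝ (u z.1 z.2) (B (u z.1 z.2))
          - ε * inner ℝ (u z.1 z.2) (A (du z.1 z.2)))
        - θ z.1 * χ z.2 * (ε * inner ℝ (du z.1 z.2) (A (du z.1 z.2))) : ℝ))
      + ∫ x in Om, θ 0 * χ x * (1 / 2 * inner ℝ (u₀ x) (u₀ x)) := by
  have hBu : MemLp (fun z : ℝ × ℝ => B (u z.1 z.2)) 2 (volume.restrict (cyl T)) :=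
    B.comp_memLp' hu
  have hAdu : MemLp (fun z : ℝ × ℝ => A (du z.1 z.2)) 2 (volume.restrict (cyl T)) :=
    A.comp_memLp' hdu
  have i1 := integrable_mul_cutoff ((integrable_inner_of_memLp hu hu).const_mul (1 / 2))
    hθ.continuous_deriv hχ.smooth.continuous hθ.exists_bound_deriv hχ.exists_bound
  have i2 := integrable_mul_cutoff (((integrable_inner_of_memLp hu hBu).const_mul (1 / 2)).sub
    ((integrable_inner_of_memLp hu hAdu).const_mul ε))
    hθ.smooth.continuous hχ.continuous_deriv hθ.exists_bound hχ.exists_bound_deriv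
  have i3 := integrable_mul_cutoff ((integrable_inner_of_memLp hdu hAdu).const_mul ε)
    hθ.smooth.continuous hχ.smooth.continuous hθ.exists_bound hχ.exists_bound
  have i := (i1.add i2).sub i3
  refine ⟨i, ?_⟩
  have hΦ : IsSTTest T fun t x => θ t * χ x := by
    have h := isSTTest_smul hθ hχ (g := fun _ _ => (1 : ℝ)) contDiff_const
    simpa using h
  have h := hsol.entropy _ hΦ fun t ht x _ => mul_nonneg (hθ0 t ht) (hχ0 x)
  refine h.trans_eq (congrArg₂ (· + ·) (Eq.trans ?_ (integral_cyl i)) ?_)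
  · refine integral_congr_ae (ae_of_all _ fun t => integral_congr_ae (ae_of_all _ fun x => ?_))
    have e1 : deriv (fun s => θ s * χ x) t = deriv θ t * χ x :=
      ((hθ.hasDerivAt t).mul_const _).deriv
    have e2 : deriv (fun y => θ t * χ y) x = θ t * deriv χ x :=
      ((hχ.hasDerivAt x).const_mul _).deriv
    simp only [e1, e2, fderiv_fderiv_quadEntropy_apply, fderiv_quadEntropy_apply, quadEntropy,
      ← real_inner_self_eq_norm_sq]
    ring
  · simp only [quadEntropy, ← real_inner_self_eq_norm_sq]

/-- Expanding the square, `½‖u-v‖² = ½‖u‖² - u·v + ½‖v‖²`. The three pieces come from the entropy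
inequality, the weak form tested with `θχv`, and the identities for `v`. The diffusion keeps the
full `A∂ₓu`, since no equation for `v` has been used yet. -/
theorem relative_entropy_cutoff (hT : 0 < T) (hB : ∀ x y, (inner ℝ (B x) y : ℝ) = inner ℝ x (B y))
    {u du : ℝ → ℝ → Vec m} {u₀ : ℝ → Vec m}
    (hu : MemLp (Function.uncurry u) 2 (volume.restrict (cyl T)))
    (hdu : MemLp (Function.uncurry du) 2 (volume.restrict (cyl T)))
    (hu₀ : MemLp u₀ 2 (volume.restrict Om))
    (hsol : IsEntropySolution T ε B (fun _ => A) quadEntropy (fun u => 1 / 2 * inner ℝ u (B u))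
      u du u₀)
    (hv : LipschitzWith K (Function.uncurry v)) {θ χ : ℝ → ℝ} (hθ : IsTest (Iio T) θ)
    (hχ : IsTest Om χ) (hθ0 : ∀ t ∈ Ico 0 T, 0 ≤ θ t) (hχ0 : ∀ x, 0 ≤ χ x)
    {w dw : ℝ × ℝ → Vec m} (hw : w = fun z => u z.1 z.2 - v z.1 z.2)
    (hdw : dw = fun z => du z.1 z.2 - xderiv v z) :
    0 ≤ (∫ z in cyl T, (deriv θ z.1 * χ z.2 * (1 / 2 * inner ℝ (w z) (w z))
        + θ z.1 * deriv χ z.2 * (1 / 2 * inner ℝ (w z) (B (w z))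
          - ε * inner ℝ (w z) (A (du z.1 z.2)))
        - θ z.1 * χ z.2 * (inner ℝ (w z) (tderiv v z) + ε * inner ℝ (dw z) (A (du z.1 z.2))
          + inner ℝ (w z) (B (xderiv v z))) : ℝ))
      + ∫ x in Om, θ 0 * χ x * (1 / 2 * inner ℝ (u₀ x - v 0 x) (u₀ x - v 0 x)) := by
  have hBu : MemLp (fun z : ℝ × ℝ => B (u z.1 z.2)) 2 (volume.restrict (cyl T)) :=
    B.comp_memLp' hu
  have hAdu : MemLp (fun z : ℝ × ℝ => A (du z.1 z.2)) 2 (volume.restrict (cyl T)) :=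
    A.comp_memLp' hdu
  have hu1 : IntegrableOn (Function.uncurry u) (cyl T) := hu.integrable one_le_two
  have hG1 : IntegrableOn (fun z : ℝ × ℝ => B (u z.1 z.2) - ε • A (du z.1 z.2)) (cyl T) :=
    (hBu.sub (hAdu.const_smul ε)).integrable one_le_two
  have hu₀1 : IntegrableOn u₀ Om := hu₀.integrable one_le_two
  have hv2 := memLp_lipschitz (T := T) hv 2
  have hvt := memLp_tderiv (T := T) hv 2
  have hvx := memLp_xderiv (T := T) hv 2
  have hBv : MemLp (fun z : ℝ × ℝ => B (v z.1 z.2)) 2 (volume.restrict (cyl T)) :=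
    B.comp_memLp' hv2
  have hG2 : MemLp (fun z : ℝ × ℝ => B (u z.1 z.2) - ε • A (du z.1 z.2)) 2
    (volume.restrict (cyl T)) := hBu.sub (hAdu.const_smul ε)
  have hv0 := memLp_slice hv 0 2
  obtain ⟨iE, hE⟩ := entropy_cutoff hu hdu hsol hθ hχ hθ0 hχ0
  have hU := weak_lipschitz hu1 hG1 hu₀1 hsol.weak hv hθ hχ
  have hV1 := time_identity hT.le hv hθ hχ
  have hV2 := space_identity hB hv hθ hχ
  have cθ := hθ.smooth.continuous
  have cχ := hχ.smooth.continuous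
  have cθ' := hθ.continuous_deriv
  have cχ' := hχ.continuous_deriv
  have bθ := hθ.exists_bound
  have bχ := hχ.exists_bound
  have bθ' := hθ.exists_bound_deriv
  have bχ' := hχ.exists_bound_deriv
  have iV1 := (integrable_mul_cutoff ((integrable_inner_of_memLp hv2 hv2).const_mul (1 / 2))
    cθ' cχ bθ' bχ).add (integrable_mul_cutoff (integrable_inner_of_memLp hv2 hvt) cθ cχ bθ bχ)
  have iV2 := (integrable_mul_cutoff ((integrable_inner_of_memLp hv2 hBv).const_mul (1 / 2))
    cθ cχ' bθ bχ').add (integrable_mul_cutoff (integrable_inner_of_memLp hvx hBv) cθ cχ bθ bχ)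
  have iU : IntegrableOn (fun z : ℝ × ℝ => (inner ℝ ((deriv θ z.1 * χ z.2) • v z.1 z.2
      + (θ z.1 * χ z.2) • tderiv v z) (u z.1 z.2)
      + inner ℝ ((θ z.1 * deriv χ z.2) • v z.1 z.2 + (θ z.1 * χ z.2) • xderiv v z)
        (B (u z.1 z.2) - ε • A (du z.1 z.2)) : ℝ)) (cyl T) := by
    have h := (((integrable_mul_cutoff (integrable_inner_of_memLp hv2 hu) cθ' cχ bθ' bχ).add
      (integrable_mul_cutoff (integrable_inner_of_memLp hvt hu) cθ cχ bθ bχ)).add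
      (integrable_mul_cutoff (integrable_inner_of_memLp hv2 hG2) cθ cχ' bθ bχ')).add
      (integrable_mul_cutoff (integrable_inner_of_memLp hvx hG2) cθ cχ bθ bχ)
    refine h.congr (ae_of_all _ fun z => ?_)
    simp only [Pi.add_apply, inner_add_left, real_inner_smul_left]
    simp only [Function.uncurry]
    ring
  have hχi : ∀ f : ℝ → ℝ, IntegrableOn f Om → IntegrableOn (fun x => θ 0 * χ x * f x) Om := by
    intro f hf
    obtain ⟨C, hC⟩ := bχ
    simp only [mul_assoc]
    exact (hf.bdd_mul (c := C) cχ.aestronglyMeasurable (ae_of_all _ hC)).const_mul _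
  have j1 := hχi _ ((integrable_inner_of_memLp hu₀ hu₀).const_mul (1 / 2))
  have j2 := hχi _ (integrable_inner_of_memLp hu₀ hv0)
  have j3 := hχi _ ((integrable_inner_of_memLp hv0 hv0).const_mul (1 / 2))
  -- The integrand is split as entropy part minus tested weak form plus the two identities for `v`;
  -- the pointwise equality is checked last and rests on the symmetry of `B`.
  have hc1 : ∫ z in cyl T, (deriv θ z.1 * χ z.2 * (1 / 2 * inner ℝ (w z) (w z))
        + θ z.1 * deriv χ z.2 * (1 / 2 * inner ℝ (w z) (B (w z))
          - ε * inner ℝ (w z) (A (du z.1 z.2)))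
        - θ z.1 * χ z.2 * (inner ℝ (w z) (tderiv v z) + ε * inner ℝ (dw z) (A (du z.1 z.2))
          + inner ℝ (w z) (B (xderiv v z))) : ℝ) = _ :=
    (integral_congr_ae (ae_of_all _ fun z => ?_)).trans
      (((integral_add ((iE.sub iU).add iV1) iV2).trans (congrArg (· + _)
        (integral_add (iE.sub iU) iV1))).trans (congrArg (· + _ + _) (integral_sub iE iU)))
  · have hc2 : ∫ x in Om, θ 0 * χ x * (1 / 2 * inner ℝ (u₀ x - v 0 x) (u₀ x - v 0 x)) = _ :=
      (integral_congr_ae (ae_of_all _ fun x => ?_)).trans ((integral_add (j1.sub j2) j3).trans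
        (congrArg (· + _) (integral_sub j1 j2)))
    · rw [hc1, hc2]
      have e : (fun x => θ 0 * χ x * inner ℝ (u₀ x) (v 0 x))
          = fun x => inner ℝ (u₀ x) ((θ 0 * χ x) • v 0 x) := by
        funext x
        rw [real_inner_smul_right]
      rw [e]
      simp only [Pi.add_apply, Function.uncurry] at hU hV1 hV2 ⊢
      linarith
    · simp only [Pi.sub_apply, inner_sub_left, inner_sub_right]
      rw [real_inner_comm (u₀ x) (v 0 x)]
      ring
  · have a1 := real_inner_comm (u z.1 z.2) (v z.1 z.2)
    have a2 := real_inner_comm (u z.1 z.2) (tderiv v z)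
    have a3 : (inner ℝ (u z.1 z.2) (B (v z.1 z.2)) : ℝ) = inner ℝ (v z.1 z.2) (B (u z.1 z.2)) := by
      rw [← hB, real_inner_comm]
    have a4 : (inner ℝ (u z.1 z.2) (B (xderiv v z)) : ℝ) = inner ℝ (xderiv v z) (B (u z.1 z.2)) := by
      rw [← hB, real_inner_comm]
    have a5 : (inner ℝ (v z.1 z.2) (B (xderiv v z)) : ℝ) = inner ℝ (xderiv v z) (B (v z.1 z.2)) := by
      rw [← hB, real_inner_comm]
    simp only [Pi.add_apply, Pi.sub_apply, hw, hdw, map_sub, inner_sub_left, inner_sub_right,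
      inner_add_left, real_inner_smul_left, real_inner_smul_right]
    rw [a1, a2, a3, a4, a5]
    ring

end RelativeEntropy


/-! ### Removing the space cut-off: the boundary layer -/

section Cutoff

open Filter Topology

theorem exists_bound_deriv_smoothTransition : ∃ C, 0 ≤ C ∧ (∀ x, |deriv Real.smoothTransition x| ≤ C) ∧
    ∀ x, x ∉ Icc (0 : ℝ) 1 → deriv Real.smoothTransition x = 0 := by
  have hz : ∀ x, x ∉ Icc (0 : ℝ) 1 → deriv Real.smoothTransition x = 0 := by
    intro x hx
    rcases not_and_or.1 hx with h | h
    · have h1 : Real.smoothTransition =ᶠ[𝓝 x] fun _ => 0 := by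
        filter_upwards [Iio_mem_nhds (not_le.1 h)] with y hy
        exact Real.smoothTransition.zero_of_nonpos (le_of_lt hy)
      rw [h1.deriv_eq, deriv_const]
    · have h1 : Real.smoothTransition =ᶠ[𝓝 x] fun _ => 1 := by
        filter_upwards [Ioi_mem_nhds (not_le.1 h)] with y hy
        exact Real.smoothTransition.one_of_one_le (le_of_lt hy)
      rw [h1.deriv_eq, deriv_const]
  have hc : Continuous (deriv Real.smoothTransition) :=
    (Real.smoothTransition.contDiff (n := 1)).continuous_deriv le_rfl
  obtain ⟨C, hC⟩ := (isCompact_Icc (a := (0 : ℝ)) (b := 1)).exists_bound_of_continuousOn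
    hc.continuousOn
  have hC0 : 0 ≤ C := (norm_nonneg _).trans (hC 0 (by simp))
  refine ⟨C, hC0, fun x => ?_, hz⟩
  by_cases hx : x ∈ Icc (0 : ℝ) 1
  · exact hC x hx
  · rw [hz x hx, abs_zero]
    exact hC0

/-- Cut-off functions exhausting `Ω`. -/
noncomputable def cutoff (n : ℕ) (x : ℝ) : ℝ :=
  Real.smoothTransition ((n + 1) * (x * (1 - x)) - 1)

theorem cutoff_nonneg (n : ℕ) (x : ℝ) : 0 ≤ cutoff n x := Real.smoothTransition.nonneg _

theorem norm_cutoff_le (n : ℕ) (x : ℝ) : ‖cutoff n x‖ ≤ 1 := by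
  rw [Real.norm_of_nonneg (cutoff_nonneg n x)]
  exact Real.smoothTransition.le_one _

theorem isTest_cutoff (n : ℕ) : IsTest Om (cutoff n) := by
  have hsub : tsupport (cutoff n) ⊆ {x : ℝ | 1 ≤ ((n : ℝ) + 1) * (x * (1 - x))} := by
    refine closure_minimal (fun x hx => ?_) (isClosed_le continuous_const (by fun_prop))
    by_contra h
    have h' : ((n : ℝ) + 1) * (x * (1 - x)) < 1 := not_le.1 h
    exact hx (Real.smoothTransition.zero_of_nonpos (by linarith))
  have hsub2 : {x : ℝ | 1 ≤ ((n : ℝ) + 1) * (x * (1 - x))} ⊆ Om := by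
    intro x hx
    have hn : (0 : ℝ) < n + 1 := by positivity
    have h1 : 0 < x * (1 - x) := by
      by_contra h
      have : ((n : ℝ) + 1) * (x * (1 - x)) ≤ 0 := mul_nonpos_of_nonneg_of_nonpos hn.le (not_lt.1 h)
      have hx' : 1 ≤ ((n : ℝ) + 1) * (x * (1 - x)) := hx
      linarith
    constructor <;> nlinarith [sq_nonneg x, sq_nonneg (1 - x)]
  refine ⟨?_, ?_, hsub.trans hsub2⟩
  · exact Real.smoothTransition.contDiff.comp (by fun_prop)
  · exact isCompact_Icc.of_isClosed_subset (isClosed_tsupport _)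
      ((hsub.trans hsub2).trans Ioo_subset_Icc_self)

theorem cutoff_tendsto {x : ℝ} (hx : x ∈ Om) :
    Tendsto (fun n => cutoff n x) atTop (𝓝 1) := by
  have h0 : 0 < x * (1 - x) := mul_pos hx.1 (by linarith [hx.2])
  have h1 : Tendsto (fun n : ℕ => ((n : ℝ) + 1) * (x * (1 - x))) atTop atTop :=
    (tendsto_atTop_add_const_right _ _ tendsto_natCast_atTop_atTop).atTop_mul_const h0
  refine tendsto_const_nhds.congr' ?_
  filter_upwards [h1.eventually_ge_atTop 2] with n hn
  exact (Real.smoothTransition.one_of_one_le (by linarith)).symm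

/-- The boundary layer where the `n`-th cut-off varies. -/
def layer (n : ℕ) : Set ℝ := {x | x ∈ Om ∧ ((n : ℝ) + 1) * (x * (1 - x)) ≤ 2}

theorem measurableSet_layer (n : ℕ) : MeasurableSet (layer n) :=
  measurableSet_Om.inter (isClosed_le (f := fun x : ℝ => ((n : ℝ) + 1) * (x * (1 - x)))
    (by fun_prop) continuous_const).measurableSet

theorem eventually_notMem_layer {x : ℝ} (hx : x ∈ Om) : ∀ᶠ n in atTop, x ∉ layer n := by
  have h0 : 0 < x * (1 - x) := mul_pos hx.1 (by linarith [hx.2])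
  have h1 : Tendsto (fun n : ℕ => ((n : ℝ) + 1) * (x * (1 - x))) atTop atTop :=
    (tendsto_atTop_add_const_right _ _ tendsto_natCast_atTop_atTop).atTop_mul_const h0
  filter_upwards [h1.eventually_gt_atTop 2] with n hn h
  exact absurd h.2 (not_le.2 hn)

/-- In the half nearer to `0` one has `1 - x ≥ ½`, so `(n+1)x(1-x) ≤ 2` forces `x ≤ 4/(n+1)`; the
other half is symmetric. -/
theorem volume_layer_le (n : ℕ) : volume.real (layer n) ≤ 8 / (n + 1) := by
  have hn : (0 : ℝ) < n + 1 := by positivity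
  have hsub : layer n ⊆ Icc 0 (4 / ((n : ℝ) + 1)) ∪ Icc (1 - 4 / ((n : ℝ) + 1)) 1 := by
    rintro x ⟨hx, h⟩
    rcases le_total x (1 / 2) with h2 | h2
    · left
      refine ⟨hx.1.le, ?_⟩
      rw [le_div_iff₀ hn]
      nlinarith [mul_nonneg hn.le (mul_nonneg hx.1.le (by linarith : 0 ≤ 1 / 2 - x))]
    · right
      refine ⟨?_, hx.2.le⟩
      rw [sub_le_comm, le_div_iff₀ hn]
      nlinarith [mul_nonneg hn.le (mul_nonneg (sub_nonneg.2 hx.2.le) (by linarith : 0 ≤ x - 1 / 2))]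
  have h4 : 0 ≤ 4 / ((n : ℝ) + 1) := by positivity
  calc volume.real (layer n) ≤ volume.real (Icc 0 (4 / ((n : ℝ) + 1)) ∪ Icc (1 - 4 / ((n : ℝ) + 1)) 1) :=
        measureReal_mono hsub (by
          exact ((measure_union_le _ _).trans_lt (by simp)).ne)
    _ ≤ _ := measureReal_union_le _ _
    _ = 8 / (n + 1) := by
        rw [Real.volume_real_Icc_of_le h4, Real.volume_real_Icc_of_le (by linarith)]
        ring

theorem exists_deriv_cutoff_bound : ∃ C : ℝ, 0 ≤ C ∧ ∀ (n : ℕ) (x : ℝ), x ∈ Om →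
    |deriv (cutoff n) x| ≤ (layer n).indicator (fun _ => C * (n + 1)) x := by
  obtain ⟨C, hC0, hC, hz⟩ := exists_bound_deriv_smoothTransition
  refine ⟨C, hC0, fun n x hx => ?_⟩
  have hd : deriv (cutoff n) x = deriv Real.smoothTransition ((n + 1) * (x * (1 - x)) - 1)
      * ((n + 1) * (1 - 2 * x)) := by
    have h1 : HasDerivAt (fun x : ℝ => ((n : ℝ) + 1) * (x * (1 - x)) - 1) ((n + 1) * (1 - 2 * x)) x := by
      have h2 := (((hasDerivAt_id x).mul ((hasDerivAt_id x).const_sub 1)).const_mul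
        ((n : ℝ) + 1)).sub_const 1
      refine h2.congr_deriv ?_
      simp only [id]
      ring
    have h3 : HasDerivAt Real.smoothTransition _ (((n : ℝ) + 1) * (x * (1 - x)) - 1) :=
      ((Real.smoothTransition.contDiff (n := 1)).differentiable (by simp) _).hasDerivAt
    exact (h3.comp x h1).deriv
  have hn : (0 : ℝ) < n + 1 := by positivity
  by_cases h : x ∈ layer n
  · rw [indicator_of_mem h, hd, abs_mul, abs_mul, abs_of_pos hn]
    have h1 : |1 - 2 * x| ≤ 1 := abs_le.2 ⟨by linarith [hx.2], by linarith [hx.1]⟩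
    calc _ ≤ C * ((n + 1) * 1) := by
          gcongr
          exact hC _
      _ = _ := by ring
  · rw [indicator_of_notMem h, hd, hz _ fun h' => h ⟨hx, by linarith [h'.2]⟩]
    simp

/-- Products of a bounded sequence in `L²` supported on vanishing sets with a fixed `L²` function
tend to zero in `L¹`. -/
theorem tendsto_integral_zero_of_layer {α : Type*} [MeasurableSpace α] {μ : Measure α}
    {a : ℕ → α → ℝ} {S : α → ℝ} {s : ℕ → Set α} {M : ℝ} (hS : MemLp S 2 μ)
    (ha : ∀ n, Integrable (fun z => a n z ^ 2) μ) (hM : ∀ n, ∫ z, a n z ^ 2 ∂μ ≤ M)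
    (hs : ∀ n, MeasurableSet (s n)) (has : ∀ n, ∀ᵐ z ∂μ, z ∉ s n → a n z = 0)
    (hlim : ∀ᵐ z ∂μ, ∀ᶠ n in atTop, z ∉ s n) {f : ℕ → α → ℝ}
    (hf : ∀ n, ∀ᵐ z ∂μ, |f n z| ≤ |a n z| * |S z|) :
    Tendsto (fun n => ∫ z, f n z ∂μ) atTop (𝓝 0) := by
  have hM0 : 0 ≤ M := (integral_nonneg fun z => sq_nonneg _).trans (hM 0)
  have hS2 : Integrable (fun z => S z ^ 2) μ := hS.integrable_sq
  have hi : ∀ n, Integrable ((s n).indicator fun z => S z ^ 2) μ := fun n => hS2.indicator (hs n)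
  have h0 : Tendsto (fun n => ∫ z, (s n).indicator (fun z => S z ^ 2) z ∂μ) atTop (𝓝 0) := by
    have := tendsto_integral_of_dominated_convergence (μ := μ) (G := ℝ)
      (F := fun n => (s n).indicator fun z => S z ^ 2) (f := fun _ => (0 : ℝ)) (fun z => S z ^ 2)
      (fun n => (hi n).1) hS2 (fun n => ae_of_all _ fun z => ?_) ?_
    · simpa using this
    · refine (norm_indicator_le_norm_self (fun z => S z ^ 2) z).trans ?_
      rw [Real.norm_of_nonneg (sq_nonneg _)]
    · filter_upwards [hlim] with z hz
      refine tendsto_const_nhds.congr' ?_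
      filter_upwards [hz] with n hn
      rw [indicator_of_notMem hn]
  -- Young's inequality with a free weight `l`: the bounded factor contributes at most `lM`, and the
  -- fixed factor contributes only on `s n`, where its integral tends to zero.
  have key : ∀ l : ℝ, 0 < l → ∀ n, |∫ z, f n z ∂μ| ≤
      l * M + 1 / l * ∫ z, (s n).indicator (fun z => S z ^ 2) z ∂μ := by
    intro l hl n
    have h1 : |∫ z, f n z ∂μ| ≤ ∫ z, (l * a n z ^ 2
        + 1 / l * (s n).indicator (fun z => S z ^ 2) z) ∂μ := by
      rw [← Real.norm_eq_abs]
      refine norm_integral_le_of_norm_le (((ha n).const_mul l).add ((hi n).const_mul _)) ?_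
      filter_upwards [hf n, has n] with z h1 h2
      refine h1.trans ?_
      by_cases hz : z ∈ s n
      · rw [indicator_of_mem hz, ← sq_abs (a n z), ← sq_abs (S z)]
        have h3 : 0 ≤ (l * |a n z| - |S z|) ^ 2 / l := by positivity
        have h4 : (l * |a n z| - |S z|) ^ 2 / l
          = l * |a n z| ^ 2 + 1 / l * |S z| ^ 2 - 2 * (|a n z| * |S z|) := by
          field_simp
          ring
        have h5 : 0 ≤ |a n z| * |S z| := by positivity
        linarith
      · rw [h2 hz, indicator_of_notMem hz]
        simp
    rw [integral_add ((ha n).const_mul l) ((hi n).const_mul _), integral_const_mul,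
      integral_const_mul] at h1
    refine h1.trans ?_
    have := mul_le_mul_of_nonneg_left (hM n) hl.le
    linarith
  rw [Metric.tendsto_atTop]
  intro η hη
  -- `M + 1` replaces `M` so that the quotient makes sense when `M = 0`.
  set l := η / (2 * (M + 1)) with hl
  have hl0 : 0 < l := by positivity
  have hlM : l * M < η / 2 := by
    have h1 : l * (M + 1) = η / 2 := by
      rw [hl]
      field_simp
    nlinarith
  have h1 := (h0.const_mul (1 / l)).eventually (gt_mem_nhds (show 1 / l * 0 < η / 2 by simpa using hη))
  obtain ⟨N, hN⟩ := eventually_atTop.1 h1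
  refine ⟨N, fun n hn => ?_⟩
  rw [dist_zero_right, Real.norm_eq_abs]
  linarith [key l hl0 n, hN n hn]

variable {m : ℕ} {T ε : ℝ} {B A : Vec m →L[ℝ] Vec m} {v : ℝ → ℝ → Vec m} {K : NNReal}

/-- The powers of `n` balance: on the layer `|χ'|² ≤ C²(n+1)²` and `‖w‖² ≤ (4/(n+1))D`, and the
layer has measure at most `8/(n+1)`. The product is `32C²D`, independent of `n`. -/
theorem IsH10.integral_deriv_cutoff_sq_le {w dw : ℝ → Vec m} (h : IsH10 w dw) {C : ℝ}
    (hC : ∀ n x, x ∈ Om → |deriv (cutoff n) x| ≤ (layer n).indicator (fun _ => C * (n + 1)) x)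
    (n : ℕ) : ∫ x in Om, (deriv (cutoff n) x * ‖w x‖) ^ 2
      ≤ 32 * C ^ 2 * ∫ x in Om, ‖dw x‖ ^ 2 := by
  set D := ∫ x in Om, ‖dw x‖ ^ 2 with hD
  have hD0 : 0 ≤ D := integral_nonneg fun x => sq_nonneg _
  have hn : (0 : ℝ) < n + 1 := by positivity
  have hsub : layer n ⊆ Om := fun x hx => hx.1
  have hle : ∫ x in Om, (deriv (cutoff n) x * ‖w x‖) ^ 2
      ≤ ∫ x in Om, (layer n).indicator (fun _ => 4 * C ^ 2 * (n + 1) * D) x := by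
    refine integral_mono_of_nonneg (ae_of_all _ fun x => sq_nonneg _)
      ((integrable_const _).indicator (measurableSet_layer n)) ?_
    filter_upwards [h.norm_sq_le, ae_restrict_mem measurableSet_Om] with x h1 hx
    have h2 := hC n x hx
    by_cases hl : x ∈ layer n
    · rw [indicator_of_mem hl] at h2 ⊢
      have h3 : deriv (cutoff n) x ^ 2 ≤ (C * (n + 1)) ^ 2 := by
        rw [← sq_abs]
        gcongr
      have h5 : ‖w x‖ ^ 2 ≤ 4 / (n + 1) * D := by
        refine h1.trans ?_
        refine mul_le_mul_of_nonneg_right ?_ hD0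
        rw [le_div_iff₀ hn]
        nlinarith [hl.2]
      rw [mul_pow]
      calc _ ≤ (C * (n + 1)) ^ 2 * (4 / (n + 1) * D) := by gcongr
        _ = _ := by
          field_simp
    · rw [indicator_of_notMem hl] at h2 ⊢
      have h3 : deriv (cutoff n) x = 0 := abs_eq_zero.1 (le_antisymm h2 (abs_nonneg _))
      simp [h3]
  refine hle.trans ?_
  rw [integral_indicator (measurableSet_layer n), Measure.restrict_restrict (measurableSet_layer n),
    inter_eq_left.2 hsub, setIntegral_const, smul_eq_mul]
  calc _ ≤ 8 / ((n : ℝ) + 1) * (4 * C ^ 2 * (n + 1) * D) :=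
        mul_le_mul_of_nonneg_right (volume_layer_le n) (by positivity)
    _ = _ := by
      field_simp
      ring

/-- Limit of `relative_entropy_cutoff` along the cut-offs. The flux term with `χ'` is the only one
not covered by dominated convergence; it vanishes because `w(t)` is zero on the boundary. -/
theorem relative_entropy (hT : 0 < T) (hB : ∀ x y, (inner ℝ (B x) y : ℝ) = inner ℝ x (B y))
    {u du : ℝ → ℝ → Vec m} {u₀ : ℝ → Vec m}
    (hu : MemLp (Function.uncurry u) 2 (volume.restrict (cyl T)))
    (hdu : MemLp (Function.uncurry du) 2 (volume.restrict (cyl T)))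
    (hu₀ : MemLp u₀ 2 (volume.restrict Om))
    (hsol : IsEntropySolution T ε B (fun _ => A) quadEntropy (fun u => 1 / 2 * inner ℝ u (B u))
      u du u₀)
    (hv : LipschitzWith K (Function.uncurry v)) {w dw : ℝ × ℝ → Vec m}
    (hw : w = fun z => u z.1 z.2 - v z.1 z.2) (hdw : dw = fun z => du z.1 z.2 - xderiv v z)
    (hH : ∀ᵐ t ∂(volume.restrict (Ioo 0 T)), IsH10 (fun x => w (t, x)) (fun x => dw (t, x)))
    {θ : ℝ → ℝ} (hθ : IsTest (Iio T) θ) (hθ0 : ∀ t ∈ Ico 0 T, 0 ≤ θ t) :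
    0 ≤ (∫ z in cyl T, (deriv θ z.1 * (1 / 2 * inner ℝ (w z) (w z))
        - θ z.1 * (inner ℝ (w z) (tderiv v z) + ε * inner ℝ (dw z) (A (du z.1 z.2))
          + inner ℝ (w z) (B (xderiv v z))) : ℝ))
      + ∫ x in Om, θ 0 * (1 / 2 * inner ℝ (u₀ x - v 0 x) (u₀ x - v 0 x)) := by
  have hAdu : MemLp (fun z : ℝ × ℝ => A (du z.1 z.2)) 2 (volume.restrict (cyl T)) :=
    A.comp_memLp' hdu
  have hvx := memLp_xderiv (T := T) hv 2
  have hw2 : MemLp w 2 (volume.restrict (cyl T)) := by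
    rw [hw]
    exact MemLp.sub (f := fun z : ℝ × ℝ => u z.1 z.2) hu (memLp_lipschitz hv 2)
  have hdw2 : MemLp dw 2 (volume.restrict (cyl T)) := by
    rw [hdw]
    exact MemLp.sub (f := fun z : ℝ × ℝ => du z.1 z.2) hdu hvx
  have hBw : MemLp (fun z => B (w z)) 2 (volume.restrict (cyl T)) := B.comp_memLp' hw2
  have hBvx : MemLp (fun z => B (xderiv v z)) 2 (volume.restrict (cyl T)) := B.comp_memLp' hvx
  have hw0 : MemLp (fun x => u₀ x - v 0 x) 2 (volume.restrict Om) := hu₀.sub (memLp_slice hv 0 2)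
  have ie := (integrable_inner_of_memLp hw2 hw2).const_mul (1 / 2)
  have ih := ((integrable_inner_of_memLp hw2 (memLp_tderiv (T := T) hv 2)).add
    ((integrable_inner_of_memLp hdw2 hAdu).const_mul ε)).add (integrable_inner_of_memLp hw2 hBvx)
  have iF := ((integrable_inner_of_memLp hw2 hBw).const_mul (1 / 2)).sub
    ((integrable_inner_of_memLp hw2 hAdu).const_mul ε)
  have ic := (integrable_inner_of_memLp hw0 hw0).const_mul (1 / 2)
  obtain ⟨Cθ, hCθ⟩ := hθ.exists_bound
  have hCθ0 : 0 ≤ Cθ := (norm_nonneg _).trans (hCθ 0)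
  obtain ⟨C, hC0, hC⟩ := exists_deriv_cutoff_bound
  have one_cont : Continuous fun _ : ℝ => (1 : ℝ) := continuous_const
  have one_bdd : ∃ C, ∀ x : ℝ, ‖(fun _ : ℝ => (1 : ℝ)) x‖ ≤ C := ⟨1, fun x => by simp⟩
  set G : ℝ × ℝ → ℝ := fun z => deriv θ z.1 * (1 / 2 * inner ℝ (w z) (w z))
        - θ z.1 * (inner ℝ (w z) (tderiv v z) + ε * inner ℝ (dw z) (A (du z.1 z.2))
          + inner ℝ (w z) (B (xderiv v z))) with hG
  have iG : IntegrableOn G (cyl T) := by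
    have h := (integrable_mul_cutoff ie hθ.continuous_deriv one_cont hθ.exists_bound_deriv one_bdd).sub
      (integrable_mul_cutoff ih hθ.smooth.continuous one_cont hθ.exists_bound one_bdd)
    refine h.congr (ae_of_all _ fun z => ?_)
    simp [hG]
  set f : ℕ → ℝ × ℝ → ℝ := fun n z => θ z.1 * deriv (cutoff n) z.2 *
    (1 / 2 * inner ℝ (w z) (B (w z)) - ε * inner ℝ (w z) (A (du z.1 z.2))) with hf
  have if' : ∀ n, IntegrableOn (f n) (cyl T) := fun n =>
    integrable_mul_cutoff iF hθ.smooth.continuous (isTest_cutoff n).continuous_deriv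
      hθ.exists_bound (isTest_cutoff n).exists_bound_deriv
  have iχG : ∀ n, IntegrableOn (fun z => cutoff n z.2 * G z) (cyl T) := fun n => by
    have h := integrable_mul_cutoff iG one_cont (isTest_cutoff n).smooth.continuous one_bdd
      (isTest_cutoff n).exists_bound
    simpa using h
  -- the boundary layer term tends to zero
  have hlim1 : Tendsto (fun n => ∫ z in cyl T, f n z) atTop (𝓝 0) := by
    have iw : ∀ n, IntegrableOn (fun z : ℝ × ℝ => (deriv (cutoff n) z.2 * ‖w z‖) ^ 2) (cyl T) := by
      intro n
      have h := integrable_mul_cutoff (integrable_mul_cutoff hw2.norm.integrable_sq one_cont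
        (isTest_cutoff n).continuous_deriv one_bdd (isTest_cutoff n).exists_bound_deriv) one_cont
        (isTest_cutoff n).continuous_deriv one_bdd (isTest_cutoff n).exists_bound_deriv
      refine h.congr (ae_of_all _ fun z => ?_)
      simp only
      ring
    -- The flux is at least linear in `w`. One factor `‖w‖` is grouped with `χ'` and stays bounded
    -- in `L²`; the rest is dominated by this fixed `L²` function.
    have hS : MemLp (fun z : ℝ × ℝ => Cθ * (1 / 2 * ‖B‖ * ‖w z‖ + |ε| * ‖A‖ * ‖du z.1 z.2‖)) 2
        (volume.restrict (cyl T)) :=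
      ((hw2.norm.const_mul _).add (hdu.norm.const_mul _)).const_mul _
    refine tendsto_integral_zero_of_layer (M := 32 * C ^ 2 * ∫ z in cyl T, ‖dw z‖ ^ 2)
      (a := fun n z => deriv (cutoff n) z.2 * ‖w z‖) (s := fun n => Prod.snd ⁻¹' layer n) hS iw
      (fun n => ?_) (fun n => measurable_snd (measurableSet_layer n)) (fun n => ?_) ?_ (fun n => ?_)
    · rw [← integral_cyl (iw n), ← integral_cyl hdw2.norm.integrable_sq, ← integral_const_mul]
      have i1 := iw n
      have i2 : IntegrableOn (fun z => ‖dw z‖ ^ 2) (cyl T) := hdw2.norm.integrable_sq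
      rw [IntegrableOn, cyl, Measure.volume_eq_prod, ← Measure.prod_restrict] at i1 i2
      refine integral_mono_ae i1.integral_prod_left (i2.integral_prod_left.const_mul _) ?_
      filter_upwards [hH] with t ht
      exact ht.integral_deriv_cutoff_sq_le hC n
    · filter_upwards [ae_restrict_mem (measurableSet_cyl T)] with z hz hzn
      have h := hC n z.2 hz.2
      rw [indicator_of_notMem (show z.2 ∉ layer n from hzn)] at h
      simp [abs_eq_zero.1 (le_antisymm h (abs_nonneg _))]
    · filter_upwards [ae_restrict_mem (measurableSet_cyl T)] with z hz
      exact eventually_notMem_layer hz.2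
    · refine ae_of_all _ fun z => ?_
      have h1 : |(inner ℝ (w z) (B (w z)) : ℝ)| ≤ ‖w z‖ * (‖B‖ * ‖w z‖) :=
        (abs_real_inner_le_norm _ _).trans (by gcongr; exact B.le_opNorm _)
      have h2 : |(inner ℝ (w z) (A (du z.1 z.2)) : ℝ)| ≤ ‖w z‖ * (‖A‖ * ‖du z.1 z.2‖) :=
        (abs_real_inner_le_norm _ _).trans (by gcongr; exact A.le_opNorm _)
      have h3 : |1 / 2 * inner ℝ (w z) (B (w z)) - ε * inner ℝ (w z) (A (du z.1 z.2))|
          ≤ ‖w z‖ * (1 / 2 * ‖B‖ * ‖w z‖ + |ε| * ‖A‖ * ‖du z.1 z.2‖) := by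
        refine (abs_sub _ _).trans ?_
        rw [abs_mul, abs_mul, abs_of_pos (by norm_num : (0 : ℝ) < 1 / 2)]
        have h4 := mul_le_mul_of_nonneg_left h2 (abs_nonneg ε)
        linarith
      have hS0 : 0 ≤ Cθ * (1 / 2 * ‖B‖ * ‖w z‖ + |ε| * ‖A‖ * ‖du z.1 z.2‖) := by positivity
      have h5 : |θ z.1| ≤ Cθ := hCθ z.1
      rw [hf, abs_of_nonneg hS0]
      simp only [abs_mul, abs_norm]
      calc _ ≤ Cθ * |deriv (cutoff n) z.2| *
            (‖w z‖ * (1 / 2 * ‖B‖ * ‖w z‖ + |ε| * ‖A‖ * ‖du z.1 z.2‖)) := by gcongr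
        _ = _ := by ring
  have hlim2 : Tendsto (fun n => ∫ z in cyl T, cutoff n z.2 * G z) atTop (𝓝 (∫ z in cyl T, G z)) := by
    refine tendsto_integral_of_dominated_convergence (fun z => ‖G z‖) (fun n => (iχG n).1) iG.norm
      (fun n => ae_of_all _ fun z => ?_) ?_
    · rw [norm_mul]
      exact mul_le_of_le_one_left (norm_nonneg _) (norm_cutoff_le n _)
    · filter_upwards [ae_restrict_mem (measurableSet_cyl T)] with z hz
      simpa using (cutoff_tendsto hz.2).mul_const (G z)
  have hlim3 : Tendsto (fun n => ∫ x in Om, cutoff n x *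
      (θ 0 * (1 / 2 * inner ℝ (u₀ x - v 0 x) (u₀ x - v 0 x)) : ℝ)) atTop
      (𝓝 (∫ x in Om, θ 0 * (1 / 2 * inner ℝ (u₀ x - v 0 x) (u₀ x - v 0 x)))) := by
    refine tendsto_integral_of_dominated_convergence _ (fun n =>
      (isTest_cutoff n).smooth.continuous.aestronglyMeasurable.mul (ic.const_mul _).1)
      (ic.const_mul (θ 0)).norm (fun n => ae_of_all _ fun x => ?_) ?_
    · rw [norm_mul]
      exact mul_le_of_le_one_left (norm_nonneg _) (norm_cutoff_le n _)
    · filter_upwards [ae_restrict_mem measurableSet_Om] with x hx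
      simpa using (cutoff_tendsto hx).mul_const
        (θ 0 * (1 / 2 * inner ℝ (u₀ x - v 0 x) (u₀ x - v 0 x)) : ℝ)
  have hlim := (hlim2.add hlim1).add hlim3
  rw [add_zero] at hlim
  refine ge_of_tendsto' hlim fun n => ?_
  refine (relative_entropy_cutoff hT hB hu hdu hu₀ hsol hv hθ (isTest_cutoff n) hθ0
    (cutoff_nonneg n) hw hdw).trans_eq (congrArg₂ (· + ·) ?_ ?_)
  · rw [← integral_add (iχG n) (if' n)]
    refine integral_congr_ae (ae_of_all _ fun z => ?_)
    simp only [hG, hf]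
    ring
  · refine integral_congr_ae (ae_of_all _ fun x => ?_)
    simp only
    ring

end Cutoff


/-! ### The perturbed system in `H⁻¹` at almost every time -/

section Perturbed

open Filter Topology

variable {m : ℕ} {T ε : ℝ} {B A : Vec m →L[ℝ] Vec m} {v : ℝ → ℝ → Vec m} {K : NNReal}

theorem memLp_dual_norm {E : Type*} [NormedAddCommGroup E] [NormedSpace ℝ E] {α : Type*}
    [MeasurableSpace α] {μ : Measure α} {p : ℝ≥0∞} {f : α → StrongDual ℝ E} (hf : MemLp f p μ) :
    MemLp (fun t => ‖f t‖) p μ := hf.norm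

theorem memLp_dual_apply {E : Type*} [NormedAddCommGroup E] [NormedSpace ℝ E] {α : Type*}
    [MeasurableSpace α] {μ : Measure α} {p : ℝ≥0∞} {f : α → StrongDual ℝ E} (hf : MemLp f p μ)
    (x : E) : MemLp (fun t => f t x) p μ :=
  (ContinuousLinearMap.apply ℝ ℝ x).comp_memLp' hf

theorem ae_slice_aestronglyMeasurable {f : ℝ → ℝ → Vec m}
    (hf : AEStronglyMeasurable (Function.uncurry f) (volume.restrict (cyl T))) :
    ∀ᵐ t ∂(volume.restrict (Ioo 0 T)), AEStronglyMeasurable (f t) (volume.restrict Om) := by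
  rw [cyl, Measure.volume_eq_prod, ← Measure.prod_restrict] at hf
  exact hf.prodMk_left

theorem lintegral_cyl {f : ℝ × ℝ → ℝ≥0∞} (hf : AEMeasurable f (volume.restrict (cyl T))) :
    ∫⁻ z in cyl T, f z = ∫⁻ t in Ioo 0 T, ∫⁻ x in Om, f (t, x) := by
  rw [cyl, Measure.volume_eq_prod, ← Measure.prod_restrict] at hf ⊢
  exact lintegral_prod _ hf

theorem MemLpL2.integrableOn {r₁ : ℝ → ℝ → Vec m} (h : MemLpL2 1 T r₁) :
    IntegrableOn (Function.uncurry r₁) (cyl T) := by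
  refine ⟨h.1, ?_⟩
  rw [HasFiniteIntegral, lintegral_cyl h.1.enorm]
  have h2 := h.2
  rw [normLpL2, eLpNorm_one_eq_lintegral_enorm] at h2
  refine lt_of_le_of_lt (lintegral_mono_ae ?_) h2
  filter_upwards [ae_slice_aestronglyMeasurable h.1] with t ht
  rw [enorm_eq_self]
  calc ∫⁻ x in Om, ‖r₁ t x‖ₑ = eLpNorm (r₁ t) 1 (volume.restrict Om) :=
        eLpNorm_one_eq_lintegral_enorm.symm
    _ ≤ eLpNorm (r₁ t) 2 (volume.restrict Om) :=
        by
          have : IsProbabilityMeasure (volume.restrict Om) := ⟨by simp [Om]⟩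
          exact eLpNorm_le_eLpNorm_of_exponent_le one_le_two ht

theorem aemeasurable_eLpNorm_slice {f : ℝ → ℝ → Vec m}
    (hf : AEStronglyMeasurable (Function.uncurry f) (volume.restrict (cyl T))) :
    AEMeasurable (fun t => eLpNorm (f t) 2 (volume.restrict Om)) (volume.restrict (Ioo 0 T)) := by
  rw [cyl, Measure.volume_eq_prod, ← Measure.prod_restrict] at hf
  simp only [eLpNorm_eq_lintegral_rpow_enorm_toReal two_ne_zero ENNReal.ofNat_ne_top]
  exact ((hf.enorm.pow_const _).lintegral_prod_right').pow_const _

theorem MemLpL2.ae_memLp {r₁ : ℝ → ℝ → Vec m} (h : MemLpL2 1 T r₁) :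
    ∀ᵐ t ∂(volume.restrict (Ioo 0 T)), MemLp (r₁ t) 2 (volume.restrict Om) := by
  have h2 := h.2
  rw [normLpL2, eLpNorm_one_eq_lintegral_enorm] at h2
  simp only [enorm_eq_self] at h2
  filter_upwards [ae_slice_aestronglyMeasurable h.1,
    ae_lt_top' (aemeasurable_eLpNorm_slice h.1) h2.ne] with t ht ht' using ⟨ht, ht'⟩

theorem toH10_smul {ψ : ℝ → Vec m} (hψ : IsTest Om ψ) (c : ℝ)
    (h : IsTest Om (fun x => c • ψ x)) : toH10 (fun x => c • ψ x) h = c • toH10 ψ hψ := by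
  have hd : deriv (fun x => c • ψ x) = c • deriv ψ := by
    funext x
    exact deriv_const_smul c (hψ.smooth.differentiable (by simp) x)
  refine Subtype.ext ?_
  show testPair _ h = c • testPair ψ hψ
  simp only [testPair, hd]
  rfl

theorem isSTTest_smul_right {F : Type*} [NormedAddCommGroup F] [NormedSpace ℝ F] {θ : ℝ → ℝ}
    {ψ : ℝ → F} (hθ : IsTest (Iio T) θ) (hψ : IsTest Om ψ) :
    IsSTTest T (fun t x => θ t • ψ x) := by
  have hsub : tsupport (Function.uncurry fun t x => θ t • ψ x) ⊆ tsupport θ ×ˢ tsupport ψ := by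
    refine closure_minimal (fun z hz => ?_) ((isClosed_tsupport _).prod (isClosed_tsupport _))
    have hz' : θ z.1 • ψ z.2 ≠ 0 := hz
    refine ⟨subset_tsupport _ fun h => hz' ?_, subset_tsupport _ fun h => hz' ?_⟩ <;> simp [h]
  refine ⟨?_, ?_, hsub.trans (prod_mono hθ.supp hψ.supp)⟩
  · exact (hθ.smooth.comp contDiff_fst).smul (hψ.smooth.comp contDiff_snd)
  · exact (hθ.compact.isCompact.prod hψ.compact.isCompact).of_isClosed_subset
      (isClosed_tsupport _) hsub

theorem time_parts (hT : 0 ≤ T) (hv : LipschitzWith K (Function.uncurry v)) {θ : ℝ → ℝ}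
    {ψ : ℝ → Vec m} (hθ : IsTest (Ioo 0 T) θ) (hψ : IsTest Om ψ) :
    ∫ z in cyl T, (deriv θ z.1 * inner ℝ (ψ z.2) (v z.1 z.2)
      + θ z.1 * inner ℝ (ψ z.2) (tderiv v z) : ℝ) = 0 := by
  obtain ⟨Cθ, hCθ⟩ := hθ.exists_bound
  obtain ⟨Cθ', hCθ'⟩ := hθ.exists_bound_deriv
  have hψ2 : MemLp (fun z : ℝ × ℝ => ψ z.2) 2 (volume.restrict (cyl T)) := by
    obtain ⟨C, hC⟩ := hψ.exists_bound
    exact (memLp_top_of_bound (hψ.smooth.continuous.comp continuous_snd).aestronglyMeasurable C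
      (ae_of_all _ fun z => hC z.2)).mono_exponent le_top
  have i1 : IntegrableOn (fun z : ℝ × ℝ => deriv θ z.1 * inner ℝ (ψ z.2) (v z.1 z.2)) (cyl T) :=
    (integrable_inner_of_memLp hψ2 (memLp_lipschitz hv 2)).bdd_mul (c := Cθ')
      (hθ.continuous_deriv.comp continuous_fst).aestronglyMeasurable (ae_of_all _ fun z => hCθ' z.1)
  have i2 : IntegrableOn (fun z : ℝ × ℝ => θ z.1 * inner ℝ (ψ z.2) (tderiv v z)) (cyl T) :=
    (integrable_inner_of_memLp hψ2 (memLp_tderiv hv 2)).bdd_mul (c := Cθ)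
      (hθ.smooth.continuous.comp continuous_fst).aestronglyMeasurable (ae_of_all _ fun z => hCθ z.1)
  have i3 := i1.add i2
  rw [IntegrableOn, cyl, Measure.volume_eq_prod, ← Measure.prod_restrict] at i3
  rw [cyl, Measure.volume_eq_prod, ← Measure.prod_restrict]
  refine (integral_prod_symm _ i3).trans ?_
  refine integral_eq_zero_of_ae (ae_of_all _ fun x => ?_)
  have h := integral_inner_add_inner (W := fun t => θ t • ψ x) (V := fun t => v t x)
    (v := fun t => tderiv v (t, x)) hT
    (ac_coord_smul (hθ.ac 0 T) (ac_coord_of_contDiff contDiff_const 0 T))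
    (ac_coord_of_lipschitz (lipschitz_fst hv x) 0 T)
    (ae_of_all _ fun t _ => (hθ.hasDerivAt t).smul_const (ψ x))
    (by
      filter_upwards [(lipschitz_fst hv x).ae_differentiableAt_real] with t ht _
      exact ht.hasDerivAt)
  have h0 : θ 0 = 0 := image_eq_zero_of_notMem_tsupport fun h' => lt_irrefl (0 : ℝ) (hθ.supp h').1
  have hT' : θ T = 0 := image_eq_zero_of_notMem_tsupport fun h' => lt_irrefl T (hθ.supp h').2
  rw [h0, hT', zero_smul, inner_zero_left, inner_zero_left, sub_zero] at h
  refine Eq.trans (integral_congr_ae (ae_of_all _ fun t => ?_)) h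
  simp only [Pi.add_apply, real_inner_smul_left]
  ring

theorem space_parts (hv : LipschitzWith K (Function.uncurry v)) (B : Vec m →L[ℝ] Vec m)
    {ψ : ℝ → Vec m} (hψ : IsTest Om ψ) (t : ℝ) :
    ∫ x in Om, (inner ℝ (deriv ψ x) (B (v t x)) + inner ℝ (ψ x) (B (xderiv v (t, x))) : ℝ) = 0 := by
  have h := integral_inner_add_inner (W := ψ) (w := deriv ψ) (V := fun x => B (v t x))
    (v := fun x => B (xderiv v (t, x))) zero_le_one
    (ac_coord_of_contDiff (hψ.smooth.of_le (by simp)) 0 1)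
    (ac_coord_clm B (ac_coord_of_lipschitz (lipschitz_snd hv t) 0 1))
    (ae_of_all _ fun x _ => hψ.hasDerivAt x)
    (by
      filter_upwards [(lipschitz_snd hv t).ae_differentiableAt_real] with x hx _
      exact B.hasFDerivAt.comp_hasDerivAt x hx.hasDerivAt)
  rw [hψ.apply_one, hψ.apply_zero, inner_zero_left, inner_zero_left, sub_zero] at h
  refine Eq.trans (integral_congr_ae (ae_of_all _ fun x => ?_)) h
  exact add_comm _ _

/-- Separated test functions `θ(t)ψ(x)` localise the weak form in time. The time derivative and the
transport term are integrated by parts onto the Lipschitz function `v`; the diffusion keeps its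
derivative on `ψ`, as `v` has no second derivatives. -/
theorem perturbed_test (hT : 0 ≤ T) (hv : LipschitzWith K (Function.uncurry v))
    {r₁ : ℝ → ℝ → Vec m} (hr₁ : MemLpL2 1 T r₁) {r₂ : ℝ → Hneg1 m}
    (hr₂ : MemLp r₂ 2 (volume.restrict (Ioo 0 T))) {v₀ : ℝ → Vec m}
    (hweak : ∀ (φ : ℝ → ℝ → Vec m) (hφ : IsSTTest T φ),
      (∫ t in Ioo 0 T, ∫ x in Om,
        (inner ℝ (deriv (fun s => φ s x) t) (v t x)
          + inner ℝ (deriv (φ t) x) (B (v t x) - ε • A (deriv (v t) x))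
          + inner ℝ (r₁ t x) (φ t x)))
      + ε * (∫ t in Ioo 0 T, r₂ t (toH10 (φ t) (hφ.slice t)))
      + ∫ x in Om, inner ℝ (v₀ x) (φ 0 x) = 0)
    {ψ : ℝ → Vec m} (hψ : IsTest Om ψ) :
    ∀ᵐ t ∂(volume.restrict (Ioo 0 T)),
      (∫ x in Om, (inner ℝ (ψ x) (tderiv v (t, x)) + inner ℝ (ψ x) (B (xderiv v (t, x)))
        + ε * inner ℝ (deriv ψ x) (A (xderiv v (t, x))) - inner ℝ (ψ x) (r₁ t x) : ℝ))
        = ε * r₂ t (toH10 ψ hψ) := by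
  have bdd : ∀ {g : ℝ → Vec m} {f : ℝ × ℝ → Vec m}, Continuous g → (∃ C, ∀ x, ‖g x‖ ≤ C) →
      IntegrableOn f (cyl T) → IntegrableOn (fun z => (inner ℝ (g z.2) (f z) : ℝ)) (cyl T) :=
    fun {g f} hg hgb hf => by
      obtain ⟨C, hC⟩ := hgb
      exact integrable_inner_of_bound hf (hg.comp continuous_snd).aestronglyMeasurable
        (ae_of_all _ fun z => hC z.2)
  have hvt : IntegrableOn (tderiv v) (cyl T) := memLp_one_iff_integrable.1 (memLp_tderiv hv 1)
  have hvx : IntegrableOn (xderiv v) (cyl T) := memLp_one_iff_integrable.1 (memLp_xderiv hv 1)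
  have hv1 : IntegrableOn (fun z : ℝ × ℝ => v z.1 z.2) (cyl T) :=
    memLp_one_iff_integrable.1 (memLp_lipschitz hv 1)
  have hψc := hψ.smooth.continuous
  have i1 := bdd hψc hψ.exists_bound hvt
  have i2 := bdd hψc hψ.exists_bound (B.integrable_comp hvx)
  have i3 := (bdd hψ.continuous_deriv hψ.exists_bound_deriv (A.integrable_comp hvx)).const_mul ε
  have i4 := bdd hψc hψ.exists_bound hr₁.integrableOn
  have i5 := bdd hψc hψ.exists_bound hv1
  have i6 := bdd hψ.continuous_deriv hψ.exists_bound_deriv (B.integrable_comp hv1)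
  set F : ℝ × ℝ → ℝ := fun z => inner ℝ (ψ z.2) (tderiv v z) + inner ℝ (ψ z.2) (B (xderiv v z))
    + ε * inner ℝ (deriv ψ z.2) (A (xderiv v z)) - inner ℝ (ψ z.2) (r₁ z.1 z.2) with hF
  have iF : IntegrableOn F (cyl T) := ((i1.add i2).add i3).sub i4
  have iFt : IntegrableOn (fun t => ∫ x in Om, F (t, x)) (Ioo 0 T) := by
    have h := iF
    rw [IntegrableOn, cyl, Measure.volume_eq_prod, ← Measure.prod_restrict] at h
    exact h.integral_prod_left
  have ir : IntegrableOn (fun t => ε * r₂ t (toH10 ψ hψ)) (Ioo 0 T) := by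
    have h : IntegrableOn (fun t => r₂ t (toH10 ψ hψ)) (Ioo 0 T) :=
      (memLp_dual_apply hr₂ (toH10 ψ hψ)).integrable one_le_two
    exact h.const_mul ε
  -- Here `θ` is supported in the open interval `(0,T)`, so the initial term drops out.
  have key : ∀ θ : ℝ → ℝ, ContDiff ℝ ∞ θ → HasCompactSupport θ → tsupport θ ⊆ Ioo 0 T →
      ∫ t, θ t • ((∫ x in Om, F (t, x)) - ε * r₂ t (toH10 ψ hψ)) = 0 := by
    intro θ h1 h2 h3
    have hθ : IsTest (Ioo 0 T) θ := ⟨h1, h2, h3⟩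
    have hθ' : IsTest (Iio T) θ := ⟨h1, h2, h3.trans fun t ht => ht.2⟩
    obtain ⟨Cθ, hCθ⟩ := hθ.exists_bound
    obtain ⟨Cθ', hCθ'⟩ := hθ.exists_bound_deriv
    have mulθ : ∀ {f : ℝ × ℝ → ℝ}, IntegrableOn f (cyl T) →
        IntegrableOn (fun z => θ z.1 * f z) (cyl T) := fun {f} hf =>
      hf.bdd_mul (c := Cθ) (h1.continuous.comp continuous_fst).aestronglyMeasurable
        (ae_of_all _ fun z => hCθ z.1)
    have mulθ' : ∀ {f : ℝ × ℝ → ℝ}, IntegrableOn f (cyl T) →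
        IntegrableOn (fun z => deriv θ z.1 * f z) (cyl T) := fun {f} hf =>
      hf.bdd_mul (c := Cθ') (hθ.continuous_deriv.comp continuous_fst).aestronglyMeasurable
        (ae_of_all _ fun z => hCθ' z.1)
    have mulθ1 : ∀ {f : ℝ → ℝ}, IntegrableOn f (Ioo 0 T) →
        IntegrableOn (fun t => θ t * f t) (Ioo 0 T) := fun {f} hf =>
      hf.bdd_mul (c := Cθ) h1.continuous.aestronglyMeasurable (ae_of_all _ hCθ)
    have hw := hweak _ (isSTTest_smul_right hθ' hψ)
    have d1 : ∀ t x, deriv (fun s => θ s • ψ x) t = deriv θ t • ψ x := fun t x =>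
      ((hθ.hasDerivAt t).smul_const _).deriv
    have d2 : ∀ t x, deriv (fun y => θ t • ψ y) x = θ t • deriv ψ x := fun t x =>
      ((hψ.hasDerivAt x).fun_const_smul (θ t)).deriv
    have h0 : θ 0 = 0 := image_eq_zero_of_notMem_tsupport fun h' => lt_irrefl (0 : ℝ) (h3 h').1
    have e1 : ∫ t in Ioo 0 T, r₂ t (toH10 (fun x => θ t • ψ x)
        ((isSTTest_smul_right hθ' hψ).slice t)) = ∫ t in Ioo 0 T, θ t * r₂ t (toH10 ψ hψ) := by
      refine integral_congr_ae (ae_of_all _ fun t => ?_)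
      simp only
      rw [toH10_smul hψ, map_smul, smul_eq_mul]
    have e2 : ∫ t in Ioo 0 T, ∫ x in Om, (inner ℝ (deriv (fun s => θ s • ψ x) t) (v t x)
          + inner ℝ (deriv (fun y => θ t • ψ y) x) (B (v t x) - ε • A (deriv (v t) x))
          + inner ℝ (r₁ t x) (θ t • ψ x)) = - ∫ z in cyl T, θ z.1 * F z := by
      have iA : IntegrableOn (fun z : ℝ × ℝ => (deriv θ z.1 * inner ℝ (ψ z.2) (v z.1 z.2)
        + θ z.1 * inner ℝ (ψ z.2) (tderiv v z) : ℝ)) (cyl T) := (mulθ' i5).add (mulθ i1)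
      have iB : IntegrableOn (fun z : ℝ × ℝ => θ z.1 * (inner ℝ (deriv ψ z.2) (B (v z.1 z.2))
        + inner ℝ (ψ z.2) (B (xderiv v z)) : ℝ)) (cyl T) := mulθ (i6.add i2)
      have zB : ∫ z in cyl T, θ z.1 * (inner ℝ (deriv ψ z.2) (B (v z.1 z.2))
          + inner ℝ (ψ z.2) (B (xderiv v z)) : ℝ) = 0 := by
        rw [← integral_cyl iB]
        refine integral_eq_zero_of_ae (ae_of_all _ fun t => ?_)
        simp only [integral_const_mul]
        rw [space_parts hv B hψ t, mul_zero]
        rfl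
      have iAB : IntegrableOn (fun z : ℝ × ℝ =>
          (deriv θ z.1 * inner ℝ (ψ z.2) (v z.1 z.2) + θ z.1 * inner ℝ (ψ z.2) (tderiv v z))
            + θ z.1 * (inner ℝ (deriv ψ z.2) (B (v z.1 z.2))
              + inner ℝ (ψ z.2) (B (xderiv v z))) : ℝ × ℝ → ℝ) (cyl T) := iA.add iB
      have e3 : - ∫ z in cyl T, θ z.1 * F z = ∫ z in cyl T,
          ((deriv θ z.1 * inner ℝ (ψ z.2) (v z.1 z.2) + θ z.1 * inner ℝ (ψ z.2) (tderiv v z))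
            + θ z.1 * (inner ℝ (deriv ψ z.2) (B (v z.1 z.2)) + inner ℝ (ψ z.2) (B (xderiv v z)))
            - θ z.1 * F z : ℝ) := by
        rw [integral_sub iAB (mulθ iF), integral_add iA iB, time_parts hT hv hθ hψ, zB]
        ring
      rw [e3]
      refine Eq.trans ?_ (integral_cyl (iAB.sub (mulθ iF)))
      refine integral_congr_ae (ae_of_all _ fun t => integral_congr_ae (ae_of_all _ fun x => ?_))
      simp only [d1, d2, hF, real_inner_smul_left, real_inner_smul_right, inner_sub_right,
        xderiv]
      rw [real_inner_comm (ψ x) (r₁ t x)]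
      ring
    have hw' := e2.symm.trans (eq_neg_of_add_eq_zero_left (by
      have : ∫ x in Om, (inner ℝ (v₀ x) (θ 0 • ψ x) : ℝ) = 0 := by simp [h0]
      rw [this, add_zero] at hw
      exact hw))
    rw [e1] at hw'
    have e4 : ∫ t, θ t • ((∫ x in Om, F (t, x)) - ε * r₂ t (toH10 ψ hψ))
        = ∫ t in Ioo 0 T, θ t * ((∫ x in Om, F (t, x)) - ε * r₂ t (toH10 ψ hψ)) :=
      (setIntegral_eq_integral_of_forall_compl_eq_zero fun t ht => by
        rw [image_eq_zero_of_notMem_tsupport fun h' => ht (h3 h'), zero_smul]).symm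
    rw [e4]
    simp only [mul_sub]
    rw [integral_sub (mulθ1 iFt) (mulθ1 ir)]
    have e5 : ∫ t in Ioo 0 T, θ t * ∫ x in Om, F (t, x) = ∫ z in cyl T, θ z.1 * F z := by
      rw [← integral_cyl (mulθ iF)]
      simp only [integral_const_mul]
    have e6 : ∫ t in Ioo 0 T, θ t * (ε * r₂ t (toH10 ψ hψ))
        = ε * ∫ t in Ioo 0 T, θ t * r₂ t (toH10 ψ hψ) := by
      rw [← integral_const_mul]
      refine integral_congr_ae (ae_of_all _ fun t => ?_)
      simp only
      ring
    rw [e5, e6]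
    linarith
  rw [ae_restrict_iff' measurableSet_Ioo]
  filter_upwards [isOpen_Ioo.ae_eq_zero_of_integral_contDiff_smul_eq_zero
    ((iFt.sub ir).locallyIntegrableOn) key] with t ht hm
  exact sub_eq_zero.1 (ht hm)

/-- Separability gives a countable dense family of test pairs, hence one null set of times that
serves all of `H¹₀`. -/
instance : TopologicalSpace.SeparableSpace (Lp (Vec m) 2 (volume.restrict Om)) := by
  have : Fact ((2 : ℝ≥0∞) ≠ ⊤) := ⟨ENNReal.ofNat_ne_top⟩
  infer_instance

instance : TopologicalSpace.SeparableSpace (L2Pair m) :=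
  (WithLp.prodContinuousLinearEquiv 2 ℝ (Lp (Vec m) 2 (volume.restrict Om))
    (Lp (Vec m) 2 (volume.restrict Om))).symm.surjective.denseRange.separableSpace
    (ContinuousLinearEquiv.continuous _)

/-- The perturbed system holds in `H⁻¹(Ω)` at almost every time. -/
theorem perturbed_ae (hT : 0 ≤ T) (hv : LipschitzWith K (Function.uncurry v))
    {r₁ : ℝ → ℝ → Vec m} (hr₁ : MemLpL2 1 T r₁) {r₂ : ℝ → Hneg1 m}
    (hr₂ : MemLp r₂ 2 (volume.restrict (Ioo 0 T))) {v₀ : ℝ → Vec m}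
    (hweak : ∀ (φ : ℝ → ℝ → Vec m) (hφ : IsSTTest T φ),
      (∫ t in Ioo 0 T, ∫ x in Om,
        (inner ℝ (deriv (fun s => φ s x) t) (v t x)
          + inner ℝ (deriv (φ t) x) (B (v t x) - ε • A (deriv (v t) x))
          + inner ℝ (r₁ t x) (φ t x)))
      + ε * (∫ t in Ioo 0 T, r₂ t (toH10 (φ t) (hφ.slice t)))
      + ∫ x in Om, inner ℝ (v₀ x) (φ 0 x) = 0) :
    ∀ᵐ t ∂(volume.restrict (Ioo 0 T)), ∀ p : H10 m,
      (∫ x in Om, (inner ℝ ((p : L2Pair m).fst x) (tderiv v (t, x))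
        + inner ℝ ((p : L2Pair m).fst x) (B (xderiv v (t, x)))
        + ε * inner ℝ ((p : L2Pair m).snd x) (A (xderiv v (t, x)))
        - inner ℝ ((p : L2Pair m).fst x) (r₁ t x) : ℝ)) = ε * r₂ t p := by
  -- The null set in `perturbed_test` depends on the test function, so the identity is first imposed
  -- on a countable dense set only.
  obtain ⟨C, hCS, hCc, hCd⟩ := (TopologicalSpace.IsSeparable.of_separableSpace
    (testSubmodule m : Set (L2Pair m))).exists_countable_dense_subset
  have hS : testSubmodule m ≤ (testSubmodule m).topologicalClosure :=
    Submodule.le_topologicalClosure _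
  have h1 : ∀ᵐ t ∂(volume.restrict (Ioo 0 T)), ∀ c, ∀ hc : c ∈ C,
      (∫ x in Om, (inner ℝ (c.fst x) (tderiv v (t, x))
        + inner ℝ (c.fst x) (B (xderiv v (t, x)))
        + ε * inner ℝ (c.snd x) (A (xderiv v (t, x)))
        - inner ℝ (c.fst x) (r₁ t x) : ℝ)) = ε * r₂ t ⟨c, hS (hCS hc)⟩ := by
    refine (ae_ball_iff hCc).2 fun c hc => ?_
    obtain ⟨ψ, hψ, rfl⟩ := hCS hc
    filter_upwards [perturbed_test hT hv hr₁ hr₂ hweak hψ] with t ht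
    refine Eq.trans (integral_congr_ae ?_) ht
    filter_upwards [testPair_fst hψ, testPair_snd hψ] with x h1 h2
    rw [h1, h2]
  filter_upwards [h1, hr₁.ae_memLp] with t ht hrt p
  have hvt : MemLp (fun x => tderiv v (t, x)) 2 (volume.restrict Om) :=
    (memLp_top_of_bound ((stronglyMeasurable_tderiv hv).comp_measurable
      measurable_prodMk_left).aestronglyMeasurable K (ae_of_all _ fun x =>
        norm_tderiv_le hv (t, x))).mono_exponent le_top
  have hvx : MemLp (fun x => xderiv v (t, x)) 2 (volume.restrict Om) :=
    (memLp_top_of_bound ((stronglyMeasurable_xderiv hv).comp_measurable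
      measurable_prodMk_left).aestronglyMeasurable K (ae_of_all _ fun x =>
        norm_xderiv_le hv (t, x))).mono_exponent le_top
  have ha : MemLp (fun x => tderiv v (t, x) + B (xderiv v (t, x)) - r₁ t x) 2
      (volume.restrict Om) := (hvt.add (B.comp_memLp' hvx)).sub hrt
  have hb : MemLp (fun x => ε • A (xderiv v (t, x))) 2 (volume.restrict Om) :=
    (A.comp_memLp' hvx).const_smul ε
  set q : L2Pair m := WithLp.toLp 2 (ha.toLp _, hb.toLp _) with hq
  have hq1 : q.fst =ᵐ[volume.restrict Om] _ := ha.coeFn_toLp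
  have hq2 : q.snd =ᵐ[volume.restrict Om] _ := hb.coeFn_toLp
  -- At a fixed time the left side is the inner product with a fixed `L²` pair, so both sides are
  -- continuous in `p` and the identity passes to the closure.
  have hΛ : ∀ p : L2Pair m, (∫ x in Om, (inner ℝ (p.fst x) (tderiv v (t, x))
        + inner ℝ (p.fst x) (B (xderiv v (t, x)))
        + ε * inner ℝ (p.snd x) (A (xderiv v (t, x)))
        - inner ℝ (p.fst x) (r₁ t x) : ℝ)) = inner ℝ p q := by
    intro p
    rw [inner_L2Pair, ← integral_add (L2.integrable_inner _ _) (L2.integrable_inner _ _)]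
    refine integral_congr_ae ?_
    filter_upwards [hq1, hq2] with x h1 h2
    rw [h1, h2, inner_sub_right, inner_add_right, real_inner_smul_right]
    ring
  simp only [hΛ] at ht ⊢
  obtain ⟨c, hc, hcp⟩ := mem_closure_iff_seq_limit.1
    (closure_minimal hCd isClosed_closure (show (p : L2Pair m) ∈ closure _ from p.2))
  have hlim1 : Tendsto (fun n => inner ℝ (c n) q) atTop (𝓝 (inner ℝ (p : L2Pair m) q)) :=
    hcp.inner tendsto_const_nhds
  have hlim2 : Tendsto (fun n => (⟨c n, hS (hCS (hc n))⟩ : H10 m)) atTop (𝓝 p) :=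
    tendsto_subtype_rng.2 hcp
  have hlim3 := (((r₂ t).continuous.tendsto p).comp hlim2).const_mul ε
  refine tendsto_nhds_unique hlim1 (hlim3.congr fun n => ?_)
  exact (ht (c n) (hc n)).symm

end Perturbed


/-! ### From the weak differential inequality in time to its integrated form -/

section Gronwall

open Filter Topology

variable {T : ℝ}

/-- A locally integrable function with nonpositive integral against all nonnegative test functions
is nonpositive almost everywhere. -/
theorem ae_nonpos_of_integral_test_nonpos {a b : ℝ} {F : ℝ → ℝ} (hF : IntegrableOn F (Ioo a b))
    (h : ∀ ρ : ℝ → ℝ, IsTest (Ioo a b) ρ → (∀ t, 0 ≤ ρ t) → ∫ t in Ioo a b, ρ t * F t ≤ 0) :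
    ∀ᵐ t ∂(volume.restrict (Ioo a b)), F t ≤ 0 := by
  let β : ℕ → ContDiffBump (0 : ℝ) := fun n =>
    ⟨1 / (n + 1), 2 / (n + 1), by positivity, by gcongr; norm_num⟩
  have hβ : Tendsto (fun n => (β n).rOut) atTop (𝓝 0) := by
    have h := tendsto_one_div_add_atTop_nhds_zero_nat (𝕜 := ℝ) |>.const_mul 2
    simpa [β, div_eq_mul_inv] using h
  have hi : Integrable ((Ioo a b).indicator F) := hF.integrable_indicator measurableSet_Ioo
  rw [ae_restrict_iff' measurableSet_Ioo]
  filter_upwards [ContDiffBump.ae_convolution_tendsto_right_of_locallyIntegrable (K := 2) hβ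
    (Eventually.of_forall fun n => le_of_eq (by simp [β, div_eq_mul_inv]))
    hi.locallyIntegrable] with t ht htm
  rw [indicator_of_mem htm] at ht
  refine le_of_tendsto ht ?_
  have hd : 0 < min (t - a) (b - t) := lt_min (by linarith [htm.1]) (by linarith [htm.2])
  filter_upwards [hβ.eventually (gt_mem_nhds hd)] with n hn
  rw [lt_min_iff] at hn
  -- The mollification of `F` at `t` is the integral of `F` against this reflected bump, which is
  -- admissible once its radius is below the distance from `t` to the end points.
  set ρ : ℝ → ℝ := fun s => (β n).normed volume (t - s) with hρ
  have hts : tsupport ρ ⊆ Metric.closedBall t (β n).rOut := by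
    refine closure_minimal (fun s hs => ?_) Metric.isClosed_closedBall
    have h1 : t - s ∈ tsupport ((β n).normed (volume : Measure ℝ)) := subset_tsupport _ hs
    rw [(β n).tsupport_normed_eq, Metric.mem_closedBall, dist_zero_right] at h1
    rwa [Metric.mem_closedBall, dist_comm, dist_eq_norm]
  have hρt : IsTest (Ioo a b) ρ := by
    refine ⟨(β n).contDiff_normed.comp (by fun_prop),
      (isCompact_closedBall t (β n).rOut).of_isClosed_subset (isClosed_tsupport _) hts,
      hts.trans fun s hs => ?_⟩
    rw [Metric.mem_closedBall, Real.dist_eq, abs_le] at hs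
    exact ⟨by linarith [hs.1], by linarith [hs.2]⟩
  have h1 := h ρ hρt fun s => (β n).nonneg_normed _
  have h2 : (convolution ((β n).normed volume) ((Ioo a b).indicator F)
      (ContinuousLinearMap.lsmul ℝ ℝ) volume) t = ∫ s in Ioo a b, ρ s * F s := by
    rw [convolution_eq_swap, ← integral_indicator measurableSet_Ioo]
    refine integral_congr_ae (ae_of_all _ fun s => ?_)
    by_cases hs : s ∈ Ioo a b
    · simp [hs, hρ]
    · simp [hs]
  rw [h2]
  exact h1

/-- The integrated form of a differential inequality with initial value. -/
theorem ae_add_integral_le (hT : 0 < T) {e h : ℝ → ℝ} {c : ℝ} (he : IntegrableOn e (Ioo 0 T))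
    (hh : IntegrableOn h (Ioo 0 T))
    (H : ∀ θ : ℝ → ℝ, IsTest (Iio T) θ → (∀ t ∈ Ico 0 T, 0 ≤ θ t) →
      0 ≤ (∫ t in Ioo 0 T, (deriv θ t * e t - θ t * h t)) + θ 0 * c) :
    ∀ᵐ t ∂(volume.restrict (Ioo 0 T)), e t + ∫ s in Ioo 0 t, h s ≤ c := by
  set h' := (Ioo 0 T).indicator h with hh'
  have hi : Integrable h' := hh.integrable_indicator measurableSet_Ioo
  set P : ℝ → ℝ := fun t => ∫ s in (0 : ℝ)..t, h' s with hP
  have hPc : Continuous P := intervalIntegral.continuous_primitive (fun _ _ => hi.intervalIntegrable) 0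
  have hPac : AbsolutelyContinuousOnInterval P 0 T :=
    hi.intervalIntegrable.absolutelyContinuousOnInterval_intervalIntegral (by simp)
  have hPd : ∀ᵐ t, t ∈ Ioo 0 T → HasDerivAt P (h t) t := by
    filter_upwards [_root_.LocallyIntegrable.ae_hasDerivAt_integral hi.locallyIntegrable] with t ht htm
    have := ht 0
    rwa [hh', indicator_of_mem htm] at this
  have hPi : IntegrableOn P (Ioo 0 T) :=
    (hPc.integrableOn_Icc (a := 0) (b := T)).mono_set Ioo_subset_Icc_self
  have hci : IntegrableOn (fun _ : ℝ => c) (Ioo 0 T) := integrableOn_const (by simp)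
  -- Tested with `ρ ≥ 0`: choosing `θ` with `θ' = -ρ` and `θ(T) = 0` gives `θ(0) = ∫ρ`, the factor
  -- of `c`, and integration by parts turns `∫ θh` into `∫ ρP`.
  have key : ∀ᵐ t ∂(volume.restrict (Ioo 0 T)), e t + P t - c ≤ 0 := by
    refine ae_nonpos_of_integral_test_nonpos ((he.add hPi).sub hci) fun ρ hρ hρ0 => ?_
    have hρc : Continuous ρ := hρ.smooth.continuous
    -- a smooth primitive of `-ρ` vanishing at `T`, cut off for negative times
    obtain ⟨c₁, d₁, hc₁, hcd, hd₁, hK⟩ :=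
      exists_Icc_of_isCompact_subset_Ioo hT hρ.compact.isCompact hρ.supp
    set R : ℝ → ℝ := fun t => ∫ s in t..T, ρ s with hR
    have hRd : ∀ t, HasDerivAt R (-ρ t) t := fun t =>
      intervalIntegral.integral_hasDerivAt_left (hρc.intervalIntegrable _ _)
        (hρc.stronglyMeasurableAtFilter _ _) hρc.continuousAt
    have hR0 : ∀ t ≤ T, 0 ≤ R t := fun t ht =>
      intervalIntegral.integral_nonneg ht fun s _ => hρ0 s
    have hρz : ∀ s, d₁ < s → ρ s = 0 := fun s hs => image_eq_zero_of_notMem_tsupport fun h' =>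
      absurd (hK h').2 (not_le.2 hs)
    have hRz : ∀ t, d₁ ≤ t → R t = 0 := fun t ht => by
      refine intervalIntegral.integral_zero_ae (ae_of_all _ fun s hs => hρz s ?_)
      rcases le_total t T with h1 | h1
      · rw [uIoc_of_le h1] at hs
        exact ht.trans_lt hs.1
      · rw [uIoc_of_ge h1] at hs
        exact hd₁.trans hs.1
    have hRs : ContDiff ℝ ∞ R := by
      refine contDiff_infty_iff_deriv.2 ⟨fun t => (hRd t).differentiableAt, ?_⟩
      have : deriv R = fun t => -ρ t := funext fun t => (hRd t).deriv
      rw [this]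
      exact hρ.smooth.neg
    -- The factor is `0` for `t ≤ -2` and `1` for `t ≥ -1`: it gives compact support without
    -- changing `R` near `[0,T]`.
    set θ : ℝ → ℝ := fun t => Real.smoothTransition (t + 2) * R t with hθ
    have hts : tsupport θ ⊆ Icc (-2) d₁ := by
      refine closure_minimal (fun t ht => ?_) isClosed_Icc
      by_contra hn
      refine ht ?_
      rcases not_and_or.1 hn with h1 | h1
      · simp only [hθ]
        rw [Real.smoothTransition.zero_of_nonpos (by linarith [not_le.1 h1]), zero_mul]
      · simp only [hθ]
        rw [hRz t (not_le.1 h1).le, mul_zero]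
    have hθt : IsTest (Iio T) θ :=
      ⟨(Real.smoothTransition.contDiff.comp (by fun_prop)).mul hRs,
        isCompact_Icc.of_isClosed_subset (isClosed_tsupport _) hts,
        hts.trans fun t ht => ht.2.trans_lt hd₁⟩
    have hθR : ∀ t, -1 ≤ t → θ t = R t := fun t ht => by
      simp only [hθ]
      rw [Real.smoothTransition.one_of_one_le (by linarith), one_mul]
    have hθd : ∀ t, 0 ≤ t → deriv θ t = -ρ t := fun t ht => by
      have : θ =ᶠ[𝓝 t] R := by
        filter_upwards [Ioi_mem_nhds (show (-1 : ℝ) < t by linarith)] with s hs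
        exact hθR s (le_of_lt hs)
      rw [this.deriv_eq, (hRd t).deriv]
    have hH := H θ hθt fun t ht => by
      rw [hθR t (by linarith [ht.1])]
      exact hR0 t ht.2.le
    have hθ0 : θ 0 = ∫ t in Ioo 0 T, ρ t := by
      rw [hθR 0 (by norm_num), hR]
      simp only
      rw [intervalIntegral.integral_of_le hT.le,
        integral_Ioc_eq_integral_Ioo]
    obtain ⟨C, hC⟩ := hρ.exists_bound
    obtain ⟨D, hD⟩ := hθt.exists_bound
    have mulρ : ∀ {f : ℝ → ℝ}, IntegrableOn f (Ioo 0 T) →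
        IntegrableOn (fun t => ρ t * f t) (Ioo 0 T) := fun {f} hf =>
      hf.bdd_mul (c := C) hρc.aestronglyMeasurable (ae_of_all _ hC)
    have hθh : IntegrableOn (fun t => θ t * h t) (Ioo 0 T) :=
      hh.bdd_mul (c := D) hθt.smooth.continuous.aestronglyMeasurable (ae_of_all _ hD)
    have hθP : ∫ t in Ioo 0 T, (deriv θ t * P t + θ t * h t) = 0 := by
      have := integral_eq_sub_of_absolutelyContinuous hT.le ((hθt.ac 0 T).mul hPac)
        (f' := fun t => deriv θ t * P t + θ t * h t) (by
          filter_upwards [hPd] with t ht htm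
          exact (hθt.hasDerivAt t).mul (ht htm))
      rw [this]
      simp [hθt.apply_right, hP]
    have e1 : ∫ t in Ioo 0 T, (deriv θ t * P t + θ t * h t)
        = ∫ t in Ioo 0 T, (θ t * h t - ρ t * P t) :=
      setIntegral_congr_fun measurableSet_Ioo fun t ht => by
        simp only [hθd t ht.1.le]
        ring
    have e2 : ∫ t in Ioo 0 T, (deriv θ t * e t - θ t * h t)
        = ∫ t in Ioo 0 T, (-(ρ t * e t) - θ t * h t) :=
      setIntegral_congr_fun measurableSet_Ioo fun t ht => by
        simp only [hθd t ht.1.le]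
        ring
    rw [e1, integral_sub hθh (mulρ hPi)] at hθP
    have i0 : IntegrableOn (fun t => -(ρ t * e t)) (Ioo 0 T) := (mulρ he).neg
    rw [e2, integral_sub i0 hθh, integral_neg, hθ0] at hH
    have e3 : ∫ t in Ioo 0 T, ρ t * (e t + P t - c) = (∫ t in Ioo 0 T, ρ t * e t)
        + (∫ t in Ioo 0 T, ρ t * P t) - (∫ t in Ioo 0 T, ρ t) * c := by
      simp only [mul_sub, mul_add]
      have i1 : IntegrableOn (fun t => ρ t * e t + ρ t * P t) (Ioo 0 T) := (mulρ he).add (mulρ hPi)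
      rw [integral_sub i1 (mulρ hci), integral_add (mulρ he) (mulρ hPi), integral_mul_const]
    refine le_of_eq_of_le e3 ?_
    linarith
  filter_upwards [key, ae_restrict_mem measurableSet_Ioo] with t ht htm
  have h1 : P t = ∫ s in Ioo 0 t, h s := by
    simp only [hP]
    rw [intervalIntegral.integral_of_le htm.1.le, integral_Ioc_eq_integral_Ioo]
    exact setIntegral_congr_fun measurableSet_Ioo fun s hs =>
      indicator_of_mem (show s ∈ Ioo 0 T from ⟨hs.1, hs.2.trans htm.2⟩) h
  rw [← h1]
  linarith

end Gronwall


/-! ### Symmetry of `B` and coercivity of `A` -/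

section Matrices

variable {m : ℕ}

theorem inner_mulOp_of_isDiag {B : Matrix (Fin m) (Fin m) ℝ} (hB : B.IsDiag) (x y : Vec m) :
    inner ℝ (mulOp B x) y = inner ℝ x (mulOp B y) := by
  have h : star (mulOp B) = mulOp B := by
    rw [mulOp, ← map_star, Matrix.star_eq_conjTranspose, Matrix.conjTranspose_eq_transpose_of_trivial,
      hB.isSymm.eq]
  conv_lhs => rw [← h, ContinuousLinearMap.star_eq_adjoint]
  exact ContinuousLinearMap.adjoint_inner_left _ _ _

/-- Parseval in an orthonormal eigenbasis of `A`, all of whose eigenvalues are at least `1`. -/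
theorem norm_sq_le_inner_mulOp {A : Matrix (Fin m) (Fin m) ℝ} (hA : A.PosDef)
    (hA1 : IsLeast (spectrum ℝ A) 1) (x : Vec m) : ‖x‖ ^ 2 ≤ inner ℝ x (mulOp A x) := by
  have hH := hA.isHermitian
  have hs : star (mulOp A) = mulOp A := by
    rw [mulOp, ← map_star, Matrix.star_eq_conjTranspose, hH.eq]
  have he : ∀ i, mulOp A (hH.eigenvectorBasis i) = hH.eigenvalues i • hH.eigenvectorBasis i :=
    fun i => by
      ext1
      rw [mulOp, Matrix.ofLp_toEuclideanCLM, hH.mulVec_eigenvectorBasis]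
      rfl
  have h1 : ∀ i, inner ℝ (hH.eigenvectorBasis i) (mulOp A x)
      = hH.eigenvalues i * inner ℝ (hH.eigenvectorBasis i) x := fun i => by
    conv_lhs => rw [← hs, ContinuousLinearMap.star_eq_adjoint]
    rw [ContinuousLinearMap.adjoint_inner_right, he, real_inner_smul_left]
  rw [← real_inner_self_eq_norm_sq, ← hH.eigenvectorBasis.sum_inner_mul_inner x x,
    ← hH.eigenvectorBasis.sum_inner_mul_inner x (mulOp A x)]
  refine Finset.sum_le_sum fun i _ => ?_
  rw [h1, real_inner_comm]
  nlinarith [hA1.2 (hH.eigenvalues_mem_spectrum_real i),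
    sq_nonneg (inner ℝ (hH.eigenvectorBasis i) x : ℝ)]

end Matrices

/-! ### Young, Poincaré, and absorption of the source terms -/

section Estimate

open Filter Topology

variable {m : ℕ} {T ε : ℝ} {K : NNReal}

theorem MemLp.eLpNorm_two_sq {α F : Type*} [MeasurableSpace α] {μ : Measure α}
    [NormedAddCommGroup F] {f : α → F} (hf : MemLp f 2 μ) :
    eLpNorm f 2 μ ^ 2 = ENNReal.ofReal (∫ x, ‖f x‖ ^ 2 ∂μ) := by
  have h := eLpNorm_nnreal_pow_eq_lintegral (f := f) (μ := μ) (p := 2) two_ne_zero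
  simp only [NNReal.coe_ofNat, ENNReal.coe_ofNat, ENNReal.rpow_ofNat] at h
  rw [h, ofReal_integral_eq_lintegral_ofReal hf.norm.integrable_sq
    (ae_of_all _ fun x => sq_nonneg _)]
  refine lintegral_congr fun x => ?_
  rw [← ofReal_norm, ENNReal.ofReal_pow (norm_nonneg _)]

theorem MemLp.ae_slice {f : ℝ × ℝ → Vec m} (hf : MemLp f 2 (volume.restrict (cyl T))) :
    ∀ᵐ t ∂(volume.restrict (Ioo 0 T)), MemLp (fun x => f (t, x)) 2 (volume.restrict Om) := by
  have h1 := (memLp_two_iff_integrable_sq_norm hf.1).1 hf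
  rw [cyl, Measure.volume_eq_prod, ← Measure.prod_restrict] at h1
  filter_upwards [h1.prod_right_ae,
    ae_slice_aestronglyMeasurable (f := fun t x => f (t, x)) hf.1] with t h2 h3
  exact (memLp_two_iff_integrable_sq_norm h3).2 h2

/-- The lower bounds for the dissipation minus the production of relative entropy at a fixed time,
from Young's inequality and Poincaré's inequality. -/
theorem relative_entropy_rate_bounds (hε : 0 < ε) {B A : Vec m →L[ℝ] Vec m}
    (hA : ∀ x, ‖x‖ ^ 2 ≤ inner ℝ x (A x)) {w dw du a b r : ℝ → Vec m} {ℓ : Hneg1 m}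
    (hH : IsH10 w dw) (ha : MemLp a 2 (volume.restrict Om)) (hb : MemLp b 2 (volume.restrict Om))
    (hr : MemLp r 2 (volume.restrict Om)) (hdu : ∀ x, du x = dw x + b x)
    (hℓ : ∀ p : H10 m, (∫ x in Om, (inner ℝ ((p : L2Pair m).fst x) (a x)
        + inner ℝ ((p : L2Pair m).fst x) (B (b x)) + ε * inner ℝ ((p : L2Pair m).snd x) (A (b x))
        - inner ℝ ((p : L2Pair m).fst x) (r x) : ℝ)) = ε * ℓ p) :
    (-((eLpNorm w 2 (volume.restrict Om)).toReal * (eLpNorm r 2 (volume.restrict Om)).toReal)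
        - ε / 3 * ‖ℓ‖ ^ 2
      ≤ ∫ x in Om, (inner ℝ (w x) (a x) + ε * inner ℝ (dw x) (A (du x)) + inner ℝ (w x) (B (b x))))
    ∧ (ε / 2 * (∫ x in Om, ‖dw x‖ ^ 2)
        - (eLpNorm w 2 (volume.restrict Om)).toReal * (eLpNorm r 2 (volume.restrict Om)).toReal
        - 2 * ε / 3 * ‖ℓ‖ ^ 2
      ≤ ∫ x in Om, (inner ℝ (w x) (a x) + ε * inner ℝ (dw x) (A (du x))
        + inner ℝ (w x) (B (b x)))) := by
  obtain ⟨p, hp1, hp2⟩ := hH.exists_mem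
  have hw : MemLp w 2 (volume.restrict Om) := (Lp.memLp (p : L2Pair m).fst).ae_eq hp1
  have hdw := hH.memLp
  have e1 : (∫ x in Om, (inner ℝ (w x) (a x) + inner ℝ (w x) (B (b x))
      + ε * inner ℝ (dw x) (A (b x)) - inner ℝ (w x) (r x) : ℝ)) = ε * ℓ p := by
    rw [← hℓ p]
    refine integral_congr_ae ?_
    filter_upwards [hp1, hp2] with x h1 h2
    rw [h1, h2]
  have hS : ∫ x in Om, ‖w x‖ ^ 2 = ∫ x in Om, ‖(p : L2Pair m).fst x‖ ^ 2 :=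
    integral_congr_ae (by filter_upwards [hp1] with x h1; rw [h1])
  have hD : ∫ x in Om, ‖dw x‖ ^ 2 = ∫ x in Om, ‖(p : L2Pair m).snd x‖ ^ 2 :=
    integral_congr_ae (by filter_upwards [hp2] with x h1; rw [h1])
  -- The `H¹` norm is `‖w‖² + ‖dw‖²`, and Poincaré bounds the first term by a third of the second.
  have hpn : ‖p‖ ^ 2 ≤ 4 / 3 * ∫ x in Om, ‖dw x‖ ^ 2 := by
    have h1 := norm_sq_L2Pair (p : L2Pair m)
    have h2 := hH.integral_sq_le
    rw [← hS, ← hD] at h1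
    rw [← Submodule.norm_coe] at *
    linarith
  have i1 : Integrable (fun x => (inner ℝ (dw x) (A (dw x)) : ℝ)) (volume.restrict Om) :=
    integrable_inner_of_memLp hdw (A.comp_memLp' hdw)
  have i2 : Integrable (fun x => (inner ℝ (w x) (r x) : ℝ)) (volume.restrict Om) :=
    integrable_inner_of_memLp hw hr
  have i3 : Integrable (fun x => (inner ℝ (w x) (a x) + inner ℝ (w x) (B (b x))
      + ε * inner ℝ (dw x) (A (b x)) - inner ℝ (w x) (r x) : ℝ)) (volume.restrict Om) :=
    (((integrable_inner_of_memLp hw ha).add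
      (integrable_inner_of_memLp hw (B.comp_memLp' hb))).add
      ((integrable_inner_of_memLp hdw (A.comp_memLp' hb)).const_mul ε)).sub i2
  have i4 : Integrable (fun x => ε * (inner ℝ (dw x) (A (dw x)) : ℝ) + inner ℝ (w x) (r x))
      (volume.restrict Om) := (i1.const_mul ε).add i2
  -- Substituting `du = dw + b` splits the diffusion; the part with `b`, together with the transport
  -- and time terms, is what the perturbed system evaluates.
  have e2 : ∫ x in Om, (inner ℝ (w x) (a x) + ε * inner ℝ (dw x) (A (du x))
      + inner ℝ (w x) (B (b x)) : ℝ) = (ε * (∫ x in Om, (inner ℝ (dw x) (A (dw x)) : ℝ))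
        + ∫ x in Om, (inner ℝ (w x) (r x) : ℝ)) + ε * ℓ p := by
    rw [← e1, ← integral_const_mul, ← integral_add (i1.const_mul ε) i2, ← integral_add i4 i3]
    refine integral_congr_ae (ae_of_all _ fun x => ?_)
    simp only [hdu, map_add, inner_add_right]
    ring
  have e3 : ∫ x in Om, ‖dw x‖ ^ 2 ≤ ∫ x in Om, (inner ℝ (dw x) (A (dw x)) : ℝ) :=
    integral_mono hdw.norm.integrable_sq i1 fun x => hA (dw x)
  have e4 : |∫ x in Om, (inner ℝ (w x) (r x) : ℝ)|
      ≤ (eLpNorm w 2 (volume.restrict Om)).toReal * (eLpNorm r 2 (volume.restrict Om)).toReal := by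
    have h := abs_real_inner_le_norm (hw.toLp w) (hr.toLp r)
    rw [Lp.norm_toLp, Lp.norm_toLp] at h
    refine le_of_eq_of_le (congrArg abs ?_) h
    rw [L2.inner_def]
    refine integral_congr_ae ?_
    filter_upwards [hw.coeFn_toLp, hr.coeFn_toLp] with x h1 h2
    rw [h1, h2]
  have e5 : |ℓ p| ≤ ‖ℓ‖ * ‖p‖ := ℓ.le_opNorm p
  have e6 := (abs_le.1 e4).1
  have e7 := (abs_le.1 e5).1
  -- Two weights in Young's inequality, `¾‖p‖² + ⅓‖ℓ‖²` and `⅜‖p‖² + ⅔‖ℓ‖²`. By the bound on `‖p‖²`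
  -- they use all and half of the dissipation respectively, and the coefficients of `‖ℓ‖²` add up to
  -- `1`.
  have y1 : ‖ℓ‖ * ‖p‖ ≤ (∫ x in Om, ‖dw x‖ ^ 2) + 1 / 3 * ‖ℓ‖ ^ 2 := by
    nlinarith [sq_nonneg (3 * ‖p‖ - 2 * ‖ℓ‖)]
  have y2 : ‖ℓ‖ * ‖p‖ ≤ 1 / 2 * (∫ x in Om, ‖dw x‖ ^ 2) + 2 / 3 * ‖ℓ‖ ^ 2 := by
    nlinarith [sq_nonneg (3 * ‖p‖ - 4 * ‖ℓ‖)]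
  rw [e2]
  constructor <;> nlinarith

/-- The Gronwall-type argument that absorbs the `L¹(0,T; L²)` source term. -/
theorem gronwall_L1 {t c M : ℝ} (hε : 0 < ε) (hc : 0 ≤ c) (hM : 0 ≤ M)
    {N ρ k D h : ℝ → ℝ} (hNM : ∀ᵐ s ∂(volume.restrict (Ioo 0 t)), N s ≤ M)
    (hρ : IntegrableOn ρ (Ioo 0 t)) (hρ0 : ∀ s, 0 ≤ ρ s)
    (hk : IntegrableOn (fun s => k s ^ 2) (Ioo 0 t)) (hD : IntegrableOn D (Ioo 0 t))
    (hh : IntegrableOn h (Ioo 0 t))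
    (h1 : ∀ᵐ s ∂(volume.restrict (Ioo 0 t)), -(N s * ρ s) - ε / 3 * k s ^ 2 ≤ h s)
    (h2 : ∀ᵐ s ∂(volume.restrict (Ioo 0 t)),
      ε / 2 * D s - N s * ρ s - 2 * ε / 3 * k s ^ 2 ≤ h s)
    (hs : ∀ᵐ s ∂(volume.restrict (Ioo 0 t)), 1 / 2 * N s ^ 2 + ∫ r in Ioo 0 s, h r ≤ 1 / 2 * c)
    (ht : 1 / 2 * N t ^ 2 + ∫ r in Ioo 0 t, h r ≤ 1 / 2 * c)
    (hMs : ∀ C, 0 ≤ C → (∀ᵐ s ∂(volume.restrict (Ioo 0 t)), N s ≤ C) → M ≤ C) :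
    1 / 4 * M ^ 2 + ε / 2 * (∫ s in Ioo 0 t, D s)
      ≤ c + 4 * (∫ s in Ioo 0 t, ρ s) ^ 2 + ε * ∫ s in Ioo 0 t, k s ^ 2 := by
  set R := ∫ s in Ioo 0 t, ρ s with hR
  set Q := ∫ s in Ioo 0 t, k s ^ 2 with hQ
  have hR0 : 0 ≤ R := integral_nonneg hρ0
  have hQ0 : 0 ≤ Q := integral_nonneg fun s => sq_nonneg _
  have ig : IntegrableOn (fun s => M * ρ s + ε / 3 * k s ^ 2) (Ioo 0 t) :=
    (hρ.const_mul M).add (hk.const_mul _)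
  have b1 : 1 / 2 * M ^ 2 ≤ 1 / 2 * c + M * R + ε / 3 * Q := by
    have hpos : 0 ≤ 2 * (1 / 2 * c + M * R + ε / 3 * Q) := by positivity
    -- `M` is minimal among essential upper bounds of `N`, so it suffices to bound `N s` for almost
    -- every `s < t` by a constant; the integrals over `(0,s)` are enlarged to `(0,t)` since their
    -- integrands are nonnegative.
    have : M ≤ √(2 * (1 / 2 * c + M * R + ε / 3 * Q)) := by
      refine hMs _ (Real.sqrt_nonneg _) ?_
      filter_upwards [hs, ae_restrict_mem measurableSet_Ioo] with s h3 hst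
      refine Real.le_sqrt_of_sq_le ?_
      have hsub : Ioo 0 s ⊆ Ioo 0 t := Ioo_subset_Ioo_right hst.2.le
      have l1 : ∫ r in Ioo 0 s, -(M * ρ r + ε / 3 * k r ^ 2) ≤ ∫ r in Ioo 0 s, h r := by
        refine integral_mono_ae (ig.mono_set hsub).neg (hh.mono_set hsub) ?_
        refine ae_restrict_of_ae_restrict_of_subset hsub ?_
        filter_upwards [h1, hNM] with r h4 h5
        nlinarith [hρ0 r]
      have l2 : ∫ r in Ioo 0 s, (M * ρ r + ε / 3 * k r ^ 2)
          ≤ ∫ r in Ioo 0 t, (M * ρ r + ε / 3 * k r ^ 2) :=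
        setIntegral_mono_set ig (ae_of_all _ fun r =>
          add_nonneg (mul_nonneg hM (hρ0 r)) (by positivity)) hsub.eventuallyLE
      have l3 : ∫ r in Ioo 0 t, (M * ρ r + ε / 3 * k r ^ 2) = M * R + ε / 3 * Q := by
        rw [integral_add (hρ.const_mul M) (hk.const_mul _), integral_const_mul,
          integral_const_mul]
      rw [integral_neg] at l1
      linarith
    have h6 := Real.sq_sqrt hpos
    nlinarith
  -- The dissipation on all of `(0,t)` needs the inequality at the end point `t` itself, with
  -- `½N(t)²` discarded.
  have b2 : ε / 2 * (∫ s in Ioo 0 t, D s) ≤ 1 / 2 * c + M * R + 2 * ε / 3 * Q := by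
    have i1 : IntegrableOn (fun s => ε / 2 * D s - M * ρ s) (Ioo 0 t) :=
      (hD.const_mul _).sub (hρ.const_mul M)
    have l1 : ∫ r in Ioo 0 t, (ε / 2 * D r - M * ρ r - 2 * ε / 3 * k r ^ 2)
        ≤ ∫ r in Ioo 0 t, h r := by
      refine integral_mono_ae (i1.sub (hk.const_mul _)) hh ?_
      filter_upwards [h2, hNM] with r h4 h5
      nlinarith [hρ0 r]
    rw [integral_sub i1 (hk.const_mul _), integral_sub (hD.const_mul _) (hρ.const_mul M),
      integral_const_mul, integral_const_mul, integral_const_mul] at l1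
    nlinarith [sq_nonneg (N t)]
  -- Sum of `b1` and `b2` with `2MR ≤ ¼M² + 4R²`, which is `(M - 4R)² ≥ 0`.
  nlinarith [sq_nonneg (M - 4 * R)]

end Estimate


/-! ### The bound for a reference solution Lipschitz on the whole plane -/

section Bound

open Filter Topology

variable {m : ℕ} {T ε : ℝ} {K : NNReal} {B A : Vec m →L[ℝ] Vec m} {v : ℝ → ℝ → Vec m}

/-- Supplies finiteness of the `L^∞(0,t;L²)` norm, without which `M` could not be absorbed. As `Ω`
has measure one, the `L²` norm of a slice is at most its essential supremum. -/
theorem ae_eLpNorm_slice_le {f : ℝ → ℝ → Vec m}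
    (hf : MemLp (Function.uncurry f) ⊤ (volume.restrict (cyl T))) :
    ∃ C : ℝ≥0∞, C ≠ ⊤ ∧
      ∀ᵐ t ∂(volume.restrict (Ioo 0 T)), eLpNorm (f t) 2 (volume.restrict Om) ≤ C := by
  refine ⟨eLpNorm (Function.uncurry f) ⊤ (volume.restrict (cyl T)), hf.2.ne, ?_⟩
  have h := ae_le_eLpNormEssSup (f := Function.uncurry f) (μ := volume.restrict (cyl T))
  rw [← eLpNorm_exponent_top] at h
  set C := eLpNorm (Function.uncurry f) ⊤ (volume.restrict (cyl T)) with hC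
  have hCt : C ≠ ⊤ := hf.2.ne
  have h' : ∀ᵐ z ∂((volume.restrict (Ioo (0 : ℝ) T)).prod (volume.restrict Om)),
      ‖Function.uncurry f z‖ₑ ≤ C := by
    rw [Measure.prod_restrict, ← Measure.volume_eq_prod]
    exact h
  filter_upwards [Measure.ae_ae_of_ae_prod h'] with t ht
  have h2 := eLpNorm_le_of_ae_bound (p := 2) (μ := volume.restrict Om) (f := f t) (C := C.toReal) (by
    filter_upwards [ht] with x hx
    rw [← toReal_enorm]
    exact ENNReal.toReal_mono hCt hx)
  refine h2.trans ?_
  have : (volume.restrict Om) univ = 1 := by simp [Om]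
  rw [this, ENNReal.one_rpow, one_mul, ENNReal.ofReal_toReal hCt]

theorem MemLp.eLpNorm_two_sq_dual {E α : Type*} [NormedAddCommGroup E] [NormedSpace ℝ E]
    [MeasurableSpace α] {μ : Measure α} {f : α → StrongDual ℝ E} (hf : MemLp f 2 μ) :
    eLpNorm f 2 μ ^ 2 = ENNReal.ofReal (∫ x, ‖f x‖ ^ 2 ∂μ) :=
  MemLp.eLpNorm_two_sq hf

theorem memLp_mono_restrict_dual {E α : Type*} [NormedAddCommGroup E] [NormedSpace ℝ E]
    [MeasurableSpace α] {μ : Measure α} {p : ℝ≥0∞} {s t : Set α} {f : α → StrongDual ℝ E}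
    (hf : MemLp f p (μ.restrict t)) (h : s ⊆ t) : MemLp f p (μ.restrict s) :=
  hf.mono_measure (Measure.restrict_mono h le_rfl)

theorem ofReal_bound {M D c R Q : ℝ} (hε : 0 < ε) (hD : 0 ≤ D) (hc : 0 ≤ c) (hR : 0 ≤ R)
    (hQ : 0 ≤ Q) (h : 1 / 4 * M ^ 2 + ε / 2 * D ≤ c + 4 * R ^ 2 + ε * Q) :
    (1 / 4 : ℝ≥0∞) * ENNReal.ofReal (M ^ 2) + ENNReal.ofReal (ε / 2) * ENNReal.ofReal D
      ≤ ENNReal.ofReal c + 4 * ENNReal.ofReal R ^ 2 + ENNReal.ofReal ε * ENNReal.ofReal Q := by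
  have q1 : (1 / 4 : ℝ≥0∞) = ENNReal.ofReal (1 / 4) := by
    rw [ENNReal.ofReal_div_of_pos (by norm_num), ENNReal.ofReal_one]
    norm_num
  have q2 : (4 : ℝ≥0∞) = ENNReal.ofReal 4 := by norm_num
  rw [q1, q2, ← ENNReal.ofReal_pow hR,
    ← ENNReal.ofReal_mul (by norm_num), ← ENNReal.ofReal_mul (by positivity),
    ← ENNReal.ofReal_mul (by norm_num), ← ENNReal.ofReal_mul hε.le,
    ← ENNReal.ofReal_add (by positivity) (by positivity),
    ← ENNReal.ofReal_add hc (by positivity), ← ENNReal.ofReal_add (by positivity) (by positivity)]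
  exact ENNReal.ofReal_le_ofReal h

/-- The relative entropy bound for a reference solution that is Lipschitz on the whole plane. -/
theorem relative_entropy_bound (hT : 0 < T) (hε : 0 < ε)
    (hB : ∀ x y, inner ℝ (B x) y = inner ℝ x (B y)) (hA : ∀ x, ‖x‖ ^ 2 ≤ inner ℝ x (A x))
    {u du : ℝ → ℝ → Vec m} {u₀ : ℝ → Vec m}
    (hu : MemLp (Function.uncurry u) 2 (volume.restrict (cyl T)))
    (hdu : MemLp (Function.uncurry du) 2 (volume.restrict (cyl T)))
    (hu₀ : MemLp u₀ 2 (volume.restrict Om))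
    (hsol : IsEntropySolution T ε B (fun _ => A) quadEntropy
      (fun u => 1 / 2 * inner ℝ u (B u)) u du u₀)
    (hv : LipschitzWith K (Function.uncurry v))
    (hH : ∀ᵐ t ∂(volume.restrict (Ioo 0 T)),
      IsH10 (fun x => u t x - v t x) (fun x => du t x - deriv (v t) x))
    {r₁ : ℝ → ℝ → Vec m} (hr₁ : MemLpL2 1 T r₁) {r₂ : ℝ → Hneg1 m}
    (hr₂ : MemLp r₂ 2 (volume.restrict (Ioo 0 T))) {v₀ : ℝ → Vec m}
    (hweak : ∀ (φ : ℝ → ℝ → Vec m) (hφ : IsSTTest T φ),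
      (∫ t in Ioo 0 T, ∫ x in Om,
        (inner ℝ (deriv (fun s => φ s x) t) (v t x)
          + inner ℝ (deriv (φ t) x) (B (v t x) - ε • A (deriv (v t) x))
          + inner ℝ (r₁ t x) (φ t x)))
      + ε * (∫ t in Ioo 0 T, r₂ t (toH10 (φ t) (hφ.slice t)))
      + ∫ x in Om, inner ℝ (v₀ x) (φ 0 x) = 0) :
    ∀ᵐ t ∂(volume.restrict (Ioo 0 T)),
      (1 / 4 : ℝ≥0∞) * normLpL2 ⊤ t (fun s x => u s x - v s x) ^ 2
        + ENNReal.ofReal (ε / 2) *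
          eLpNorm (Function.uncurry fun s x => du s x - deriv (v s) x) 2
            (volume.restrict (cyl t)) ^ 2
      ≤ eLpNorm (fun x => u₀ x - v 0 x) 2 (volume.restrict Om) ^ 2
        + 4 * normLpL2 1 t r₁ ^ 2
        + ENNReal.ofReal ε * eLpNorm r₂ 2 (volume.restrict (Ioo 0 t)) ^ 2 := by
  set w : ℝ × ℝ → Vec m := fun z => u z.1 z.2 - v z.1 z.2 with hw
  set dw : ℝ × ℝ → Vec m := fun z => du z.1 z.2 - xderiv v z with hdw
  have hw2 : MemLp w 2 (volume.restrict (cyl T)) := hu.sub (memLp_lipschitz hv 2)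
  have hwt : MemLp (Function.uncurry fun s x => u s x - v s x) ⊤ (volume.restrict (cyl T)) :=
    hsol.bounded.sub (memLp_lipschitz hv ⊤)
  have hdw2 : MemLp dw 2 (volume.restrict (cyl T)) := hdu.sub (memLp_xderiv hv 2)
  have hu0 : MemLp (fun x => u₀ x - v 0 x) 2 (volume.restrict Om) := hu₀.sub (memLp_slice hv 0 2)
  set F : ℝ × ℝ → ℝ := fun z => inner ℝ (w z) (tderiv v z)
    + ε * inner ℝ (dw z) (A (du z.1 z.2)) + inner ℝ (w z) (B (xderiv v z)) with hF
  have iF : IntegrableOn F (cyl T) :=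
    ((integrable_inner_of_memLp hw2 (memLp_tderiv hv 2)).add
      ((integrable_inner_of_memLp hdw2 (A.comp_memLp' hdu)).const_mul ε)).add
      (integrable_inner_of_memLp hw2 (B.comp_memLp' (memLp_xderiv hv 2)))
  have iE : IntegrableOn (fun z => (1 / 2 * inner ℝ (w z) (w z) : ℝ)) (cyl T) :=
    (integrable_inner_of_memLp hw2 hw2).const_mul _
  have iD : IntegrableOn (fun z => ‖dw z‖ ^ 2) (cyl T) := hdw2.norm.integrable_sq
  have slice : ∀ {f : ℝ × ℝ → ℝ}, IntegrableOn f (cyl T) →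
      IntegrableOn (fun t => ∫ x in Om, f (t, x)) (Ioo 0 T) := fun {f} hf => by
    rw [cyl, IntegrableOn, Measure.volume_eq_prod, ← Measure.prod_restrict] at hf
    exact hf.integral_prod_left
  set c : ℝ := ∫ x in Om, ‖u₀ x - v 0 x‖ ^ 2 with hc
  have hc0 : 0 ≤ c := integral_nonneg fun x => sq_nonneg _
  -- The inequality on the cylinder becomes one in time alone by Fubini: `e` is half the squared
  -- `L²` norm of `w`, and `h` the space integral of `F`.
  have key := ae_add_integral_le hT (slice iE) (slice iF) (c := 1 / 2 * c) fun θ hθ hθ0 => by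
    have h := relative_entropy hT hB hu hdu hu₀ hsol hv hw hdw hH hθ hθ0
    obtain ⟨C, hC⟩ := hθ.exists_bound
    obtain ⟨C', hC'⟩ := hθ.exists_bound_deriv
    have i1 : IntegrableOn (fun z : ℝ × ℝ => deriv θ z.1 * (1 / 2 * inner ℝ (w z) (w z))
        - θ z.1 * F z) (cyl T) :=
      (iE.bdd_mul (c := C') (hθ.continuous_deriv.comp continuous_fst).aestronglyMeasurable
        (ae_of_all _ fun z => hC' z.1)).sub
      (iF.bdd_mul (c := C) (hθ.smooth.continuous.comp continuous_fst).aestronglyMeasurable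
        (ae_of_all _ fun z => hC z.1))
    have h1 : ∫ t in Ioo 0 T, (deriv θ t * (∫ x in Om, (1 / 2 * inner ℝ (w (t, x)) (w (t, x)) : ℝ))
        - θ t * ∫ x in Om, F (t, x)) = ∫ z in cyl T, (deriv θ z.1 * (1 / 2 * inner ℝ (w z) (w z))
        - θ z.1 * F z) := by
      refine Eq.trans (integral_congr_ae ?_) (integral_cyl i1)
      have iE' := iE
      have iF' := iF
      rw [cyl, IntegrableOn, Measure.volume_eq_prod, ← Measure.prod_restrict] at iE' iF'
      filter_upwards [iE'.prod_right_ae, iF'.prod_right_ae] with t ht1 ht2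
      rw [← integral_const_mul, ← integral_const_mul,
        integral_sub (ht1.const_mul _) (ht2.const_mul _)]
    have h2 : θ 0 * (1 / 2 * c)
        = ∫ x in Om, θ 0 * (1 / 2 * inner ℝ (u₀ x - v 0 x) (u₀ x - v 0 x) : ℝ) := by
      rw [integral_const_mul, integral_const_mul, hc]
      simp only [real_inner_self_eq_norm_sq]
    rw [h1, h2]
    exact h
  have hρm := aemeasurable_eLpNorm_slice hr₁.1
  have hρf : ∫⁻ s in Ioo 0 T, eLpNorm (r₁ s) 2 (volume.restrict Om) ≠ ⊤ := by
    have h := hr₁.2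
    rw [normLpL2, eLpNorm_one_eq_lintegral_enorm] at h
    simpa only [enorm_eq_self] using h.ne
  have iρ : IntegrableOn (fun s => (eLpNorm (r₁ s) 2 (volume.restrict Om)).toReal) (Ioo 0 T) :=
    integrable_toReal_of_lintegral_ne_top hρm hρf
  have hk2 : MemLp (fun s => ‖r₂ s‖) 2 (volume.restrict (Ioo 0 T)) := memLp_dual_norm hr₂
  have ik : IntegrableOn (fun s => ‖r₂ s‖ ^ 2) (Ioo 0 T) := hk2.integrable_sq
  obtain ⟨C, hC, hNC⟩ := ae_eLpNorm_slice_le hwt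
  have hrate := perturbed_ae hT.le hv hr₁ hr₂ hweak
  have hvt2 : ∀ t, MemLp (fun x => tderiv v (t, x)) 2 (volume.restrict Om) := fun t =>
    (memLp_top_of_bound ((stronglyMeasurable_tderiv hv).comp_measurable
      measurable_prodMk_left).aestronglyMeasurable K (ae_of_all _ fun x =>
        norm_tderiv_le hv (t, x))).mono_exponent le_top
  have hvx2 : ∀ t, MemLp (fun x => xderiv v (t, x)) 2 (volume.restrict Om) := fun t =>
    (memLp_top_of_bound ((stronglyMeasurable_xderiv hv).comp_measurable
      measurable_prodMk_left).aestronglyMeasurable K (ae_of_all _ fun x =>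
        norm_xderiv_le hv (t, x))).mono_exponent le_top
  have hbounds : ∀ᵐ s ∂(volume.restrict (Ioo 0 T)),
      (-((eLpNorm (fun x => u s x - v s x) 2 (volume.restrict Om)).toReal
          * (eLpNorm (r₁ s) 2 (volume.restrict Om)).toReal) - ε / 3 * ‖r₂ s‖ ^ 2
        ≤ ∫ x in Om, F (s, x))
      ∧ (ε / 2 * (∫ x in Om, ‖dw (s, x)‖ ^ 2)
        - (eLpNorm (fun x => u s x - v s x) 2 (volume.restrict Om)).toReal
          * (eLpNorm (r₁ s) 2 (volume.restrict Om)).toReal - 2 * ε / 3 * ‖r₂ s‖ ^ 2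
        ≤ ∫ x in Om, F (s, x)) := by
    filter_upwards [hrate, hH, hr₁.ae_memLp] with s h1 h2 h3
    exact relative_entropy_rate_bounds hε (B := B) hA (du := du s) h2 (hvt2 s) (hvx2 s) h3
      (fun x => (sub_add_cancel _ _).symm) h1
  have hen : ∀ᵐ s ∂(volume.restrict (Ioo 0 T)),
      ∫ x in Om, (1 / 2 * inner ℝ (w (s, x)) (w (s, x)) : ℝ)
        = 1 / 2 * (eLpNorm (fun x => u s x - v s x) 2 (volume.restrict Om)).toReal ^ 2 := by
    filter_upwards [MemLp.ae_slice hw2] with s hs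
    rw [integral_const_mul, ← ENNReal.toReal_pow, MemLp.eLpNorm_two_sq hs, ENNReal.toReal_ofReal
      (integral_nonneg fun x => sq_nonneg _)]
    simp only [real_inner_self_eq_norm_sq]
  have hkey : ∀ᵐ s ∂(volume.restrict (Ioo 0 T)),
      1 / 2 * (eLpNorm (fun x => u s x - v s x) 2 (volume.restrict Om)).toReal ^ 2
        + ∫ r in Ioo 0 s, ∫ x in Om, F (r, x) ≤ 1 / 2 * c := by
    filter_upwards [key, hen] with s h1 h2
    rw [← h2]
    exact h1
  filter_upwards [hkey, ae_restrict_mem measurableSet_Ioo] with t ht htm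
  have hsub : Ioo 0 t ⊆ Ioo 0 T := Ioo_subset_Ioo_right htm.2.le
  have hcyl : cyl t ⊆ cyl T := prod_mono hsub subset_rfl
  set M : ℝ≥0∞ := normLpL2 ⊤ t (fun s x => u s x - v s x) with hM
  have hM' : M = essSup (fun s => eLpNorm (fun x => u s x - v s x) 2 (volume.restrict Om))
      (volume.restrict (Ioo 0 t)) := by
    rw [hM, normLpL2, eLpNorm_exponent_top, eLpNormEssSup_eq_essSup_enorm]
    simp only [enorm_eq_self]
  have hMs : ∀ C : ℝ≥0∞, (∀ᵐ s ∂(volume.restrict (Ioo 0 t)),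
      eLpNorm (fun x => u s x - v s x) 2 (volume.restrict Om) ≤ C) → M ≤ C := fun C h => by
    rw [hM']
    exact essSup_le_of_ae_le C h
  have hMt : M ≠ ⊤ :=
    ne_top_of_le_ne_top hC (hMs C (ae_restrict_of_ae_restrict_of_subset hsub hNC))
  have hNt : ∀ᵐ s ∂(volume.restrict (Ioo 0 t)),
      eLpNorm (fun x => u s x - v s x) 2 (volume.restrict Om) ≤ M := by
    rw [hM']
    exact ae_le_essSup
  have main := gronwall_L1 (M := M.toReal) (c := c) hε hc0 ENNReal.toReal_nonneg
    (N := fun s => (eLpNorm (fun x => u s x - v s x) 2 (volume.restrict Om)).toReal)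
    (k := fun s => ‖r₂ s‖) (D := fun s => ∫ x in Om, ‖dw (s, x)‖ ^ 2)
    (hNt.mono fun s hs => ENNReal.toReal_mono hMt hs)
    (iρ.mono_set hsub) (fun s => ENNReal.toReal_nonneg) (ik.mono_set hsub)
    ((slice iD).mono_set hsub) ((slice iF).mono_set hsub)
    (ae_restrict_of_ae_restrict_of_subset hsub (hbounds.mono fun s hs => hs.1))
    (ae_restrict_of_ae_restrict_of_subset hsub (hbounds.mono fun s hs => hs.2))
    (ae_restrict_of_ae_restrict_of_subset hsub hkey) ht fun C hC h => by
      refine ENNReal.toReal_le_of_le_ofReal hC (hMs _ ?_)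
      filter_upwards [h, hNt] with s h1 h2
      exact (ENNReal.le_ofReal_iff_toReal_le (ne_top_of_le_ne_top hMt h2) hC).2 h1
  have a1 : M ^ 2 = ENNReal.ofReal (M.toReal ^ 2) := by
    rw [ENNReal.ofReal_pow ENNReal.toReal_nonneg, ENNReal.ofReal_toReal hMt]
  have a2 : eLpNorm (Function.uncurry fun s x => du s x - deriv (v s) x) 2
      (volume.restrict (cyl t)) ^ 2
      = ENNReal.ofReal (∫ s in Ioo 0 t, ∫ x in Om, ‖dw (s, x)‖ ^ 2) := by
    rw [integral_cyl (iD.mono_set hcyl)]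
    exact MemLp.eLpNorm_two_sq (hdw2.mono_measure (Measure.restrict_mono hcyl le_rfl))
  have a3 : eLpNorm (fun x => u₀ x - v 0 x) 2 (volume.restrict Om) ^ 2 = ENNReal.ofReal c :=
    MemLp.eLpNorm_two_sq hu0
  have a4 : normLpL2 1 t r₁ = ENNReal.ofReal
      (∫ s in Ioo 0 t, (eLpNorm (r₁ s) 2 (volume.restrict Om)).toReal) := by
    have hf : ∫⁻ s in Ioo 0 t, eLpNorm (r₁ s) 2 (volume.restrict Om) ≠ ⊤ :=
      ne_top_of_le_ne_top hρf (lintegral_mono_set hsub)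
    have hm := hρm.mono_measure (Measure.restrict_mono hsub le_rfl)
    rw [integral_toReal hm (ae_lt_top' hm hf), ENNReal.ofReal_toReal hf, normLpL2,
      eLpNorm_one_eq_lintegral_enorm]
    simp only [enorm_eq_self]
  have a5 : eLpNorm r₂ 2 (volume.restrict (Ioo 0 t)) ^ 2
      = ENNReal.ofReal (∫ s in Ioo 0 t, ‖r₂ s‖ ^ 2) := by
    exact MemLp.eLpNorm_two_sq_dual (memLp_mono_restrict_dual hr₂ hsub)
  have p1 : 0 ≤ ∫ s in Ioo 0 t, ∫ x in Om, ‖dw (s, x)‖ ^ 2 :=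
    integral_nonneg fun s => integral_nonneg fun x => sq_nonneg _
  have p2 : 0 ≤ ∫ s in Ioo 0 t, (eLpNorm (r₁ s) 2 (volume.restrict Om)).toReal :=
    integral_nonneg fun s => ENNReal.toReal_nonneg
  have p3 : 0 ≤ ∫ s in Ioo 0 t, ‖r₂ s‖ ^ 2 := integral_nonneg fun s => sq_nonneg _
  rw [a1, a2, a3, a4, a5]
  exact ofReal_bound hε p1 hc0 p2 p3 main

end Bound


/-! ### Independence of the values outside the closed cylinder -/

section Extension

open Filter Topology

variable {m : ℕ} {T ε : ℝ}

theorem deriv_eq_of_eqOn_rectangle {v v' : ℝ → ℝ → Vec m}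
    (h : EqOn (Function.uncurry v) (Function.uncurry v') (Icc 0 T ×ˢ Icc 0 1)) {t x : ℝ}
    (ht : t ∈ Ioo 0 T) (hx : x ∈ Om) : deriv (v t) x = deriv (v' t) x := by
  refine EventuallyEq.deriv_eq ?_
  filter_upwards [isOpen_Ioo.mem_nhds hx] with y hy
  exact h (x := (t, y)) ⟨Ioo_subset_Icc_self ht, Ioo_subset_Icc_self hy⟩

/-- Only values on the closed rectangle enter: `∂ₓv` is evaluated at interior points of `Ω`, where
it is determined by nearby values on the same time slice. -/
theorem IsPerturbedSolution.congr {f : Vec m → Vec m} {A : Vec m → Vec m →L[ℝ] Vec m}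
    {r₁ : ℝ → ℝ → Vec m} {r₂ : ℝ → Hneg1 m} {v v' : ℝ → ℝ → Vec m} {v₀ : ℝ → Vec m} (hT : 0 < T)
    (hsol : IsPerturbedSolution T ε f A r₁ r₂ v v₀)
    (h : EqOn (Function.uncurry v) (Function.uncurry v') (Icc 0 T ×ˢ Icc 0 1)) :
    IsPerturbedSolution T ε f A r₁ r₂ v' v₀ := by
  obtain ⟨K, hK⟩ := hsol.lipschitz
  refine ⟨⟨K, fun z hz y hy => by
    rw [← h hz, ← h hy]
    exact hK hz hy⟩, fun x hx => ?_, fun φ hφ => ?_⟩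
  · rw [← hsol.initial x hx]
    exact (h (x := (0, x)) ⟨left_mem_Icc.2 hT.le, hx⟩).symm
  · refine Eq.trans ?_ (hsol.weak φ hφ)
    congr 2
    refine setIntegral_congr_fun measurableSet_Ioo fun t ht =>
      setIntegral_congr_fun measurableSet_Om fun x hx => ?_
    have h1 : v t x = v' t x :=
      h (x := (t, x)) ⟨Ioo_subset_Icc_self ht, Ioo_subset_Icc_self hx⟩
    simp only [h1, deriv_eq_of_eqOn_rectangle h ht hx]

theorem normLpL2_congr {p : ℝ≥0∞} {t : ℝ} {f g : ℝ → ℝ → Vec m}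
    (h : ∀ s ∈ Ioo 0 t, ∀ x ∈ Om, f s x = g s x) : normLpL2 p t f = normLpL2 p t g := by
  refine eLpNorm_congr_ae ?_
  filter_upwards [ae_restrict_mem measurableSet_Ioo] with s hs
  refine eLpNorm_congr_ae ?_
  filter_upwards [ae_restrict_mem measurableSet_Om] with x hx using h s hs x hx

end Extension

end ConvDiff

/-! ### Conclusion: extension of the Lipschitz solution and transfer of the bound -/

theorem mainTheorem5 (m : ℕ) (T ε : ℝ) (hT : 0 < T) (hε : 0 < ε)
    -- the system: `B` diagonal, `A` positive definite with smallest eigenvalue `1`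
    (B A : Matrix (Fin m) (Fin m) ℝ) (hB : B.IsDiag)
    (hA : A.PosDef) (hA1 : IsLeast (spectrum ℝ A) 1)
    -- Dirichlet data in `W^{1,∞}((0,T) × ∂Ω; ℝᵐ)`
    (gD : ℝ → ℝ → ConvDiff.Vec m)
    (hgD : ∀ x ∈ frontier ConvDiff.Om, ∃ K, LipschitzOnWith K (fun t => gD t x) (Ioo 0 T))
    -- the entropy solution `u`, with `du = ∂ₓu`
    (u₀ : ℝ → ConvDiff.Vec m) (hu₀ : ConvDiff.MemH1 u₀)
    (u du : ℝ → ℝ → ConvDiff.Vec m) (hu : ConvDiff.MemL2H1 T u du)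
    (hu_sol : ConvDiff.IsEntropySolution T ε (ConvDiff.mulOp B) (fun _ => ConvDiff.mulOp A)
      ConvDiff.quadEntropy (ConvDiff.quadFlux B) u du u₀)
    (hu_bdry : ∀ᵐ t ∂(volume.restrict (Ioo 0 T)), ConvDiff.HasTrace (u t) (gD t))
    -- the residuals
    (r₁ : ℝ → ℝ → ConvDiff.Vec m) (hr₁ : ConvDiff.MemLpL2 1 T r₁)
    (r₂ : ℝ → ConvDiff.Hneg1 m) (hr₂ : MemLp r₂ 2 (volume.restrict (Ioo 0 T)))
    -- the Lipschitz solution `v` of the perturbed system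
    (v₀ : ℝ → ConvDiff.Vec m) (hv₀ : ∃ K, LipschitzOnWith K v₀ (Icc 0 1))
    (v : ℝ → ℝ → ConvDiff.Vec m)
    (hv_sol : ConvDiff.IsPerturbedSolution T ε (ConvDiff.mulOp B) (fun _ => ConvDiff.mulOp A)
      r₁ r₂ v v₀)
    (hv_bdry : ∀ t ∈ Ioo 0 T, ∀ x ∈ frontier ConvDiff.Om, v t x = gD t x) :
    ∀ᵐ t ∂(volume.restrict (Ioo 0 T)),
      (1 / 4 : ℝ≥0∞) * ConvDiff.normLpL2 (∞ : ℝ≥0∞) t (fun s x => u s x - v s x) ^ 2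
        + ENNReal.ofReal (ε / 2) *
          eLpNorm (Function.uncurry fun s x => du s x - deriv (v s) x) 2
            (volume.restrict (ConvDiff.cyl t)) ^ 2
      ≤ eLpNorm (fun x => u₀ x - v₀ x) 2 (volume.restrict ConvDiff.Om) ^ 2
        + 4 * ConvDiff.normLpL2 1 t r₁ ^ 2
        + ENNReal.ofReal ε * eLpNorm r₂ 2 (volume.restrict (Ioo 0 t)) ^ 2 := by
  obtain ⟨K, hK⟩ := hv_sol.lipschitz
  -- A Lipschitz extension to the plane makes mollification possible up to the boundary of the
  -- cylinder and up to time `0`.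
  obtain ⟨v', hv', hvv'⟩ := hK.extend_finite_dimension
  have heq : EqOn (Function.uncurry v) (Function.uncurry fun t x => v' (t, x))
      (Icc 0 T ×ˢ Icc 0 1) := hvv'
  have hsol' := hv_sol.congr hT heq
  have hH : ∀ᵐ t ∂(volume.restrict (Ioo 0 T)),
      ConvDiff.IsH10 (fun x => u t x - v' (t, x))
        (fun x => du t x - deriv (fun y => v' (t, y)) x) := by
    filter_upwards [ConvDiff.MemLp.ae_slice hu.memLp, ConvDiff.MemLp.ae_slice hu.memLp_deriv,
      hu.weakDeriv, hu_bdry, ae_restrict_mem measurableSet_Ioo] with t h1 h2 h3 h4 ht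
    refine ConvDiff.isH10_sub_of_lipschitz (h1.integrable one_le_two) h2 h3 h4
      (ConvDiff.lipschitz_snd (v := fun t x => v' (t, x)) hv' t) fun x hx => ?_
    rw [← hv_bdry t ht x hx]
    refine (hvv' (x := (t, x)) ⟨Ioo_subset_Icc_self ht, ?_⟩).symm
    rw [ConvDiff.frontier_Om] at hx
    rcases hx with rfl | rfl <;> simp
  have main := ConvDiff.relative_entropy_bound (v := fun t x => v' (t, x)) hT hε
    (ConvDiff.inner_mulOp_of_isDiag hB) (ConvDiff.norm_sq_le_inner_mulOp hA hA1)
    hu.memLp hu.memLp_deriv hu₀.1 hu_sol hv' hH hr₁ hr₂ hsol'.weak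
  filter_upwards [main, ae_restrict_mem measurableSet_Ioo] with t ht htm
  have hsub : ∀ {s}, s ∈ Ioo 0 t → s ∈ Ioo 0 T := fun hs => ⟨hs.1, hs.2.trans htm.2⟩
  have e1 : ConvDiff.normLpL2 (∞ : ℝ≥0∞) t (fun s x => u s x - v s x)
      = ConvDiff.normLpL2 (∞ : ℝ≥0∞) t (fun s x => u s x - v' (s, x)) :=
    ConvDiff.normLpL2_congr fun s hs x hx => congrArg _
      (hvv' (x := (s, x)) ⟨Ioo_subset_Icc_self (hsub hs), Ioo_subset_Icc_self hx⟩)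
  have e2 : eLpNorm (Function.uncurry fun s x => du s x - deriv (v s) x) 2
        (volume.restrict (ConvDiff.cyl t))
      = eLpNorm (Function.uncurry fun s x => du s x - deriv (fun y => v' (s, y)) x) 2
        (volume.restrict (ConvDiff.cyl t)) := by
    refine eLpNorm_congr_ae ?_
    filter_upwards [ae_restrict_mem (ConvDiff.measurableSet_cyl t)] with z hz
    exact congrArg _ (ConvDiff.deriv_eq_of_eqOn_rectangle heq (hsub hz.1) hz.2)
  have e3 : eLpNorm (fun x => u₀ x - v₀ x) 2 (volume.restrict ConvDiff.Om)
      = eLpNorm (fun x => u₀ x - v' (0, x)) 2 (volume.restrict ConvDiff.Om) := by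
    refine eLpNorm_congr_ae ?_
    filter_upwards [ae_restrict_mem ConvDiff.measurableSet_Om] with x hx
    exact congrArg _ (hsol'.initial x (Ioo_subset_Icc_self hx)).symm
  rw [e1, e2, e3]
  exact ht
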